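/- **Conventions.** $\mathcal S'(\mathbb R^d)$, the space of tempered distributions, carries the weak-$*$ topology; $\widehat f(\xi)=\int f(x)e^{-2\pi i x\xi}\,dx$; $\pi(t,\nu)f(x)=e^{2\pi i\nu x}f(x-t)$; $\mathfrak g(x)=2^{1/4}e^{-\pi x^2}$; and $V_{\mathfrak g}f(t,\nu)=\langle f,\pi(t,\nu)\mathfrak g\rangle$ for $f\in\mathcal S'(\mathbb R)$, the pairing being antilinear in the second argument. *Weights.* A submultiplicative weight is a locally integrable $v:\mathbb R^2\to[0,\infty)$ with $v(z+z')\le v(z)v(z')$. A locally integrable $w:\mathbb R^2\to[0,\infty)$ is moderate if $w(z+z')\le C\,w(z)v(z')$ for some $C>0$ and some submultiplicative weight $v$, and it is subexponential if it is moderate and there are $\gamma,C>0$ and $0<\beta<1$ with $C^{-1}e^{-\gamma\|z\|_\infty^\beta}\le w(z)\le Ce^{\gamma\|z\|_\infty^\beta}$ for all $z\in\mathbb R^2$. *Norms.* For $1\le p,q\le\infty$ put $$\|F\|_{L^{p,q}_w}=\Big(\int\Big(\int|w(x,\xi)F(x,\xi)|^p\,dx\Big)^{q/p}d\xi\Big)^{1/q}$$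 (with the usual changes if $p=\infty$ or $q=\infty$), $\|f\|_{M^{p,q}_w}=\|V_{\mathfrak g}f\|_{L^{p,q}_w}$ and $M^{p,q}_w(\mathbb R)=\{f\in\mathcal S'(\mathbb R):\|f\|_{M^{p,q}_w}<\infty\}$; $M^{\infty,\infty}(\mathbb R)$ is the case $p=q=\infty$, $w\equiv1$. *Operators.* A continuous linear operator $H:\mathcal S(\mathbb R)\to\mathcal S'(\mathbb R)$ has a unique Kohn--Nirenberg symbol $\sigma_H\in\mathcal S'(\mathbb R^2)$, determined by $Hf(x)=\int\sigma_H(x,\xi)\widehat f(\xi)e^{2\pi ix\xi}\,d\xi$ in the sense of distributions. Let $\mathcal F^s$ be the symplectic Fourier transform, $\mathcal F^sF(t,\nu)=\iint F(x,\xi)e^{-2\pi i(\nu x-\xi t)}\,dx\,d\xi$, extended to $\mathcal S'(\mathbb R^2)$ by duality. For $M\subseteq\mathbb R^2$, the operator Paley--Wiener space $OPW^{p,q}_w(M)$ consists of all such $H$ for which $\operatorname{supp}\mathcal F^s\sigma_H\subseteq M$ and $\sigma_H$ is a function in $L^{p,q}_w(\mathbb R^2)$; its norm is $\|H\|_{OPW^{p,q}_w}=\|\sigma_H\|_{L^{p,q}_w}$.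 If $M$ is bounded, every $H\in OPW^{p,q}_w(M)$ has a unique weak-$*$ continuous extension $\mathcal S'(\mathbb R)\to\mathcal S'(\mathbb R)$, and for $g\in\mathcal S'(\mathbb R)$ the value of this extension at $g$ is denoted $Hg$. *Identifiability.* $OPW^{p,q}_w(M)$, mapping $M^{\infty,\infty}(\mathbb R)$ to $M^{p,q}_w(\mathbb R)$, is identifiable if there are $g\in M^{\infty,\infty}(\mathbb R)$ and $A,B>0$ with $$A\,\|H\|_{OPW^{p,q}_w}\le\|Hg\|_{M^{p,q}_w}\le B\,\|H\|_{OPW^{p,q}_w}\qquad\text{for all }H\in OPW^{p,q}_w(M).$$ *Inner content.* For integers $K,L\ge1$ let $R_{K,L}=[0,\tfrac1K)\times[0,\tfrac KL)$, and let $\mathcal U_{K,L}$ be the family of all finite unions of sets $R_{K,L}+(\tfrac kK,\tfrac{pK}L)$ with $k,p\in\mathbb Z$. The inner Jordan content of a bounded set $M\subseteq\mathbb R^2$ is $\operatorname{vol}^-(M)=\sup\{\mu(U):U\subseteq M,\ U\in\mathcal U_{K,L}\text{ for some }K,L\ge1\}$, where $\mu$ is Lebesgue measure (and $\operatorname{vol}^-(M)=0$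 if no nonempty such $U$ exists). **Theorem.** Let $1\le p,q\le\infty$, let $w$ be a subexponential weight on $\mathbb R^2$, and let $M\subseteq\mathbb R^2$ be a bounded set with $\operatorname{vol}^-(M)>1$. Then $OPW^{p,q}_w(M)$, mapping $M^{\infty,\infty}(\mathbb R)$ to $M^{p,q}_w(\mathbb R)$, is not identifiable. In fact, for every $g\in M^{\infty,\infty}(\mathbb R)$ the map $H\mapsto Hg$ is not bounded below: there is no $A>0$ such that $\|Hg\|_{M^{p,q}_w}\ge A\,\|H\|_{OPW^{p,q}_w}$ for all $H\in OPW^{p,q}_w(M)$. -/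

import Mathlib

open SchwartzMap MeasureTheory
open scoped ENNReal NNReal FourierTransform

noncomputable section

namespace OperatorSampling

/-! ### Schwartz functions used in the definitions -/

section Schwartz

open scoped ContDiff

/-- The character `x ↦ exp (2 π i x)`. -/
def expi (x : ℝ) : ℂ := Complex.exp (2 * Real.pi * Complex.I * x)

theorem hasTemperateGrowth_expi : expi.HasTemperateGrowth := by
  have hc : ContDiff ℝ ∞ expi := by
    unfold expi
    exact Complex.contDiff_exp.comp (contDiff_const.mul Complex.ofRealCLM.contDiff)
  have hd (x : ℝ) : HasDerivAt expi (2 * Real.pi * Complex.I * expi x) x := by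
    have h1 : HasDerivAt (fun y : ℝ => 2 * Real.pi * Complex.I * (y : ℂ))
        (2 * Real.pi * Complex.I * 1) x := (Complex.ofRealCLM.hasDerivAt (x := x)).const_mul _
    have h2 : HasDerivAt expi (expi x * (2 * Real.pi * Complex.I * 1)) x := h1.cexp
    convert h2 using 1
    ring
  have hn (n : ℕ) : iteratedDeriv n expi = fun x => (2 * Real.pi * Complex.I) ^ n * expi x := by
    induction n with
    | zero => simp
    | succ n ih =>
      rw [iteratedDeriv_succ, ih]
      funext x
      rw [((hd x).const_mul _).deriv]
      ring
  have hnorm (x : ℝ) : ‖expi x‖ = 1 := by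
    have : (2 * Real.pi * Complex.I * x : ℂ) = ((2 * Real.pi * x : ℝ) : ℂ) * Complex.I := by
      push_cast; ring
    rw [expi, this, Complex.norm_exp_ofReal_mul_I]
  refine ⟨hc, fun n => ⟨0, ‖(2 * Real.pi * Complex.I : ℂ)‖ ^ n, fun x => ?_⟩⟩
  rw [norm_iteratedFDeriv_eq_norm_iteratedDeriv, hn]
  simp [hnorm]

theorem hasTemperateGrowth_expi_linear (ν : ℝ) :
    (fun x : ℝ => expi (ν * x)).HasTemperateGrowth :=
  hasTemperateGrowth_expi.comp
    ((Function.HasTemperateGrowth.const ν).mul Function.HasTemperateGrowth.id')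

theorem hasTemperateGrowth_expi_chirp :
    (fun z : ℝ × ℝ => expi (z.1 * z.2)).HasTemperateGrowth :=
  hasTemperateGrowth_expi.comp
    ((ContinuousLinearMap.fst ℝ ℝ ℝ).hasTemperateGrowth.mul
      (ContinuousLinearMap.snd ℝ ℝ ℝ).hasTemperateGrowth)

/-- The time-frequency shift `π(t, ν) = M_ν T_t`, that is
`π(t, ν) f (x) = exp (2 π i ν x) f (x - t)`. -/
def timeFreqShift (t ν : ℝ) : 𝓢(ℝ, ℂ) →L[ℂ] 𝓢(ℝ, ℂ) :=
  smulLeftCLM ℂ (fun x : ℝ => expi (ν * x)) ∘L compSubConstCLM ℂ t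

theorem timeFreqShift_apply (t ν : ℝ) (f : 𝓢(ℝ, ℂ)) (x : ℝ) :
    timeFreqShift t ν f x = expi (ν * x) * f (x - t) := by
  simp [timeFreqShift, hasTemperateGrowth_expi_linear]

theorem gaussian_decay (k n : ℕ) : ∃ C : ℝ, ∀ x : ℝ, ‖x‖ ^ k * ‖iteratedFDeriv ℝ n
    (fun x : ℝ => (((2 : ℝ) ^ (1 / 4 : ℝ) * Real.exp (-Real.pi * x ^ 2) : ℝ) : ℂ)) x‖ ≤ C := by
  set c : ℝ := (2 : ℝ) ^ (1 / 4 : ℝ)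
  have hn (n : ℕ) : ∃ p : Polynomial ℝ, iteratedDeriv n
      (fun x : ℝ => (((c * Real.exp (-Real.pi * x ^ 2) : ℝ)) : ℂ)) =
      fun x : ℝ => (((p.eval x * Real.exp (-Real.pi * x ^ 2) : ℝ)) : ℂ) := by
    induction n with
    | zero => exact ⟨Polynomial.C c, by simp⟩
    | succ n ih =>
      obtain ⟨p, hp⟩ := ih
      refine ⟨p.derivative - Polynomial.C (2 * Real.pi) * Polynomial.X * p, ?_⟩
      rw [iteratedDeriv_succ, hp]
      funext x
      have h1 : HasDerivAt (fun x : ℝ => Real.exp (-Real.pi * x ^ 2))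
          (Real.exp (-Real.pi * x ^ 2) * (-Real.pi * (2 * x))) x := by
        have := ((hasDerivAt_pow 2 x).const_mul (-Real.pi)).exp
        simpa using this
      have h2 := ((p.hasDerivAt x).mul h1).ofReal_comp
      refine h2.deriv.trans ?_
      simp
      ring
  obtain ⟨p, hp⟩ := hn n
  have key (q : Polynomial ℝ) :
      ∃ C : ℝ, ∀ x : ℝ, |q.eval x| * Real.exp (-Real.pi * x ^ 2) ≤ C := by
    induction q using Polynomial.induction_on' with
    | add p q hp hq =>
      obtain ⟨A, hA⟩ := hp
      obtain ⟨B, hB⟩ := hq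
      refine ⟨A + B, fun x => ?_⟩
      rw [Polynomial.eval_add]
      calc _ ≤ (|p.eval x| + |q.eval x|) * Real.exp (-Real.pi * x ^ 2) := by
            gcongr; exact abs_add_le _ _
        _ ≤ A + B := by rw [add_mul]; exact add_le_add (hA x) (hB x)
    | monomial m a =>
      refine ⟨|a| * ((m.factorial : ℝ) * Real.exp 1), fun x => ?_⟩
      have hpi : (1 : ℝ) ≤ Real.pi := by linarith [Real.pi_gt_three]
      have hx : |x| ≤ 1 + x ^ 2 := by nlinarith [sq_abs x, sq_nonneg (|x| - 1), abs_nonneg x]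
      have h1 : |x| ^ m ≤ (1 + x ^ 2) ^ m := by gcongr
      have h2 : (1 + x ^ 2) ^ m / m.factorial ≤ Real.exp (1 + x ^ 2) :=
        Real.pow_div_factorial_le_exp _ (by positivity) m
      have hm : (0 : ℝ) < m.factorial := by positivity
      rw [div_le_iff₀ hm] at h2
      have h3 : Real.exp (-Real.pi * x ^ 2) ≤ Real.exp (-(x ^ 2)) := by
        apply Real.exp_le_exp.mpr; nlinarith [sq_nonneg x]
      rw [Polynomial.eval_monomial, abs_mul, abs_pow, mul_assoc]
      refine mul_le_mul_of_nonneg_left ?_ (abs_nonneg a)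
      calc |x| ^ m * Real.exp (-Real.pi * x ^ 2)
          ≤ (Real.exp (1 + x ^ 2) * m.factorial) * Real.exp (-(x ^ 2)) := by
            gcongr; exact h1.trans h2
        _ = m.factorial * (Real.exp (1 + x ^ 2) * Real.exp (-(x ^ 2))) := by ring
        _ = m.factorial * Real.exp 1 := by rw [← Real.exp_add]; congr 2; ring
  obtain ⟨C, hC⟩ := key (Polynomial.X ^ k * p)
  refine ⟨C, fun x => ?_⟩
  rw [norm_iteratedFDeriv_eq_norm_iteratedDeriv, hp]
  have := hC x
  rw [Polynomial.eval_mul, Polynomial.eval_pow, Polynomial.eval_X, abs_mul, abs_pow,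
    mul_assoc] at this
  simpa only [Complex.norm_real, norm_mul, Real.norm_eq_abs, Real.abs_exp] using this

/-- The normalized Gaussian `x ↦ 2 ^ (1 / 4) exp (- π x ^ 2)`. -/
def gaussian : 𝓢(ℝ, ℂ) where
  toFun x := (((2 : ℝ) ^ (1 / 4 : ℝ) * Real.exp (-Real.pi * x ^ 2) : ℝ) : ℂ)
  smooth' := by
    have h : ContDiff ℝ ∞ (fun x : ℝ => Real.exp (-Real.pi * x ^ 2)) :=
      Real.contDiff_exp.comp (contDiff_const.mul (contDiff_id.pow 2))
    exact Complex.ofRealCLM.contDiff.comp (contDiff_const.mul h)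
  decay' := gaussian_decay

/-- The tensor product `(x, ξ) ↦ φ x * ψ ξ`. -/
def tensor (φ ψ : 𝓢(ℝ, ℂ)) : 𝓢(ℝ × ℝ, ℂ) where
  toFun z := φ z.1 * ψ z.2
  smooth' := ((φ.smooth ⊤).comp contDiff_fst).mul ((ψ.smooth ⊤).comp contDiff_snd)
  decay' k n := by
    have hφ (i : ℕ) (z : ℝ × ℝ) :
        ‖iteratedFDeriv ℝ i (fun z : ℝ × ℝ => φ z.1) z‖ ≤ ‖iteratedFDeriv ℝ i φ z.1‖ := by
      have h := (ContinuousLinearMap.fst ℝ ℝ ℝ).iteratedFDeriv_comp_right (φ.smooth ⊤) z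
        (i := i) (by exact_mod_cast le_top)
      have h' : iteratedFDeriv ℝ i (fun z : ℝ × ℝ => φ z.1) z = _ := h
      rw [h']
      refine (ContinuousMultilinearMap.norm_compContinuousLinearMap_le _ _).trans ?_
      refine mul_le_of_le_one_right (norm_nonneg _) ?_
      exact Finset.prod_le_one (fun _ _ => norm_nonneg _)
        (fun _ _ => ContinuousLinearMap.norm_fst_le ℝ ℝ ℝ)
    have hψ (i : ℕ) (z : ℝ × ℝ) :
        ‖iteratedFDeriv ℝ i (fun z : ℝ × ℝ => ψ z.2) z‖ ≤ ‖iteratedFDeriv ℝ i ψ z.2‖ := by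
      have h := (ContinuousLinearMap.snd ℝ ℝ ℝ).iteratedFDeriv_comp_right (ψ.smooth ⊤) z
        (i := i) (by exact_mod_cast le_top)
      have h' : iteratedFDeriv ℝ i (fun z : ℝ × ℝ => ψ z.2) z = _ := h
      rw [h']
      refine (ContinuousMultilinearMap.norm_compContinuousLinearMap_le _ _).trans ?_
      refine mul_le_of_le_one_right (norm_nonneg _) ?_
      exact Finset.prod_le_one (fun _ _ => norm_nonneg _)
        (fun _ _ => ContinuousLinearMap.norm_snd_le ℝ ℝ ℝ)
    choose A hA0 hA using fun k i => φ.decay k i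
    choose B hB0 hB using fun k i => ψ.decay k i
    refine ⟨∑ i ∈ Finset.range (n + 1), (n.choose i : ℝ) *
      (A k i * B 0 (n - i) + A 0 i * B k (n - i)), fun z => ?_⟩
    have hmul := norm_iteratedFDeriv_mul_le (𝕜 := ℝ) (N := ∞)
      ((φ.smooth ⊤).comp contDiff_fst : ContDiff ℝ ∞ (fun z : ℝ × ℝ => φ z.1))
      ((ψ.smooth ⊤).comp contDiff_snd : ContDiff ℝ ∞ (fun z : ℝ × ℝ => ψ z.2)) z
      (n := n) (by exact_mod_cast le_top)
    have hz : ‖z‖ ^ k ≤ ‖z.1‖ ^ k + ‖z.2‖ ^ k := by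
      rcases max_cases ‖z.1‖ ‖z.2‖ with h | h
      · rw [Prod.norm_def, h.1]; exact le_add_of_nonneg_right (by positivity)
      · rw [Prod.norm_def, h.1]; exact le_add_of_nonneg_left (by positivity)
    refine (mul_le_mul_of_nonneg_left hmul (by positivity)).trans ?_
    rw [Finset.mul_sum]
    refine Finset.sum_le_sum fun i _ => ?_
    have a0 := hA 0 i z.1
    have ak := hA k i z.1
    have b0 := hB 0 (n - i) z.2
    have bk := hB k (n - i) z.2
    rw [pow_zero, one_mul] at a0 b0
    calc ‖z‖ ^ k * ((n.choose i : ℝ) * ‖iteratedFDeriv ℝ i (fun z : ℝ × ℝ => φ z.1) z‖ *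
          ‖iteratedFDeriv ℝ (n - i) (fun z : ℝ × ℝ => ψ z.2) z‖)
        ≤ (‖z.1‖ ^ k + ‖z.2‖ ^ k) * ((n.choose i : ℝ) * ‖iteratedFDeriv ℝ i φ z.1‖ *
          ‖iteratedFDeriv ℝ (n - i) ψ z.2‖) := by
          gcongr
          · exact hφ i z
          · exact hψ (n - i) z
      _ = (n.choose i : ℝ) * ((‖z.1‖ ^ k * ‖iteratedFDeriv ℝ i φ z.1‖) *
            ‖iteratedFDeriv ℝ (n - i) ψ z.2‖ + ‖iteratedFDeriv ℝ i φ z.1‖ *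
            (‖z.2‖ ^ k * ‖iteratedFDeriv ℝ (n - i) ψ z.2‖)) := by ring
      _ ≤ _ := by
          have := hA0 k i
          have := hA0 0 i
          gcongr

end Schwartz

/-! ### Mixed norms, weights, modulation spaces -/

/-- The norm `‖w F‖_{L^{p,q}(ℝ²)}`: the `L^p` norm in the first variable is taken first, then the
`L^q` norm in the second variable. -/
def mixedNorm (p q : ℝ≥0∞) (w : ℝ × ℝ → ℝ) (F : ℝ × ℝ → ℂ) : ℝ≥0∞ :=
  eLpNorm (fun ξ : ℝ => eLpNorm (fun x : ℝ => (w (x, ξ) : ℂ) * F (x, ξ)) p volume) q volume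

/-- A submultiplicative weight on `ℝ²`. -/
structure IsSubmultiplicativeWeight (v : ℝ × ℝ → ℝ) : Prop where
  locallyIntegrable : LocallyIntegrable v volume
  nonneg : ∀ z, 0 ≤ v z
  submul : ∀ z z', v (z + z') ≤ v z * v z'

/-- A moderate weight on `ℝ²`. -/
structure IsModerateWeight (w : ℝ × ℝ → ℝ) : Prop where
  locallyIntegrable : LocallyIntegrable w volume
  nonneg : ∀ z, 0 ≤ w z
  moderate : ∃ v, IsSubmultiplicativeWeight v ∧ ∃ C : ℝ, 0 < C ∧
    ∀ z z', w (z + z') ≤ C * w z * v z'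

/-- A subexponential weight on `ℝ²`; the norm of `ℝ × ℝ` is the maximum norm. -/
structure IsSubexponentialWeight (w : ℝ × ℝ → ℝ) : Prop where
  isModerate : IsModerateWeight w
  bounds : ∃ γ C β : ℝ, 0 < γ ∧ 0 < C ∧ 0 < β ∧ β < 1 ∧
    ∀ z, C⁻¹ * Real.exp (-γ * ‖z‖ ^ β) ≤ w z ∧ w z ≤ C * Real.exp (γ * ‖z‖ ^ β)

/-- The short-time Fourier transform `V_𝔤 f (t, ν) = ⟨f, π(t, ν) 𝔤⟩` of a tempered distribution with
Gaussian window. The sesquilinear pairing `⟨f, φ⟩` is the action of `f` on the complex conjugate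
of `φ`, and the complex conjugate of `π(t, ν) 𝔤` is `π(t, -ν) 𝔤`, as `𝔤` is real. -/
def stft (f : 𝓢'(ℝ, ℂ)) (z : ℝ × ℝ) : ℂ := f (timeFreqShift z.1 (-z.2) gaussian)

/-- The modulation space norm `‖f‖_{M^{p,q}_w}`, with value `∞` off `M^{p,q}_w(ℝ)`. -/
def modulationNorm (p q : ℝ≥0∞) (w : ℝ × ℝ → ℝ) (f : 𝓢'(ℝ, ℂ)) : ℝ≥0∞ :=
  mixedNorm p q w (stft f)

/-- The modulation space `M^{p,q}_w(ℝ)`. -/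
def modulationSpace (p q : ℝ≥0∞) (w : ℝ × ℝ → ℝ) : Set 𝓢'(ℝ, ℂ) :=
  {f | modulationNorm p q w f < ∞}

/-! ### Kohn-Nirenberg symbols and operator Paley-Wiener spaces -/

/-- `σ` is the Kohn-Nirenberg symbol of `H`: in the sense of distributions,
`H f (x) = ∫ σ(x, ξ) (𝓕 f)(ξ) exp (2 π i x ξ) dξ`. By the Schwartz kernel theorem every `H` has
exactly one symbol. -/
def IsKohnNirenbergSymbol (H : 𝓢(ℝ, ℂ) →L[ℂ] 𝓢'(ℝ, ℂ)) (σ : 𝓢'(ℝ × ℝ, ℂ)) : Prop :=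
  ∀ f φ : 𝓢(ℝ, ℂ),
    H f φ = σ (smulLeftCLM ℂ (fun z : ℝ × ℝ => expi (z.1 * z.2)) (tensor φ (𝓕 f)))

/-- The Fourier transform on `𝓢(ℝ²)`; `WithLp 2 (ℝ × ℝ)` is `ℝ²` with the Euclidean norm. -/
def fourierPlane : 𝓢(ℝ × ℝ, ℂ) →L[ℂ] 𝓢(ℝ × ℝ, ℂ) :=
  compCLMOfContinuousLinearEquiv ℂ (WithLp.prodContinuousLinearEquiv 2 ℝ ℝ ℝ).symm ∘L
    (FourierTransform.fourierCLM ℂ 𝓢(WithLp 2 (ℝ × ℝ), ℂ)) ∘L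
      compCLMOfContinuousLinearEquiv ℂ (WithLp.prodContinuousLinearEquiv 2 ℝ ℝ ℝ)

theorem fourierPlane_apply (Φ : 𝓢(ℝ × ℝ, ℂ)) (a b : ℝ) :
    fourierPlane Φ (a, b) = ∫ z : ℝ × ℝ, expi (-(z.1 * a + z.2 * b)) * Φ z := by
  have h : fourierPlane Φ (a, b) =
      𝓕 (fun y : WithLp 2 (ℝ × ℝ) => Φ y.ofLp) (WithLp.toLp 2 (a, b)) := rfl
  rw [h, Real.fourier_eq']
  rw [← (WithLp.volume_preserving_ofLp ℝ ℝ).integral_comp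
    (MeasurableEquiv.toLp 2 (ℝ × ℝ)).symm.measurableEmbedding]
  refine integral_congr_ae (Filter.Eventually.of_forall fun y => ?_)
  simp only [expi, smul_eq_mul, WithLp.prod_inner_apply]
  congr 2
  simp
  ring

/-- The rotation `(x, ξ) ↦ (-ξ, x)` of the plane. -/
def rotation : (ℝ × ℝ) ≃L[ℝ] (ℝ × ℝ) :=
  (ContinuousLinearEquiv.prodComm ℝ ℝ ℝ).trans
    ((ContinuousLinearEquiv.neg ℝ).prodCongr (ContinuousLinearEquiv.refl ℝ ℝ))

/-- The transpose of the symplectic Fourier transform on `𝓢(ℝ²)`: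
`Φ ↦ ((x, ξ) ↦ ∬ Φ(t, ν) exp (-2 π i (ν x - ξ t)) dt dν)`. -/
def symplecticFourierTranspose : 𝓢(ℝ × ℝ, ℂ) →L[ℂ] 𝓢(ℝ × ℝ, ℂ) :=
  compCLMOfContinuousLinearEquiv ℂ rotation ∘L fourierPlane

theorem symplecticFourierTranspose_apply (Φ : 𝓢(ℝ × ℝ, ℂ)) (x ξ : ℝ) :
    symplecticFourierTranspose Φ (x, ξ) =
      ∫ z : ℝ × ℝ, expi (-(z.2 * x - ξ * z.1)) * Φ z := by
  have h : symplecticFourierTranspose Φ (x, ξ) = fourierPlane Φ (-ξ, x) := rfl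
  rw [h, fourierPlane_apply]
  congr 1
  funext z
  congr 2
  ring

/-- The symplectic Fourier transform of a tempered distribution, by duality. -/
def symplecticFourier (σ : 𝓢'(ℝ × ℝ, ℂ)) : 𝓢'(ℝ × ℝ, ℂ) :=
  PointwiseConvergenceCLM.precomp ℂ symplecticFourierTranspose σ

/-- The tempered distribution `σ` is the locally integrable function `F`. -/
def IsRepresentedBy (σ : 𝓢'(ℝ × ℝ, ℂ)) (F : ℝ × ℝ → ℂ) : Prop :=
  LocallyIntegrable F volume ∧
    ∀ Φ : 𝓢(ℝ × ℝ, ℂ), HasCompactSupport Φ → σ Φ = ∫ z, F z * Φ z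

/-- `‖H‖_{OPW^{p,q}_w} = ‖σ_H‖_{L^{p,q}_w}`, with value `∞` if the symbol `σ_H` of `H` is not a
function. The symbol is unique, and the function that represents it is unique up to null sets, so
that the infimum runs over at most one value. -/
def opwNorm (p q : ℝ≥0∞) (w : ℝ × ℝ → ℝ) (H : 𝓢(ℝ, ℂ) →L[ℂ] 𝓢'(ℝ, ℂ)) : ℝ≥0∞ :=
  ⨅ (σ : 𝓢'(ℝ × ℝ, ℂ)) (F : ℝ × ℝ → ℂ)
    (_ : IsKohnNirenbergSymbol H σ) (_ : IsRepresentedBy σ F), mixedNorm p q w F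

/-- The operator Paley-Wiener space `OPW^{p,q}_w(M)`: the operators `H` with
`supp 𝓕ˢ σ_H ⊆ M` and `σ_H ∈ L^{p,q}_w`. -/
def OPW (p q : ℝ≥0∞) (w : ℝ × ℝ → ℝ) (M : Set (ℝ × ℝ)) : Set (𝓢(ℝ, ℂ) →L[ℂ] 𝓢'(ℝ, ℂ)) :=
  {H | (∃ σ, IsKohnNirenbergSymbol H σ ∧ Distribution.dsupport (symplecticFourier σ) ⊆ M) ∧
    opwNorm p q w H < ∞}

/-! ### Identification -/

/-- `T` is the extension of `H : 𝓢(ℝ) → 𝓢'(ℝ)` to `𝓢'(ℝ)` that is continuous for the weak-*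
topology. It is unique, as `𝓢(ℝ)` is weak-* dense in `𝓢'(ℝ)`, and it exists when `𝓕ˢ σ_H` has compact
support. The value of `H` at a distribution `g` is `T g`. -/
def IsExtension (H : 𝓢(ℝ, ℂ) →L[ℂ] 𝓢'(ℝ, ℂ)) (T : 𝓢'(ℝ, ℂ) →L[ℂ] 𝓢'(ℝ, ℂ)) : Prop :=
  ∀ f : 𝓢(ℝ, ℂ), T (toTemperedDistributionCLM ℝ ℂ volume f) = H f

/-- `H ↦ H g` is bounded below on `OPW^{p,q}_w(M)`, as a map to `M^{p,q}_w(ℝ)`. -/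
def IsBoundedBelowAt (p q : ℝ≥0∞) (w : ℝ × ℝ → ℝ) (M : Set (ℝ × ℝ)) (g : 𝓢'(ℝ, ℂ)) : Prop :=
  ∃ A : ℝ≥0, 0 < A ∧ ∀ H ∈ OPW p q w M, ∀ T, IsExtension H T →
    A * opwNorm p q w H ≤ modulationNorm p q w (T g)

/-- `H ↦ H g` is bounded on `OPW^{p,q}_w(M)`, as a map to `M^{p,q}_w(ℝ)`. -/
def IsBoundedAboveAt (p q : ℝ≥0∞) (w : ℝ × ℝ → ℝ) (M : Set (ℝ × ℝ)) (g : 𝓢'(ℝ, ℂ)) : Prop :=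
  ∃ B : ℝ≥0, 0 < B ∧ ∀ H ∈ OPW p q w M, ∀ T, IsExtension H T →
    modulationNorm p q w (T g) ≤ B * opwNorm p q w H

/-- `OPW^{p,q}_w(M)`, mapping `M^{∞,∞}(ℝ)` to `M^{p,q}_w(ℝ)`, is identifiable: for some
`g ∈ M^{∞,∞}(ℝ)` the norms `‖H‖_{OPW^{p,q}_w}` and `‖H g‖_{M^{p,q}_w}` are equivalent. -/
def IsIdentifiable (p q : ℝ≥0∞) (w : ℝ × ℝ → ℝ) (M : Set (ℝ × ℝ)) : Prop :=
  ∃ g ∈ modulationSpace ∞ ∞ (fun _ => 1), IsBoundedBelowAt p q w M g ∧ IsBoundedAboveAt p q w M g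

/-! ### Inner Jordan content -/

/-- The family `𝓤_{K,L}` of finite unions of translates of `[0, 1/K) × [0, K/L)` by elements of
`(1/K) ℤ × (K/L) ℤ`. -/
def gridSets (K L : ℕ) : Set (Set (ℝ × ℝ)) :=
  {U | ∃ (J : ℕ) (k p : Fin J → ℤ), U = ⋃ j,
    Set.Ico ((k j : ℝ) / K) ((k j : ℝ) / K + 1 / K) ×ˢ
      Set.Ico ((p j : ℝ) * K / L) ((p j : ℝ) * K / L + K / L)}

/-- The inner (Jordan) content of a bounded subset of the plane. -/
def innerContent (M : Set (ℝ × ℝ)) : ℝ≥0∞ :=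
  sSup {c | ∃ (K L : ℕ) (U : Set (ℝ × ℝ)), 0 < K ∧ 0 < L ∧ U ∈ gridSets K L ∧ U ⊆ M ∧
    c = volume U}

end OperatorSampling

end

/-! The proof compares degrees of freedom. Inner content above one yields, for some K and L, at
least L + 1 grid cells of area 1 / L inside M. On every cell one places a smooth bump A(t) B(ν) and
modulates it with lattice steps s₂ = (1 + ε) K in t and s₁ = (1 + ε) L / K in ν. These atoms are
admissible spreading functions, and the symbol 𝓕⁻ B ⊗ 𝓕 A of the atom with indices (n, m) is
concentrated near (n s₁, m s₂). Hence the box [-N, N]² carries about |S| · 4 N² / ((1 + ε)² L)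
atoms, where |S| ≥ L + 1 is the number of cells.

The output H g of such a combination essentially lives in the same box, where there are only about 4
N² degrees of freedom. To make this quantitative, a Gaussian test atom is periodized with period P =
2 N (1 + 2 ε). By Poisson summation (`tsum_functional_gaussian`, `exists_norm_sum_gaussian_le`) it
is replaced by the characters of frequency l / P, up to the contribution of far translates. About 4
N² (1 + 2 ε)² characters satisfy |l / P| ≤ N (1 + 2 ε). For small ε these are fewer than the atoms
(`exists_oversampling`, `exists_card_lt`), so some coefficient vector of maximum norm one
annihilates all of these responses. Only tails are left of the short-time Fourier transform of H g,
and `exists_norm_family_le` bounds them by exp (-κ N ^ β') times a decaying function of the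
time-frequency point, up to the number of atoms.

Conversely, the symbol cannot be that small. The windows belong to a biorthogonal system, so every
coefficient is recovered by pairing the symbol with a dual function. The weight of exponent β makes
this cost only a factor exp (-κ N ^ β) (`exists_coefficient_le`). With β < β' < 1 the quotient of
the two norms tends to zero as N grows.

All this needs compactly supported windows whose Fourier transforms decay like exp (-c |ξ| ^ β').
They exist because β' < 1 (`exists_measure_subexp`, `exists_window`). The distribution g enters only
through its continuity on the Schwartz space, which costs polynomial factors, so the argument covers
every tempered g. -/

noncomputable section

namespace OperatorSampling

/-! ### Subexponential functions -/

/-- The subexponential function `x ↦ exp (-c |x| ^ β)`. -/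
def subexp (β c x : ℝ) : ℝ := Real.exp (-(c * |x| ^ β))

theorem subexp_pos (β c x : ℝ) : 0 < subexp β c x := Real.exp_pos _

theorem subexp_le_one {β c : ℝ} (hc : 0 ≤ c) (x : ℝ) : subexp β c x ≤ 1 := by
  unfold subexp
  rw [Real.exp_le_one_iff]
  have := Real.rpow_nonneg (abs_nonneg x) β
  nlinarith [mul_nonneg hc this]

theorem subexp_abs (β c x : ℝ) : subexp β c |x| = subexp β c x := by simp [subexp]

theorem subexp_neg (β c x : ℝ) : subexp β c (-x) = subexp β c x := by simp [subexp]

theorem subexp_sub_comm (β c x y : ℝ) : subexp β c (x - y) = subexp β c (y - x) := by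
  rw [← subexp_neg, neg_sub]

theorem subexp_add_const (β c d x : ℝ) : subexp β (c + d) x = subexp β c x * subexp β d x := by
  unfold subexp
  rw [← Real.exp_add]
  ring_nf

theorem subexp_half (β c x : ℝ) : subexp β c x = subexp β (c / 2) x * subexp β (c / 2) x := by
  rw [← subexp_add_const, add_halves]

theorem subexp_le_of_const_le {β c d : ℝ} (h : c ≤ d) (x : ℝ) : subexp β d x ≤ subexp β c x := by
  unfold subexp
  have := Real.rpow_nonneg (abs_nonneg x) β
  gcongr

theorem subexp_le_of_abs_le {β c x y : ℝ} (hβ : 0 ≤ β) (hc : 0 ≤ c) (h : |x| ≤ |y|) :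
    subexp β c y ≤ subexp β c x := by
  unfold subexp
  have := Real.rpow_le_rpow (abs_nonneg x) h hβ
  gcongr

theorem abs_add_rpow_le {β : ℝ} (h0 : 0 ≤ β) (h1 : β ≤ 1) (x y : ℝ) :
    |x + y| ^ β ≤ |x| ^ β + |y| ^ β :=
  (Real.rpow_le_rpow (abs_nonneg _) (abs_add_le x y) h0).trans
    (Real.rpow_add_le_add_rpow (abs_nonneg _) (abs_nonneg _) h0 h1)

theorem subexp_mul_le {β c : ℝ} (h0 : 0 ≤ β) (h1 : β ≤ 1) (hc : 0 ≤ c) (x y : ℝ) :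
    subexp β c x * subexp β c y ≤ subexp β c (x + y) := by
  unfold subexp
  rw [← Real.exp_add]
  have := mul_le_mul_of_nonneg_left (abs_add_rpow_le h0 h1 x y) hc
  gcongr
  linarith

theorem subexp_sub_mul_le {β c : ℝ} (h0 : 0 ≤ β) (h1 : β ≤ 1) (hc : 0 ≤ c) (x y z : ℝ) :
    subexp β c (x - y) * subexp β c (x - z) ≤ subexp β c (y - z) := by
  rw [subexp_sub_comm β c x y]
  refine (subexp_mul_le h0 h1 hc _ _).trans_eq ?_
  ring_nf

theorem exists_pow_mul_subexp_le {β c : ℝ} (hβ : 0 < β) (hc : 0 < c) (N : ℕ) :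
    ∃ C : ℝ, 0 < C ∧ ∀ x : ℝ, (1 + |x|) ^ N * subexp β c x ≤ C := by
  -- With n ≥ N / β one has |x| ^ N ≤ (|x| ^ β) ^ n for |x| ≥ 1, and the n-th term of the
  -- exponential series of c |x| ^ β controls the right side.
  obtain ⟨n, hn⟩ := exists_nat_ge (N / β)
  have hn' : (N : ℝ) ≤ β * n := by rw [div_le_iff₀ hβ] at hn; linarith
  refine ⟨2 ^ N * (1 + n.factorial / c ^ n), by positivity, fun x => ?_⟩
  have hs := subexp_pos β c x
  have hs1 := subexp_le_one (β := β) hc.le x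
  have hf : (0 : ℝ) ≤ n.factorial / c ^ n := by positivity
  rcases le_total |x| 1 with hx | hx
  · calc (1 + |x|) ^ N * subexp β c x ≤ 2 ^ N * 1 := by
          gcongr; linarith
      _ ≤ _ := by gcongr; linarith
  · have hy : 0 ≤ c * |x| ^ β := by positivity
    have h1 := Real.pow_div_factorial_le_exp _ hy n
    have h2 : |x| ^ N ≤ (|x| ^ β) ^ n := by
      rw [← Real.rpow_natCast, ← Real.rpow_natCast, ← Real.rpow_mul (by positivity)]
      exact Real.rpow_le_rpow_of_exponent_le hx hn'
    have h3 : |x| ^ N * subexp β c x ≤ n.factorial / c ^ n := by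
      unfold subexp
      rw [Real.exp_neg, ← div_eq_mul_inv, div_le_div_iff₀ (Real.exp_pos _) (by positivity)]
      rw [mul_pow, div_le_iff₀ (by positivity)] at h1
      calc |x| ^ N * c ^ n ≤ (|x| ^ β) ^ n * c ^ n := by gcongr
        _ ≤ _ := by linarith
    calc (1 + |x|) ^ N * subexp β c x ≤ (2 * |x|) ^ N * subexp β c x := by
          gcongr; linarith
      _ = 2 ^ N * (|x| ^ N * subexp β c x) := by rw [mul_pow]; ring
      _ ≤ _ := by gcongr; linarith

theorem exists_pow_mul_subexp_le_subexp {β c : ℝ} (hβ : 0 < β) (hc : 0 < c) (N : ℕ) :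
    ∃ C : ℝ, 0 < C ∧ ∀ x : ℝ, (1 + |x|) ^ N * subexp β c x ≤ C * subexp β (c / 2) x := by
  obtain ⟨C, hC, h⟩ := exists_pow_mul_subexp_le hβ (half_pos hc) N
  refine ⟨C, hC, fun x => ?_⟩
  rw [subexp_half, ← mul_assoc]
  exact mul_le_mul_of_nonneg_right (h x) (subexp_pos _ _ _).le

/-- A smaller exponent loses against a larger one. -/
theorem exists_subexp_le_mul_subexp {β β' c : ℝ} (hβ : 0 < β) (hββ : β < β') (hc : 0 < c) (γ : ℝ) :
    ∃ C : ℝ, 0 < C ∧ ∀ x : ℝ, subexp β' c x ≤ C * subexp β γ x := by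
  set γ' := max γ 1
  have hγ' : 0 < γ' := lt_of_lt_of_le one_pos (le_max_right _ _)
  -- Beyond the radius R the term c |x| ^ β' exceeds γ' |x| ^ β; inside it the constant exp (γ' R ^
  -- β) pays for everything.
  set R := (γ' / c) ^ (1 / (β' - β))
  have hR : 0 ≤ R := by positivity
  refine ⟨Real.exp (γ' * R ^ β), Real.exp_pos _, fun x => ?_⟩
  refine le_trans ?_ (mul_le_mul_of_nonneg_left (subexp_le_of_const_le (le_max_left γ 1) x)
    (Real.exp_pos _).le)
  change _ ≤ _ * subexp β γ' x
  unfold subexp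
  rw [← Real.exp_add, Real.exp_le_exp]
  have hd : 0 < β' - β := sub_pos.2 hββ
  rcases le_total |x| R with hx | hx
  · have h1 := Real.rpow_le_rpow (abs_nonneg x) hx hβ.le
    have h2 : 0 ≤ c * |x| ^ β' := by positivity
    nlinarith
  · have h1 : γ' / c ≤ |x| ^ (β' - β) := by
      have := Real.rpow_le_rpow hR hx hd.le
      rwa [← Real.rpow_mul (by positivity), one_div_mul_cancel hd.ne', Real.rpow_one] at this
    have hx0 : 0 < |x| := lt_of_lt_of_le (by positivity) hx
    have h2 : |x| ^ β' = |x| ^ (β' - β) * |x| ^ β := by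
      rw [← Real.rpow_add hx0]; ring_nf
    rw [div_le_iff₀ hc] at h1
    have h3 : 0 ≤ γ' * R ^ β := by positivity
    have h4 : 0 ≤ |x| ^ β := by positivity
    rw [h2]
    nlinarith [mul_le_mul_of_nonneg_right h1 h4]

/-! ### Sums of norms of derivatives -/

/-- The sum of the norms of the derivatives of order at most `N` of a function on the line. -/
def derivSum (N : ℕ) (f : ℝ → ℂ) (x : ℝ) : ℝ :=
  ∑ i ∈ Finset.range (N + 1), ‖iteratedFDeriv ℝ i f x‖

theorem derivSum_nonneg (N : ℕ) (f : ℝ → ℂ) (x : ℝ) : 0 ≤ derivSum N f x :=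
  Finset.sum_nonneg fun _ _ => norm_nonneg _

theorem norm_iteratedFDeriv_le_derivSum {N i : ℕ} (hi : i ≤ N) (f : ℝ → ℂ) (x : ℝ) :
    ‖iteratedFDeriv ℝ i f x‖ ≤ derivSum N f x :=
  Finset.single_le_sum (f := fun i => ‖iteratedFDeriv ℝ i f x‖) (fun _ _ => norm_nonneg _)
    (Finset.mem_range.2 (Nat.lt_succ_of_le hi))

theorem norm_le_derivSum (N : ℕ) (f : ℝ → ℂ) (x : ℝ) : ‖f x‖ ≤ derivSum N f x := by
  simpa using norm_iteratedFDeriv_le_derivSum (Nat.zero_le N) f x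

theorem derivSum_mul_le {N : ℕ} {f g : ℝ → ℂ} (hf : ContDiff ℝ N f) (hg : ContDiff ℝ N g) (x : ℝ) :
    derivSum N (fun y => f y * g y) x ≤
      ((N + 1 : ℕ) * 2 ^ N : ℝ) * derivSum N f x * derivSum N g x := by
  have hF := derivSum_nonneg N f x
  have hG := derivSum_nonneg N g x
  have key : ∀ n ∈ Finset.range (N + 1), ‖iteratedFDeriv ℝ n (fun y => f y * g y) x‖ ≤
      2 ^ N * derivSum N f x * derivSum N g x := by
    intro n hn
    have hn' : n ≤ N := Nat.lt_succ_iff.1 (Finset.mem_range.1 hn)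
    refine (norm_iteratedFDeriv_mul_le hf hg x (by exact_mod_cast hn')).trans ?_
    calc _ ≤ ∑ i ∈ Finset.range (n + 1), (n.choose i : ℝ) * derivSum N f x * derivSum N g x := by
          refine Finset.sum_le_sum fun i hi => ?_
          have hi' : i ≤ n := Nat.lt_succ_iff.1 (Finset.mem_range.1 hi)
          gcongr
          · exact norm_iteratedFDeriv_le_derivSum (hi'.trans hn') f x
          · exact norm_iteratedFDeriv_le_derivSum ((Nat.sub_le _ _).trans hn') g x
      _ = 2 ^ n * derivSum N f x * derivSum N g x := by
          rw [← Finset.sum_mul, ← Finset.sum_mul, ← Nat.cast_sum, Nat.sum_range_choose]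
          push_cast
          rfl
      _ ≤ _ := by gcongr; norm_num
  refine (Finset.sum_le_sum key).trans_eq ?_
  simp
  ring

theorem derivSum_comp_sub (N : ℕ) (f : ℝ → ℂ) (a x : ℝ) :
    derivSum N (fun y => f (y - a)) x = derivSum N f (x - a) := by
  simp only [derivSum, iteratedFDeriv_comp_sub]

theorem hasDerivAt_expi_mul (s x : ℝ) :
    HasDerivAt (fun y : ℝ => expi (s * y)) (2 * Real.pi * Complex.I * s * expi (s * x)) x := by
  have h1 : HasDerivAt (fun y : ℝ => 2 * Real.pi * Complex.I * ((s * y : ℝ) : ℂ))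
      (2 * Real.pi * Complex.I * ((s * 1 : ℝ) : ℂ)) x :=
    (((hasDerivAt_id x).const_mul s).ofReal_comp).const_mul _
  have h2 := h1.cexp
  unfold expi
  convert h2 using 1
  push_cast
  ring

theorem norm_expi (x : ℝ) : ‖expi x‖ = 1 := by
  have : (2 * Real.pi * Complex.I * x : ℂ) = ((2 * Real.pi * x : ℝ) : ℂ) * Complex.I := by
    push_cast; ring
  rw [expi, this, Complex.norm_exp_ofReal_mul_I]

theorem expi_add (x y : ℝ) : expi (x + y) = expi x * expi y := by
  unfold expi
  rw [← Complex.exp_add]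
  congr 1
  push_cast
  ring

theorem expi_zero : expi 0 = 1 := by simp [expi]

theorem continuous_expi : Continuous expi := by
  unfold expi
  fun_prop

theorem derivSum_expi_le (N : ℕ) (s x : ℝ) :
    derivSum N (fun y : ℝ => expi (s * y)) x ≤ (N + 1 : ℕ) * 8 ^ N * (1 + |s|) ^ N := by
  have hn (n : ℕ) : iteratedDeriv n (fun y : ℝ => expi (s * y)) =
      fun y => (2 * Real.pi * Complex.I * s) ^ n * expi (s * y) := by
    induction n with
    | zero => simp
    | succ n ih =>
      rw [iteratedDeriv_succ, ih]
      funext y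
      rw [((hasDerivAt_expi_mul s y).const_mul _).deriv]
      ring
  have key : ∀ n ∈ Finset.range (N + 1), ‖iteratedFDeriv ℝ n (fun y : ℝ => expi (s * y)) x‖ ≤
      8 ^ N * (1 + |s|) ^ N := by
    intro n hn'
    have hnN : n ≤ N := Nat.lt_succ_iff.1 (Finset.mem_range.1 hn')
    rw [norm_iteratedFDeriv_eq_norm_iteratedDeriv, hn, norm_mul, norm_expi, mul_one, norm_pow,
      ← mul_pow]
    have h8 : ‖(2 * Real.pi * Complex.I * s : ℂ)‖ ≤ 8 * (1 + |s|) := by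
      simp only [norm_mul, Complex.norm_ofNat, Complex.norm_real, Real.norm_eq_abs,
        Complex.norm_I, mul_one, abs_of_pos Real.pi_pos]
      nlinarith [Real.pi_lt_four, Real.pi_pos, abs_nonneg s]
    calc _ ≤ (8 * (1 + |s|)) ^ n := by gcongr
      _ ≤ _ := pow_le_pow_right₀ (by nlinarith [abs_nonneg s]) hnN
  refine (Finset.sum_le_sum key).trans_eq ?_
  simp
  ring

theorem contDiff_expi_mul (s : ℝ) (n : ℕ) : ContDiff ℝ n (fun y : ℝ => expi (s * y)) :=
  (hasTemperateGrowth_expi_linear s).1.of_le (by exact_mod_cast le_top)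

theorem SchwartzMap.contDiff_nat (f : 𝓢(ℝ, ℂ)) (n : ℕ) : ContDiff ℝ n f := by
  exact_mod_cast f.smooth n

/-- Each derivative falling on the character costs a factor of order 1 + |s|, and the translation
costs nothing. Polynomial losses of this kind are later absorbed by subexponential decay. -/
theorem exists_derivSum_timeFreqShift_le (N : ℕ) : ∃ C : ℝ, 0 < C ∧
    ∀ (f : 𝓢(ℝ, ℂ)) (t s x : ℝ),
      derivSum N (timeFreqShift t s f) x ≤ C * (1 + |s|) ^ N * derivSum N f (x - t) := by
  refine ⟨((N + 1 : ℕ) * 2 ^ N : ℝ) * ((N + 1 : ℕ) * 8 ^ N), by positivity, fun f t s x => ?_⟩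
  have h : (timeFreqShift t s f : ℝ → ℂ) = fun y => expi (s * y) * (fun y => f (y - t)) y := by
    funext y; rw [timeFreqShift_apply]
  have hc : ContDiff ℝ N (fun y => f (y - t)) :=
    (SchwartzMap.contDiff_nat f N).comp (contDiff_id.sub contDiff_const)
  rw [h]
  refine (derivSum_mul_le (contDiff_expi_mul s N) hc x).trans ?_
  rw [derivSum_comp_sub, mul_assoc _ ((N + 1 : ℕ) * 8 ^ N : ℝ)]
  have := derivSum_expi_le N s x
  have h2 := derivSum_nonneg N f (x - t)
  gcongr

/-! ### Multiplication of Schwartz functions and seminorms -/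

/-- The product of two Schwartz functions. -/
def schwartzMul (f : 𝓢(ℝ, ℂ)) : 𝓢(ℝ, ℂ) →L[ℂ] 𝓢(ℝ, ℂ) := smulLeftCLM ℂ f

theorem schwartzMul_apply (f g : 𝓢(ℝ, ℂ)) (x : ℝ) : schwartzMul f g x = f x * g x := by
  simp [schwartzMul, smulLeftCLM_apply_apply f.hasTemperateGrowth]

theorem exists_derivSum_schwartzMul_le (N : ℕ) : ∃ C : ℝ, 0 < C ∧ ∀ (f g : 𝓢(ℝ, ℂ)) (x : ℝ),
    derivSum N (schwartzMul f g) x ≤ C * derivSum N f x * derivSum N g x := by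
  refine ⟨((N + 1 : ℕ) * 2 ^ N : ℝ), by positivity, fun f g x => ?_⟩
  have h : (schwartzMul f g : ℝ → ℂ) = fun y => f y * g y := by
    funext y; rw [schwartzMul_apply]
  rw [h]
  exact derivSum_mul_le (SchwartzMap.contDiff_nat f N) (SchwartzMap.contDiff_nat g N) x

/-- The bound `(1 + |x|) ^ N ∑_{i ≤ N} |f^{(i)}(x)| ≤ B` for all `x`. -/
def SchwartzBound (N : ℕ) (f : ℝ → ℂ) (B : ℝ) : Prop :=
  ∀ x, (1 + |x|) ^ N * derivSum N f x ≤ B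

theorem SchwartzBound.nonneg {N : ℕ} {f : ℝ → ℂ} {B : ℝ} (h : SchwartzBound N f B) : 0 ≤ B :=
  le_trans (mul_nonneg (by positivity) (derivSum_nonneg N f 0)) (h 0)

theorem SchwartzBound.seminorm_le {N k n : ℕ} (hk : k ≤ N) (hn : n ≤ N) {f : 𝓢(ℝ, ℂ)} {B : ℝ}
    (h : SchwartzBound N f B) : SchwartzMap.seminorm ℂ k n f ≤ B := by
  refine SchwartzMap.seminorm_le_bound ℂ k n f h.nonneg fun x => ?_
  refine le_trans ?_ (h x)
  have h1 : ‖x‖ ^ k ≤ (1 + |x|) ^ N := by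
    rw [Real.norm_eq_abs]
    exact (pow_le_pow_left₀ (abs_nonneg x) (by linarith) k).trans
      (pow_le_pow_right₀ (by linarith [abs_nonneg x]) hk)
  have := norm_iteratedFDeriv_le_derivSum hn (f : ℝ → ℂ) x
  gcongr

theorem SchwartzBound.sup_seminorm_le {N : ℕ} {s : Finset (ℕ × ℕ)}
    (hs : ∀ m ∈ s, m.1 ≤ N ∧ m.2 ≤ N) {f : 𝓢(ℝ, ℂ)} {B : ℝ} (h : SchwartzBound N f B) :
    s.sup (schwartzSeminormFamily ℂ ℝ ℂ) f ≤ B :=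
  Seminorm.finset_sup_apply_le h.nonneg fun m hm => h.seminorm_le (hs m hm).1 (hs m hm).2

theorem exists_finset_nat_bound (s : Finset (ℕ × ℕ)) : ∃ N, ∀ m ∈ s, m.1 ≤ N ∧ m.2 ≤ N :=
  ⟨s.sup (fun m => max m.1 m.2), fun m hm => by
    have h : max m.1 m.2 ≤ s.sup (fun m => max m.1 m.2) :=
      Finset.le_sup (f := fun m : ℕ × ℕ => max m.1 m.2) hm
    exact ⟨(le_max_left _ _).trans h, (le_max_right _ _).trans h⟩⟩

theorem exists_bound_of_continuous_seminorm (q : Seminorm ℂ 𝓢(ℝ, ℂ)) (hq : Continuous q) :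
    ∃ (N : ℕ) (C : ℝ), 0 ≤ C ∧ ∀ (f : 𝓢(ℝ, ℂ)) (B : ℝ), SchwartzBound N f B → q f ≤ C * B := by
  obtain ⟨s, C, -, h⟩ := Seminorm.bound_of_continuous (schwartz_withSeminorms ℂ ℝ ℂ) q hq
  obtain ⟨N, hN⟩ := exists_finset_nat_bound s
  refine ⟨N, C, C.2, fun f B hB => (h f).trans ?_⟩
  simp only [smul_apply, NNReal.smul_def, smul_eq_mul]
  exact mul_le_mul_of_nonneg_left (hB.sup_seminorm_le hN) C.2

/-- A continuous functional on the Schwartz space is bounded by finitely many seminorms. -/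
theorem exists_bound_of_functional (G : 𝓢(ℝ, ℂ) →L[ℂ] ℂ) :
    ∃ (N : ℕ) (C : ℝ), 0 ≤ C ∧ ∀ (f : 𝓢(ℝ, ℂ)) (B : ℝ), SchwartzBound N f B → ‖G f‖ ≤ C * B :=
  exists_bound_of_continuous_seminorm ((normSeminorm ℂ ℂ).comp G.toLinearMap)
    (continuous_norm.comp G.continuous)

theorem schwartzBound_of_seminorm_le (N : ℕ) (f : 𝓢(ℝ, ℂ)) :
    SchwartzBound N f ((N + 1 : ℕ) * (2 ^ N * (Finset.Iic (N, N)).sup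
      (fun m => SchwartzMap.seminorm ℂ m.1 m.2) f)) := by
  intro x
  unfold derivSum
  rw [Finset.mul_sum]
  have key : ∀ i ∈ Finset.range (N + 1), (1 + |x|) ^ N * ‖iteratedFDeriv ℝ i f x‖ ≤
      2 ^ N * (Finset.Iic (N, N)).sup (fun m => SchwartzMap.seminorm ℂ m.1 m.2) f := fun i hi =>
    SchwartzMap.one_add_le_sup_seminorm_apply (𝕜 := ℂ) (m := (N, N)) le_rfl
      (Nat.lt_succ_iff.1 (Finset.mem_range.1 hi)) f x
  refine (Finset.sum_le_sum key).trans_eq ?_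
  simp

/-- A continuous operator on the Schwartz space is bounded with respect to seminorms. -/
theorem exists_bound_of_operator (T : 𝓢(ℝ, ℂ) →L[ℂ] 𝓢(ℝ, ℂ)) (N : ℕ) :
    ∃ (N' : ℕ) (C : ℝ), 0 ≤ C ∧ ∀ (f : 𝓢(ℝ, ℂ)) (B : ℝ), SchwartzBound N' f B →
      SchwartzBound N (T f) (C * B) := by
  obtain ⟨N', C, hC, h⟩ := exists_bound_of_continuous_seminorm
    (((Finset.Iic (N, N)).sup (schwartzSeminormFamily ℂ ℝ ℂ)).comp T.toLinearMap)
    ((Seminorm.continuous_of_le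
      (q := ∑ m ∈ Finset.Iic (N, N), schwartzSeminormFamily ℂ ℝ ℂ m)
      (by
        have : (⇑(∑ m ∈ Finset.Iic (N, N), schwartzSeminormFamily ℂ ℝ ℂ m) : 𝓢(ℝ, ℂ) → ℝ) =
            fun f => ∑ m ∈ Finset.Iic (N, N), schwartzSeminormFamily ℂ ℝ ℂ m f := by
          funext f
          simp
        rw [this]
        exact continuous_finsetSum _ fun m _ =>
          (schwartz_withSeminorms ℂ ℝ ℂ).continuous_seminorm m)
      (Seminorm.finset_sup_le_sum _ _)).comp T.continuous)
  refine ⟨N', (N + 1 : ℕ) * (2 ^ N * C), by positivity, fun f B hB x => ?_⟩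
  refine (schwartzBound_of_seminorm_le N (T f) x).trans ?_
  rw [mul_assoc, mul_assoc]
  have := h f B hB
  gcongr
  exact this

/-! ### Schwartz functions with subexponentially decaying derivatives -/

/-- All derivatives of `f` decay subexponentially. -/
def HasSubexpDecay (β : ℝ) (f : 𝓢(ℝ, ℂ)) : Prop :=
  ∀ N : ℕ, ∃ C c : ℝ, 0 < C ∧ 0 < c ∧ ∀ x, derivSum N f x ≤ C * subexp β c x

/-- Mean value inequality for y ↦ f y - y f' x, whose derivative is at most D on the interval. It
bounds a derivative by values of the function and the oscillation of the derivative. -/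
theorem norm_deriv_le_of_norm_deriv_sub_le {f : ℝ → ℂ} {f' : ℝ → ℂ} {D x h : ℝ} (hh : 0 < h)
    (hf : ∀ y, HasDerivAt f (f' y) y) (hD : ∀ y ∈ Set.Ico x (x + h), ‖f' y - f' x‖ ≤ D) :
    h * ‖f' x‖ ≤ ‖f (x + h)‖ + ‖f x‖ + D * h := by
  have hg : ∀ y ∈ Set.Icc x (x + h), HasDerivWithinAt (fun y : ℝ => f y - (y : ℂ) * f' x)
      (f' y - f' x) (Set.Icc x (x + h)) y := by
    intro y _
    have h1 : HasDerivAt (fun y : ℝ => (y : ℂ) * f' x) (1 * f' x) y :=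
      (Complex.ofRealCLM.hasDerivAt (x := y)).mul_const _
    simpa using! ((hf y).sub h1).hasDerivWithinAt
  have := norm_image_sub_le_of_norm_deriv_le_segment' hg hD (x + h) ⟨by linarith, le_rfl⟩
  have he : f (x + h) - ((x + h : ℝ) : ℂ) * f' x - (f x - (x : ℂ) * f' x) =
      (f (x + h) - f x) - (h : ℂ) * f' x := by push_cast; ring
  rw [he] at this
  have h2 : ‖(h : ℂ) * f' x‖ = h * ‖f' x‖ := by
    rw [norm_mul, Complex.norm_real, Real.norm_eq_abs, abs_of_pos hh]
  have h3 : ‖(h : ℂ) * f' x‖ ≤ ‖f (x + h) - f x‖ + ‖(f (x + h) - f x) - (h : ℂ) * f' x‖ := by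
    rw [← norm_neg ((h : ℂ) * f' x)]
    refine le_trans (le_of_eq ?_) ((norm_sub_le _ (f (x + h) - f x)).trans_eq (add_comm _ _))
    congr 1
    ring
  have h4 := norm_sub_le (f (x + h)) (f x)
  have h5 : x + h - x = h := by ring
  rw [h5] at this
  linarith

/-- Subexponential decay of a Schwartz function passes to its derivative. -/
theorem exists_norm_deriv_le_subexp {β : ℝ} (h0 : 0 < β) (h1 : β ≤ 1) {f : 𝓢(ℝ, ℂ)}
    (hf : ∃ C c : ℝ, 0 < C ∧ 0 < c ∧ ∀ x, ‖f x‖ ≤ C * subexp β c x) :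
    ∃ C c : ℝ, 0 < C ∧ 0 < c ∧ ∀ x, ‖SchwartzMap.derivCLM ℂ ℂ f x‖ ≤ C * subexp β c x := by
  obtain ⟨C, c, hC, hc, hf⟩ := hf
  set f' := SchwartzMap.derivCLM ℂ ℂ f
  set f'' := SchwartzMap.derivCLM ℂ ℂ f'
  have hd : ∀ y, HasDerivAt f (f' y) y := fun y => by
    rw [SchwartzMap.derivCLM_apply]; exact f.hasDerivAt y
  have hd' : ∀ y, HasDerivAt f' (f'' y) y := fun y => by
    rw [SchwartzMap.derivCLM_apply]; exact f'.hasDerivAt y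
  set D := SchwartzMap.seminorm ℂ 0 0 f''
  have hD : ∀ y, ‖f'' y‖ ≤ D := fun y => SchwartzMap.norm_le_seminorm ℂ f'' y
  have hD0 : 0 ≤ D := (norm_nonneg _).trans (hD 0)
  refine ⟨C * Real.exp c + C + D, c / 2, by positivity, half_pos hc, fun x => ?_⟩
  -- The step width is the square root of the decay of f. After division by h, both the values of f
  -- and the second-order error D h² are then of order h.
  set h := subexp β (c / 2) x
  have hh : 0 < h := subexp_pos _ _ _
  have hh1 : h ≤ 1 := subexp_le_one (half_pos hc).le x
  have key := norm_deriv_le_of_norm_deriv_sub_le (D := D * h) hh hd (x := x) (fun y hy => by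
    have := Convex.norm_image_sub_le_of_norm_hasDerivWithin_le (f := f') (f' := f'') (C := D)
      (s := Set.univ) (x := x) (y := y) (fun z _ => (hd' z).hasDerivWithinAt) (fun z _ => hD z)
      convex_univ trivial trivial
    refine this.trans ?_
    have h3 : ‖y - x‖ ≤ h := by
      rw [Real.norm_eq_abs, abs_of_nonneg (by linarith [hy.1])]; linarith [hy.2]
    gcongr)
  -- Since h ≤ 1, passing from x to x + h lowers |·| ^ β by at most 1, which costs the factor exp c.
  have h4 : subexp β c (x + h) ≤ Real.exp c * (h * h) := by
    rw [← subexp_half]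
    unfold subexp
    rw [← Real.exp_add, Real.exp_le_exp]
    have h5 := abs_add_rpow_le h0.le h1 (x + h) (-h)
    rw [add_neg_cancel_right, abs_neg, abs_of_pos hh] at h5
    have h6 : h ^ β ≤ 1 := Real.rpow_le_one hh.le hh1 h0.le
    nlinarith
  have h7 := hf (x + h)
  have h8 := hf x
  rw [subexp_half] at h8
  have h9 : h * ‖f' x‖ ≤ h * ((C * Real.exp c + C + D) * h) := by
    refine key.trans ?_
    have := mul_le_mul_of_nonneg_left h4 hC.le
    change ‖f x‖ ≤ C * (h * h) at h8
    nlinarith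
  exact le_of_mul_le_mul_left h9 hh

/-- Induction on the order of the derivative, shrinking the rate at each step. For a Schwartz
function it therefore suffices to check the decay of its size. -/
theorem hasSubexpDecay_of_norm_le {β : ℝ} (h0 : 0 < β) (h1 : β ≤ 1) {f : 𝓢(ℝ, ℂ)}
    (hf : ∃ C c : ℝ, 0 < C ∧ 0 < c ∧ ∀ x, ‖f x‖ ≤ C * subexp β c x) : HasSubexpDecay β f := by
  have key : ∀ (n : ℕ) (f : 𝓢(ℝ, ℂ)),
      (∃ C c : ℝ, 0 < C ∧ 0 < c ∧ ∀ x, ‖f x‖ ≤ C * subexp β c x) →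
      ∃ C c : ℝ, 0 < C ∧ 0 < c ∧ ∀ x, ‖iteratedFDeriv ℝ n f x‖ ≤ C * subexp β c x := by
    intro n
    induction n with
    | zero => intro f hf; simpa using hf
    | succ n ih =>
      intro f hf
      obtain ⟨C, c, hC, hc, h⟩ := ih _ (exists_norm_deriv_le_subexp h0 h1 hf)
      refine ⟨C, c, hC, hc, fun x => ?_⟩
      have h2 := h x
      have h3 : (SchwartzMap.derivCLM ℂ ℂ f : ℝ → ℂ) = deriv f := by
        funext y; exact SchwartzMap.derivCLM_apply ℂ f y
      rw [norm_iteratedFDeriv_eq_norm_iteratedDeriv, h3] at h2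
      rwa [norm_iteratedFDeriv_eq_norm_iteratedDeriv, iteratedDeriv_succ']
  intro N
  choose C c hC hc h using fun n => key n f hf
  obtain ⟨d, hd, hdc⟩ : ∃ d : ℝ, 0 < d ∧ ∀ n ∈ Finset.range (N + 1), d ≤ c n := by
    have hne : (Finset.range (N + 1)).Nonempty := ⟨0, by simp⟩
    refine ⟨(Finset.range (N + 1)).inf' hne c, ?_, fun n hn => Finset.inf'_le _ hn⟩
    rw [Finset.lt_inf'_iff]
    exact fun n _ => hc n
  refine ⟨∑ n ∈ Finset.range (N + 1), C n, d,
    Finset.sum_pos (fun n _ => hC n) ⟨0, by simp⟩, hd, fun x => ?_⟩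
  unfold derivSum
  rw [Finset.sum_mul]
  refine Finset.sum_le_sum fun n hn => (h n x).trans ?_
  exact mul_le_mul_of_nonneg_left (subexp_le_of_const_le (hdc n hn) x) (hC n).le

theorem hasSubexpDecay_gaussian {β : ℝ} (h0 : 0 < β) (h1 : β ≤ 1) :
    HasSubexpDecay β gaussian := by
  refine hasSubexpDecay_of_norm_le h0 h1
    ⟨(2 : ℝ) ^ (1 / 4 : ℝ) * Real.exp 1, 1, by positivity, one_pos, fun x => ?_⟩
  have h : ‖gaussian x‖ = (2 : ℝ) ^ (1 / 4 : ℝ) * Real.exp (-Real.pi * x ^ 2) := by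
    change ‖(((2 : ℝ) ^ (1 / 4 : ℝ) * Real.exp (-Real.pi * x ^ 2) : ℝ) : ℂ)‖ = _
    rw [Complex.norm_real, Real.norm_eq_abs, abs_of_pos (by positivity)]
  rw [h, mul_assoc]
  unfold subexp
  rw [← Real.exp_add]
  gcongr
  have h2 : |x| ^ β ≤ 1 + x ^ 2 := by
    rcases le_total |x| 1 with hx | hx
    · have := Real.rpow_le_one (abs_nonneg x) hx h0.le
      nlinarith [sq_nonneg x]
    · have := Real.rpow_le_rpow_of_exponent_le hx h1
      rw [Real.rpow_one] at this
      nlinarith [sq_abs x]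
  nlinarith [Real.pi_gt_three, sq_nonneg x]

theorem hasSubexpDecay_of_hasCompactSupport {β : ℝ} (h0 : 0 < β) (h1 : β ≤ 1) {f : 𝓢(ℝ, ℂ)}
    {R : ℝ} (hf : ∀ x, R < |x| → f x = 0) : HasSubexpDecay β f := by
  refine hasSubexpDecay_of_norm_le h0 h1
    ⟨(SchwartzMap.seminorm ℂ 0 0 f + 1) * Real.exp (|R| ^ β), 1, by positivity, one_pos,
      fun x => ?_⟩
  rcases lt_or_ge R |x| with hx | hx
  · rw [hf x hx, norm_zero]
    exact mul_nonneg (by positivity) (subexp_pos _ _ _).le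
  · have h2 := SchwartzMap.norm_le_seminorm ℂ f x
    have h3 : 1 ≤ Real.exp (|R| ^ β) * subexp β 1 x := by
      unfold subexp
      rw [← Real.exp_add, Real.one_le_exp_iff]
      have := Real.rpow_le_rpow (abs_nonneg x) (hx.trans (le_abs_self R)) h0.le
      linarith
    rw [mul_assoc]
    have h4 : 0 ≤ SchwartzMap.seminorm ℂ 0 0 f := by positivity
    nlinarith

/-- Products of time-frequency shifts of functions with subexponential decay. -/
theorem HasSubexpDecay.exists_schwartzBound_mul {β : ℝ} (h0 : 0 < β) (h1 : β ≤ 1)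
    {u v : 𝓢(ℝ, ℂ)} (hu : HasSubexpDecay β u) (hv : HasSubexpDecay β v) (N : ℕ) :
    ∃ C c : ℝ, 0 < C ∧ 0 < c ∧ ∀ A s B s' : ℝ,
      SchwartzBound N (schwartzMul (timeFreqShift A s u) (timeFreqShift B s' v))
        (C * (1 + |s|) ^ N * (1 + |s'|) ^ N * (1 + |A|) ^ N * subexp β c (A - B)) := by
  obtain ⟨Cu, cu, hCu, hcu, hu⟩ := hu N
  obtain ⟨Cv, cv, hCv, hcv, hv⟩ := hv N
  obtain ⟨K1, hK1, k1⟩ := exists_derivSum_schwartzMul_le N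
  obtain ⟨K2, hK2, k2⟩ := exists_derivSum_timeFreqShift_le N
  set c := min cu cv
  have hc : 0 < c := lt_min hcu hcv
  obtain ⟨K3, hK3, k3⟩ := exists_pow_mul_subexp_le_subexp h0 hc N
  refine ⟨K1 * (K2 * Cu) * (K2 * Cv) * K3, c / 2, by positivity, half_pos hc,
    fun A s B s' x => ?_⟩
  have e1 : derivSum N u (x - A) ≤ Cu * subexp β c (x - A) := (hu _).trans
    (mul_le_mul_of_nonneg_left (subexp_le_of_const_le (min_le_left _ _) _) hCu.le)
  -- Only half of the rate of v is kept, to match what remains of the rate of u once the polynomial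
  -- weight has been absorbed.
  have e2 : derivSum N v (x - B) ≤ Cv * subexp β (c / 2) (x - B) := (hv _).trans
    (mul_le_mul_of_nonneg_left (subexp_le_of_const_le
      ((half_le_self hc.le).trans (min_le_right _ _)) _) hCv.le)
  have e3 : (1 + |x|) ^ N ≤ (1 + |A|) ^ N * (1 + |x - A|) ^ N := by
    rw [← mul_pow]
    gcongr
    have := abs_add_le (x - A) A
    rw [sub_add_cancel] at this
    nlinarith [mul_nonneg (abs_nonneg A) (abs_nonneg (x - A))]
  have p1 := subexp_pos β c (x - A)
  have p2 := subexp_pos β (c / 2) (x - B)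
  have d1 := derivSum_nonneg N u (x - A)
  have d2 := derivSum_nonneg N v (x - B)
  calc (1 + |x|) ^ N *
        derivSum N (schwartzMul (timeFreqShift A s u) (timeFreqShift B s' v)) x
      ≤ ((1 + |A|) ^ N * (1 + |x - A|) ^ N) * (K1 * (K2 * (1 + |s|) ^ N *
          (Cu * subexp β c (x - A))) * (K2 * (1 + |s'|) ^ N * (Cv * subexp β (c / 2) (x - B)))) := by
        have f1 : derivSum N (timeFreqShift A s u) x ≤
            K2 * (1 + |s|) ^ N * (Cu * subexp β c (x - A)) := (k2 u A s x).trans (by gcongr)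
        have f2 : derivSum N (timeFreqShift B s' v) x ≤
            K2 * (1 + |s'|) ^ N * (Cv * subexp β (c / 2) (x - B)) :=
          (k2 v B s' x).trans (by gcongr)
        have g1 := derivSum_nonneg N (timeFreqShift A s u) x
        have g2 := derivSum_nonneg N (timeFreqShift B s' v) x
        have g3 := derivSum_nonneg N (schwartzMul (timeFreqShift A s u) (timeFreqShift B s' v)) x
        refine mul_le_mul e3 ((k1 _ _ _).trans ?_) g3 (by positivity)
        gcongr
    _ = K1 * (K2 * Cu) * (K2 * Cv) * (1 + |s|) ^ N * (1 + |s'|) ^ N * (1 + |A|) ^ N *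
          (((1 + |x - A|) ^ N * subexp β c (x - A)) * subexp β (c / 2) (x - B)) := by ring
    _ ≤ K1 * (K2 * Cu) * (K2 * Cv) * (1 + |s|) ^ N * (1 + |s'|) ^ N * (1 + |A|) ^ N *
          ((K3 * subexp β (c / 2) (x - A)) * subexp β (c / 2) (x - B)) := by
        have := mul_le_mul_of_nonneg_right (k3 (x - A)) p2.le
        exact mul_le_mul_of_nonneg_left this (by positivity)
    _ = K1 * (K2 * Cu) * (K2 * Cv) * K3 * (1 + |s|) ^ N * (1 + |s'|) ^ N * (1 + |A|) ^ N *
          (subexp β (c / 2) (x - A) * subexp β (c / 2) (x - B)) := by ring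
    _ ≤ _ := by
        gcongr
        exact subexp_sub_mul_le h0.le h1 (half_pos hc).le _ _ _

/-- The derivatives of the shifted factor are merely bounded, and the weight in x falls entirely on
ψ. This makes the bound uniform in the translation A. -/
theorem exists_schwartzBound_mul_timeFreqShift (u : 𝓢(ℝ, ℂ)) (N : ℕ) :
    ∃ C : ℝ, 0 < C ∧ ∀ (A s : ℝ) (ψ : 𝓢(ℝ, ℂ)) (B : ℝ), SchwartzBound N ψ B →
      SchwartzBound N (schwartzMul (timeFreqShift A s u) ψ) (C * (1 + |s|) ^ N * B) := by
  obtain ⟨K1, hK1, k1⟩ := exists_derivSum_schwartzMul_le N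
  obtain ⟨K2, hK2, k2⟩ := exists_derivSum_timeFreqShift_le N
  have hb := schwartzBound_of_seminorm_le N u
  set D := ((N + 1 : ℕ) * (2 ^ N * (Finset.Iic (N, N)).sup
      (fun m => SchwartzMap.seminorm ℂ m.1 m.2) u))
  have hD : 0 ≤ D := hb.nonneg
  have hu : ∀ x, derivSum N u x ≤ D + 1 := fun x => by
    refine le_trans ?_ ((hb x).trans (by linarith))
    refine le_mul_of_one_le_left (derivSum_nonneg N u x) (one_le_pow₀ ?_)
    linarith [abs_nonneg x]
  refine ⟨K1 * (K2 * (D + 1)), by positivity, fun A s ψ B hB x => ?_⟩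
  have g2 := derivSum_nonneg N ψ x
  have g1 := derivSum_nonneg N (timeFreqShift A s u) x
  calc (1 + |x|) ^ N * derivSum N (schwartzMul (timeFreqShift A s u) ψ) x
      ≤ (1 + |x|) ^ N * (K1 * (K2 * (1 + |s|) ^ N * (D + 1)) * derivSum N ψ x) := by
        have f1 : derivSum N (timeFreqShift A s u) x ≤ K2 * (1 + |s|) ^ N * (D + 1) :=
          (k2 u A s x).trans (by gcongr; exact hu _)
        have := k1 (timeFreqShift A s u) ψ x
        refine mul_le_mul_of_nonneg_left (this.trans ?_) (by positivity)
        gcongr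
    _ = K1 * (K2 * (D + 1)) * (1 + |s|) ^ N * ((1 + |x|) ^ N * derivSum N ψ x) := by ring
    _ ≤ _ := by gcongr; exact hB x

/-! ### Series of Schwartz functions -/

/-- A functional may be applied termwise to a series of Schwartz functions. -/
theorem tsum_functional_eq_zero {ι : Type*} (G : 𝓢(ℝ, ℂ) →L[ℂ] ℂ) (f : ι → 𝓢(ℝ, ℂ))
    (hf : ∀ N : ℕ, ∃ B : ι → ℝ, Summable B ∧ ∀ i, SchwartzBound N (f i) (B i))
    (h0 : ∀ x, ∑' i, f i x = 0) : HasSum (fun i => G (f i)) 0 := by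
  obtain ⟨N, C, hC, hG⟩ := exists_bound_of_functional G
  obtain ⟨B, hB, hfB⟩ := hf N
  have hle : ∀ n ≤ N, ∀ i x, (1 + |x|) ^ N * ‖iteratedFDeriv ℝ n (f i) x‖ ≤ B i := by
    intro n hn i x
    refine le_trans ?_ (hfB i x)
    have := norm_iteratedFDeriv_le_derivSum hn (f i) x
    gcongr
  have hle' : ∀ n ≤ N, ∀ i x, ‖iteratedFDeriv ℝ n (f i) x‖ ≤ B i := by
    intro n hn i x
    refine le_trans ?_ (hle n hn i x)
    refine le_mul_of_one_le_left (norm_nonneg _) (one_le_pow₀ ?_)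
    linarith [abs_nonneg x]
  -- The summable majorant permits termwise differentiation, so all derivatives up to order N of the
  -- zero sum vanish termwise as well.
  have hz : ∀ n ≤ N, ∀ x, ∑' i, iteratedFDeriv ℝ n (f i) x = 0 := by
    intro n hn x
    have h := iteratedFDeriv_tsum_apply (𝕜 := ℝ) (N := (N : ℕ∞)) (f := fun i => (f i : ℝ → ℂ))
      (v := fun _ i => B i) (fun i => (f i).smooth N) (fun k _ => hB)
      (fun k i x hk => hle' k (by exact_mod_cast hk) i x) (k := n) (by exact_mod_cast hn) x
    rw [← h]
    have : (fun y => ∑' i, f i y) = fun _ => (0 : ℂ) := funext h0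
    rw [this]
    simp
  -- As the full series of derivatives is zero, a partial sum is minus its tail. Its seminorms are
  -- thus bounded by the tail of the majorant, which tends to zero.
  have key : ∀ s : Finset ι, SchwartzBound N (∑ i ∈ s, f i : 𝓢(ℝ, ℂ))
      ((N + 1 : ℕ) * ∑' i : {i // i ∉ s}, B i) := by
    intro s x
    unfold derivSum
    rw [Finset.mul_sum]
    have hterm : ∀ n ∈ Finset.range (N + 1),
        (1 + |x|) ^ N * ‖iteratedFDeriv ℝ n (∑ i ∈ s, f i : 𝓢(ℝ, ℂ)) x‖ ≤
          ∑' i : {i // i ∉ s}, B i := by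
      intro n hn
      have hn' : n ≤ N := Nat.lt_succ_iff.1 (Finset.mem_range.1 hn)
      have hsum : Summable fun i => iteratedFDeriv ℝ n (f i) x :=
        Summable.of_norm_bounded hB fun i => hle' n hn' i x
      have h1 : iteratedFDeriv ℝ n (∑ i ∈ s, f i : 𝓢(ℝ, ℂ)) x =
          ∑ i ∈ s, iteratedFDeriv ℝ n (f i) x := by
        have : ((∑ i ∈ s, f i : 𝓢(ℝ, ℂ)) : ℝ → ℂ) = fun y => ∑ i ∈ s, f i y := by
          funext y; simp
        rw [this, iteratedFDeriv_fun_sum_apply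
          (fun i _ => (SchwartzMap.contDiff_nat (f i) n).contDiffAt)]
      have h2 := hsum.sum_add_tsum_subtype_compl s
      rw [hz n hn' x] at h2
      rw [h1, eq_neg_of_add_eq_zero_left h2, norm_neg]
      have hs2 : Summable fun i : {i // i ∉ s} => (1 + |x|) ^ N * ‖iteratedFDeriv ℝ n (f i) x‖ :=
        Summable.of_nonneg_of_le (fun i => by positivity) (fun i => hle n hn' i x)
          (hB.subtype _)
      have hs3 : Summable fun i : {i // i ∉ s} => ‖iteratedFDeriv ℝ n (f i) x‖ :=
        Summable.of_nonneg_of_le (fun i => by positivity) (fun i => hle' n hn' i x)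
          (hB.subtype _)
      calc _ ≤ (1 + |x|) ^ N * ∑' i : {i // i ∉ s}, ‖iteratedFDeriv ℝ n (f i) x‖ := by
            gcongr; exact norm_tsum_le_tsum_norm hs3
        _ = ∑' i : {i // i ∉ s}, (1 + |x|) ^ N * ‖iteratedFDeriv ℝ n (f i) x‖ :=
            tsum_mul_left.symm
        _ ≤ _ := hs2.tsum_le_tsum (fun i => hle n hn' i x) (hB.subtype _)
    refine (Finset.sum_le_sum hterm).trans_eq ?_
    simp
  have ht := (tendsto_tsum_compl_atTop_zero B).const_mul (C * (N + 1 : ℕ))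
  rw [mul_zero] at ht
  unfold HasSum
  rw [tendsto_zero_iff_norm_tendsto_zero]
  refine squeeze_zero (fun _ => norm_nonneg _) (fun s => ?_) ht
  rw [← map_sum, mul_assoc]
  exact hG _ _ (key s)

/-! ### Sums of subexponential functions over lattices -/

theorem summable_one_add_abs_pow_neg_two : Summable fun l : ℤ => ((1 + |(l : ℝ)|) ^ 2)⁻¹ := by
  have h1 : Summable fun n : ℕ => (((n + 1 : ℕ) : ℝ) ^ 2)⁻¹ :=
    (summable_nat_add_iff (f := fun n : ℕ => ((n : ℝ) ^ 2)⁻¹) 1).2 (by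
      simp)
  refine Summable.of_nat_of_neg ?_ ?_
  · refine h1.congr fun n => ?_
    push_cast
    rw [abs_of_nonneg (by positivity), add_comm]
  · refine h1.congr fun n => ?_
    push_cast
    rw [abs_neg, abs_of_nonneg (by positivity), add_comm]

theorem exists_subexp_le_inv_sq {β c : ℝ} (h0 : 0 < β) (hc : 0 < c) :
    ∃ C : ℝ, 0 < C ∧ ∀ x, subexp β c x ≤ C * ((1 + |x|) ^ 2)⁻¹ := by
  obtain ⟨C, hC, h⟩ := exists_pow_mul_subexp_le h0 hc 2
  refine ⟨C, hC, fun x => ?_⟩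
  rw [← div_eq_mul_inv, le_div_iff₀ (by positivity), mul_comm]
  exact h x

/-- The bound is uniform in ν: shifting l by the integer part of ν P leaves an offset in [0, 1). The
power P ^ 2 is crude, but only polynomial growth in P matters. -/
theorem exists_subexp_lattice_le {β c : ℝ} (h0 : 0 < β) (hc : 0 < c) :
    ∃ C : ℝ, 0 < C ∧ ∀ P : ℝ, 1 ≤ P → ∀ ν : ℝ, Summable (fun l : ℤ => subexp β c (l / P + ν)) ∧
      ∑' l : ℤ, subexp β c (l / P + ν) ≤ C * P ^ 2 := by
  obtain ⟨C, hC, h⟩ := exists_subexp_le_inv_sq h0 hc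
  set S := ∑' l : ℤ, ((1 + |(l : ℝ)|) ^ 2)⁻¹
  have hS : 0 ≤ S := tsum_nonneg fun _ => by positivity
  refine ⟨C * 4 * (S + 1), by positivity, fun P hP ν => ?_⟩
  have hP0 : 0 < P := by linarith
  set n := ⌊ν * P⌋
  set f := Int.fract (ν * P)
  have hf0 : 0 ≤ f := Int.fract_nonneg _
  have hf1 : f < 1 := Int.fract_lt_one _
  have hν : ν = (n + f) / P := by
    rw [eq_div_iff hP0.ne']; exact (Int.floor_add_fract _).symm
  have key : ∀ l : ℤ, subexp β c (l / P + ν) ≤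
      C * 4 * P ^ 2 * ((1 + |((Equiv.addRight n l : ℤ) : ℝ)|) ^ 2)⁻¹ := by
    intro l
    refine (h _).trans ?_
    have e : (l : ℝ) / P + ν = (((l + n : ℤ) : ℝ) + f) / P := by
      rw [hν]; push_cast; ring
    rw [e, Equiv.coe_addRight, abs_div, abs_of_pos hP0]
    set k : ℝ := ((l + n : ℤ) : ℝ)
    have h1 : 1 + |k| ≤ 2 * P * (1 + |k + f| / P) := by
      have : 2 * P * (1 + |k + f| / P) = 2 * P + 2 * |k + f| := by field_simp
      rw [this]
      have h3 := abs_sub_abs_le_abs_sub k (-f)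
      rw [sub_neg_eq_add, abs_neg, abs_of_nonneg hf0] at h3
      linarith [abs_nonneg (k + f)]
    have h2 : (1 + |k|) ^ 2 ≤ 4 * P ^ 2 * (1 + |k + f| / P) ^ 2 := by
      calc (1 + |k|) ^ 2 ≤ (2 * P * (1 + |k + f| / P)) ^ 2 := by gcongr
        _ = _ := by ring
    rw [mul_assoc, mul_assoc]
    gcongr
    rw [← mul_assoc, ← div_eq_mul_inv, inv_le_comm₀ (by positivity) (by positivity), inv_div,
      div_le_iff₀ (by positivity)]
    linarith
  have hs := ((Equiv.addRight n).summable_iff.2 summable_one_add_abs_pow_neg_two).mul_left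
    (C * 4 * P ^ 2)
  have hsum := Summable.of_nonneg_of_le (fun l => (subexp_pos β c _).le) key hs
  refine ⟨hsum, (hsum.tsum_le_tsum key hs).trans ?_⟩
  rw [tsum_mul_left, (Equiv.addRight n).tsum_eq (fun l : ℤ => ((1 + |(l : ℝ)|) ^ 2)⁻¹)]
  change C * 4 * P ^ 2 * S ≤ _
  nlinarith [mul_nonneg (mul_nonneg hC.le hS) (sq_nonneg P), mul_pos hC (sq_pos_of_pos hP0)]

/-- If d stays at distance D from the ends of [-P, P], all its translates by nonzero multiples of P
remain far from the origin. Half of the rate produces the decay in D, the other half the summability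
in k. -/
theorem exists_subexp_punctured_lattice_le {β c : ℝ} (h0 : 0 < β) (hc : 0 < c) :
    ∃ C : ℝ, 0 < C ∧ ∀ P D d : ℝ, 1 ≤ D → D ≤ P → |d| ≤ P - D →
      Summable (fun k : ℤ => if k = 0 then 0 else subexp β c (d - k * P)) ∧
      ∑' k : ℤ, (if k = 0 then 0 else subexp β c (d - k * P)) ≤ C * subexp β (c / 2) D := by
  obtain ⟨C, hC, h⟩ := exists_subexp_le_inv_sq h0 (half_pos hc)
  set S := ∑' l : ℤ, ((1 + |(l : ℝ)|) ^ 2)⁻¹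
  have hS : 0 ≤ S := tsum_nonneg fun _ => by positivity
  refine ⟨C * (S + 1), by positivity, fun P D d hD hDP hd => ?_⟩
  have key : ∀ k : ℤ, (if k = 0 then 0 else subexp β c (d - k * P)) ≤
      C * subexp β (c / 2) D * ((1 + |(k : ℝ)|) ^ 2)⁻¹ := by
    intro k
    have p := subexp_pos β (c / 2) D
    split_ifs with hk
    · positivity
    · have hk1 : (1 : ℝ) ≤ |(k : ℝ)| := by
        rw [← Int.cast_abs]; exact_mod_cast Int.one_le_abs hk
      have h2 : |(k : ℝ)| * D ≤ |d - k * P| := by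
        have h3 := abs_sub_abs_le_abs_sub (k * P) d
        rw [abs_mul, abs_of_nonneg (by linarith : 0 ≤ P), abs_sub_comm] at h3
        nlinarith
      have h4 : |D| ≤ |d - k * P| := by
        rw [abs_of_nonneg (by linarith)]; nlinarith
      have h5 : |(k : ℝ)| ≤ |d - k * P| := by nlinarith
      rw [subexp_half]
      have a1 := subexp_le_of_abs_le h0.le (half_pos hc).le h4
      have a2 := (subexp_le_of_abs_le h0.le (half_pos hc).le h5).trans (h k)
      calc _ ≤ subexp β (c / 2) D * (C * ((1 + |(k : ℝ)|) ^ 2)⁻¹) := by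
            gcongr
            exact (subexp_pos _ _ _).le
        _ = _ := by ring
  have hs := summable_one_add_abs_pow_neg_two.mul_left (C * subexp β (c / 2) D)
  have hsum := Summable.of_nonneg_of_le (fun k => by
    split_ifs
    · exact le_rfl
    · exact (subexp_pos β c _).le) key hs
  refine ⟨hsum, (hsum.tsum_le_tsum key hs).trans ?_⟩
  rw [tsum_mul_left]
  change C * subexp β (c / 2) D * S ≤ _
  nlinarith [mul_pos hC (subexp_pos β (c / 2) D)]

theorem summable_subexp_sub_mul {β c : ℝ} (h0 : 0 < β) (hc : 0 < c) {P : ℝ} (hP : 1 ≤ P) (d : ℝ) :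
    Summable fun k : ℤ => subexp β c (d - k * P) := by
  obtain ⟨C, hC, h⟩ := exists_subexp_lattice_le h0 hc
  have h1 := (h 1 le_rfl (-(d / P))).1
  refine Summable.of_nonneg_of_le (fun k => (subexp_pos _ _ _).le) (fun k => ?_) h1
  refine subexp_le_of_abs_le h0.le hc.le ?_
  have : d - k * P = -P * ((k : ℝ) / 1 + -(d / P)) := by
    field_simp
    ring
  rw [this, abs_mul, abs_neg]
  exact le_mul_of_one_le_left (abs_nonneg _) (hP.trans (le_abs_self P))

/-! ### Poisson summation for Gaussian atoms -/

theorem gaussian_apply (x : ℝ) :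
    gaussian x = ((2 : ℝ) ^ (1 / 4 : ℝ) : ℝ) * Complex.exp (-Real.pi * x ^ 2) := by
  change (((2 : ℝ) ^ (1 / 4 : ℝ) * Real.exp (-Real.pi * x ^ 2) : ℝ) : ℂ) = _
  push_cast
  rfl

/-- This is the functional equation of the Jacobi theta function, applied with quadratic coefficient
P ^ 2 and a complex linear coefficient that encodes ν and x - t. -/
theorem tsum_gaussian_translates (t ν x P : ℝ) (hP : 0 < P) :
    ∑' k : ℤ, expi (-ν * (k * P)) * timeFreqShift (t - k * P) (-ν) gaussian x =
      ∑' l : ℤ, ((P⁻¹ : ℝ) : ℂ) * (gaussian (l / P + ν) * expi (-((l / P + ν) * t))) *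
        expi (l / P * x) := by
  have hPC : (P : ℂ) ≠ 0 := by exact_mod_cast hP.ne'
  have h := Complex.tsum_exp_neg_quadratic (a := (P : ℂ) ^ 2)
    (by rw [← Complex.ofReal_pow, Complex.ofReal_re]; positivity)
    (-(P : ℂ) * (Complex.I * ν + (x - t)))
  have hsq : ((P : ℂ) ^ 2) ^ (1 / 2 : ℂ) = P := by
    have : (1 / 2 : ℂ) = ((2 : ℕ) : ℂ)⁻¹ := by norm_num
    rw [this, ← Complex.ofReal_pow, ← Complex.ofReal_natCast, ← Complex.ofReal_inv,
      ← Complex.ofReal_cpow (by positivity), Real.pow_rpow_inv_natCast hP.le two_ne_zero]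
  set g : ℂ := (((2 : ℝ) ^ (1 / 4 : ℝ) : ℝ) : ℂ)
  have hl : ∀ k : ℤ, expi (-ν * (k * P)) * timeFreqShift (t - k * P) (-ν) gaussian x =
      (g * Complex.exp (-(2 * Real.pi * Complex.I * ν * x) - Real.pi * (x - t) ^ 2)) *
      Complex.exp (-Real.pi * (P : ℂ) ^ 2 * k ^ 2 +
        2 * Real.pi * (-(P : ℂ) * (Complex.I * ν + (x - t))) * k) := by
    intro k
    rw [timeFreqShift_apply, gaussian_apply, expi, expi, mul_assoc g, ← Complex.exp_add]
    have : ∀ a b c : ℂ, a * (b * (g * c)) = g * (a * b * c) := fun a b c => by ring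
    refine (this _ _ _).trans ?_
    rw [← Complex.exp_add, ← Complex.exp_add]
    congr 2
    push_cast
    ring
  have hr : ∀ l : ℤ, ((P⁻¹ : ℝ) : ℂ) * (gaussian (l / P + ν) * expi (-((l / P + ν) * t))) *
        expi (l / P * x) =
      (g * Complex.exp (-(2 * Real.pi * Complex.I * ν * x) - Real.pi * (x - t) ^ 2)) *
      (1 / P * Complex.exp (-Real.pi / (P : ℂ) ^ 2 *
        (l + Complex.I * (-(P : ℂ) * (Complex.I * ν + (x - t)))) ^ 2)) := by
    intro l
    rw [gaussian_apply, expi, expi]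
    -- The common exponential prefactor e is pulled out by dividing by it; the alternative e = 0 is
    -- excluded afterwards, as exponentials do not vanish.
    have : ∀ a b c d e : ℂ, a * (g * b * c) * d = (g * e) * (1 / P * ((P : ℂ) * a * (b * c * d) / e))
        ∨ e = 0 := by
      intro a b c d e
      by_cases he : e = 0
      · exact Or.inr he
      · left; field_simp
    rcases this ((P⁻¹ : ℝ) : ℂ) (Complex.exp (-Real.pi * ((l / P + ν : ℝ) : ℂ) ^ 2))
      (Complex.exp (2 * Real.pi * Complex.I * ((-((l / P + ν) * t) : ℝ) : ℂ)))
      (Complex.exp (2 * Real.pi * Complex.I * ((l / P * x : ℝ) : ℂ)))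
      (Complex.exp (-(2 * Real.pi * Complex.I * ν * x) - Real.pi * (x - t) ^ 2)) with h2 | h2
    · rw [h2]
      congr 2
      rw [Complex.ofReal_inv, mul_inv_cancel₀ hPC, one_mul, ← Complex.exp_add, ← Complex.exp_add,
        ← Complex.exp_sub]
      congr 1
      have hI : Complex.I ^ 2 = -1 := Complex.I_sq
      have hI4 : Complex.I ^ 3 = -Complex.I := by rw [pow_succ, hI]; ring
      have hI5 : Complex.I ^ 4 = 1 := by rw [pow_succ, hI4]; ring_nf; rw [hI]; ring
      push_cast
      field_simp
      ring_nf
      simp only [hI, hI4, hI5]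
      ring
    · exact absurd h2 (Complex.exp_ne_zero _)
  simp_rw [hl, hr]
  rw [tsum_mul_left, tsum_mul_left, h, hsq, tsum_mul_left]

theorem norm_gaussian_le {β : ℝ} (h0 : 0 < β) (h1 : β ≤ 1) : ∃ C c : ℝ, 0 < C ∧ 0 < c ∧
    ∀ x, ‖gaussian x‖ ≤ C * subexp β c x := by
  obtain ⟨C, c, hC, hc, h⟩ := hasSubexpDecay_gaussian h0 h1 0
  exact ⟨C, c, hC, hc, fun x => (norm_le_derivSum 0 _ x).trans (h x)⟩

theorem SchwartzBound.smul {N : ℕ} {f : 𝓢(ℝ, ℂ)} {B : ℝ} (h : SchwartzBound N f B) (a : ℂ) :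
    SchwartzBound N (a • f : 𝓢(ℝ, ℂ)) (‖a‖ * B) := by
  intro x
  have : derivSum N (a • f : 𝓢(ℝ, ℂ)) x = ‖a‖ * derivSum N f x := by
    unfold derivSum
    rw [Finset.mul_sum]
    refine Finset.sum_congr rfl fun i _ => ?_
    have e : ((a • f : 𝓢(ℝ, ℂ)) : ℝ → ℂ) = a • (f : ℝ → ℂ) := by
      funext y; simp
    rw [e, iteratedFDeriv_const_smul_apply (SchwartzMap.contDiff_nat f i).contDiffAt, norm_smul]
  rw [this, mul_left_comm]
  exact mul_le_mul_of_nonneg_left (h x) (norm_nonneg a)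

theorem SchwartzBound.sub {N : ℕ} {f g : 𝓢(ℝ, ℂ)} {B B' : ℝ} (hf : SchwartzBound N f B)
    (hg : SchwartzBound N g B') : SchwartzBound N (f - g : 𝓢(ℝ, ℂ)) (B + B') := by
  intro x
  have : derivSum N (f - g : 𝓢(ℝ, ℂ)) x ≤ derivSum N f x + derivSum N g x := by
    unfold derivSum
    rw [← Finset.sum_add_distrib]
    refine Finset.sum_le_sum fun i _ => ?_
    have e : ((f - g : 𝓢(ℝ, ℂ)) : ℝ → ℂ) = (f : ℝ → ℂ) - (g : ℝ → ℂ) := by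
      funext y; simp
    rw [e, iteratedFDeriv_sub_apply (SchwartzMap.contDiff_nat f i).contDiffAt
      (SchwartzMap.contDiff_nat g i).contDiffAt]
    exact norm_sub_le _ _
  have h1 := hf x
  have h2 := hg x
  have h3 : (0 : ℝ) ≤ (1 + |x|) ^ N := by positivity
  nlinarith [mul_le_mul_of_nonneg_left this h3]

theorem summable_functional (G : 𝓢(ℝ, ℂ) →L[ℂ] ℂ) {ι : Type*} (f : ι → 𝓢(ℝ, ℂ))
    (hf : ∀ N : ℕ, ∃ B : ι → ℝ, Summable B ∧ ∀ i, SchwartzBound N (f i) (B i)) :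
    Summable fun i => G (f i) := by
  obtain ⟨N, C, hC, hG⟩ := exists_bound_of_functional G
  obtain ⟨B, hB, hfB⟩ := hf N
  exact Summable.of_norm_bounded (hB.mul_left C) fun i => hG _ _ (hfB i)

theorem timeFreqShift_zero_zero (f : 𝓢(ℝ, ℂ)) : timeFreqShift 0 0 f = f := by
  ext x
  rw [timeFreqShift_apply]
  simp [expi_zero]

/-- Poisson summation for the Gaussian atoms, tested against a functional on the Schwartz space
after multiplication by a rapidly decaying window. -/
theorem tsum_functional_gaussian {β : ℝ} (h0 : 0 < β) (h1 : β ≤ 1) {ψ : 𝓢(ℝ, ℂ)}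
    (hψ : HasSubexpDecay β ψ) (G : 𝓢(ℝ, ℂ) →L[ℂ] ℂ) (t ν : ℝ) {P : ℝ} (hP : 1 ≤ P) :
    (Summable fun k : ℤ => expi (-ν * (k * P)) *
      G (schwartzMul ψ (timeFreqShift (t - k * P) (-ν) gaussian))) ∧
    (Summable fun l : ℤ => ((P⁻¹ : ℝ) : ℂ) * (gaussian (l / P + ν) * expi (-((l / P + ν) * t))) *
      G (timeFreqShift 0 (l / P) ψ)) ∧
    ∑' k : ℤ, expi (-ν * (k * P)) * G (schwartzMul ψ (timeFreqShift (t - k * P) (-ν) gaussian)) =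
      ∑' l : ℤ, ((P⁻¹ : ℝ) : ℂ) * (gaussian (l / P + ν) * expi (-((l / P + ν) * t))) *
        G (timeFreqShift 0 (l / P) ψ) := by
  have hP0 : 0 < P := by linarith
  set f : ℤ → 𝓢(ℝ, ℂ) := fun k => expi (-ν * (k * P)) •
    schwartzMul ψ (timeFreqShift (t - k * P) (-ν) gaussian)
  set g : ℤ → 𝓢(ℝ, ℂ) := fun l =>
    (((P⁻¹ : ℝ) : ℂ) * (gaussian (l / P + ν) * expi (-((l / P + ν) * t)))) •
      timeFreqShift 0 (l / P) ψ
  have hfB : ∀ N : ℕ, ∃ B : ℤ → ℝ, Summable B ∧ ∀ i, SchwartzBound N (f i) (B i) := by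
    intro N
    obtain ⟨C, c, hC, hc, h⟩ := hψ.exists_schwartzBound_mul h0 h1 (hasSubexpDecay_gaussian h0 h1) N
    have hs := summable_subexp_sub_mul h0 hc hP t
    refine ⟨fun k => C * (1 + |-ν|) ^ N * subexp β c (t - k * P), hs.mul_left _, fun k => ?_⟩
    have h2 := (h 0 0 (t - k * P) (-ν)).smul (expi (-ν * (k * P)))
    rw [norm_expi, one_mul, timeFreqShift_zero_zero] at h2
    have h3 : |(0 : ℝ)| = 0 := abs_zero
    rw [h3, add_zero, one_pow, mul_one, mul_one, zero_sub, subexp_neg] at h2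
    exact h2
  -- The Gaussian coefficients decay in l and outweigh the polynomial growth in l / P of the
  -- seminorms of the modulated window.
  have hgB : ∀ N : ℕ, ∃ B : ℤ → ℝ, Summable B ∧ ∀ i, SchwartzBound N (g i) (B i) := by
    intro N
    obtain ⟨C1, c, hC1, hc, e1⟩ := norm_gaussian_le h0 h1
    obtain ⟨C2, hC2, e2⟩ := exists_pow_mul_subexp_le_subexp h0 hc N
    obtain ⟨C3, hC3, e3⟩ := exists_derivSum_timeFreqShift_le N
    have hB := schwartzBound_of_seminorm_le N ψ
    set B := ((N + 1 : ℕ) * (2 ^ N * (Finset.Iic (N, N)).sup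
      (fun m => SchwartzMap.seminorm ℂ m.1 m.2) ψ))
    obtain ⟨C4, hC4, e4⟩ := exists_subexp_lattice_le h0 (half_pos hc)
    refine ⟨fun l => P⁻¹ * C1 * C3 * B * (1 + |ν|) ^ N * C2 * subexp β (c / 2) (l / P + ν),
      ((e4 P hP ν).1).mul_left _, fun l => ?_⟩
    have hB0 := hB.nonneg
    have h2 : SchwartzBound N (timeFreqShift 0 (l / P) ψ) (C3 * (1 + |(l : ℝ) / P|) ^ N * B) := by
      intro x
      have h3 := e3 ψ 0 (l / P) x
      rw [sub_zero] at h3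
      calc _ ≤ (1 + |x|) ^ N * (C3 * (1 + |(l : ℝ) / P|) ^ N * derivSum N ψ x) := by gcongr
        _ = C3 * (1 + |(l : ℝ) / P|) ^ N * ((1 + |x|) ^ N * derivSum N ψ x) := by ring
        _ ≤ _ := by gcongr; exact hB x
    have h4 := h2.smul (((P⁻¹ : ℝ) : ℂ) * (gaussian (l / P + ν) * expi (-((l / P + ν) * t))))
    rw [norm_mul, norm_mul, norm_expi, mul_one, Complex.norm_real, Real.norm_eq_abs,
      abs_of_pos (inv_pos.2 hP0)] at h4
    intro x
    refine (h4 x).trans ?_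
    have h5 : (1 + |(l : ℝ) / P|) ^ N ≤ (1 + |ν|) ^ N * (1 + |(l : ℝ) / P + ν|) ^ N := by
      rw [← mul_pow]
      gcongr
      have := abs_add_le ((l : ℝ) / P + ν) (-ν)
      rw [add_neg_cancel_right, abs_neg] at this
      nlinarith [mul_nonneg (abs_nonneg ν) (abs_nonneg ((l : ℝ) / P + ν))]
    have p := subexp_pos β c (l / P + ν)
    calc _ ≤ P⁻¹ * (C1 * subexp β c (l / P + ν)) *
          (C3 * ((1 + |ν|) ^ N * (1 + |(l : ℝ) / P + ν|) ^ N) * B) := by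
          gcongr; exact e1 _
      _ = P⁻¹ * C1 * C3 * B * (1 + |ν|) ^ N *
          ((1 + |(l : ℝ) / P + ν|) ^ N * subexp β c (l / P + ν)) := by ring
      _ ≤ P⁻¹ * C1 * C3 * B * (1 + |ν|) ^ N * (C2 * subexp β (c / 2) (l / P + ν)) := by
          have := e2 (l / P + ν)
          exact mul_le_mul_of_nonneg_left this (by positivity)
      _ = _ := by ring
  have sf := summable_functional G f hfB
  have sg := summable_functional G g hgB
  -- Pointwise, the difference of the two series is ψ x times the two sides of the Poisson formula,
  -- hence zero. The window supplies the convergence in the Schwartz space.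
  have hz := tsum_functional_eq_zero G (fun k => f k - g k) (fun N => by
    obtain ⟨B, hB, h2⟩ := hfB N
    obtain ⟨B', hB', h2'⟩ := hgB N
    exact ⟨fun k => B k + B' k, hB.add hB', fun k => (h2 k).sub (h2' k)⟩) (fun x => by
      have e1 : Summable fun k => f k x := by
        obtain ⟨B, hB, h2⟩ := hfB 0
        exact Summable.of_norm_bounded hB fun k => (norm_le_derivSum 0 _ x).trans
          (by simpa using h2 k x)
      have e2 : Summable fun k => g k x := by
        obtain ⟨B, hB, h2⟩ := hgB 0
        exact Summable.of_norm_bounded hB fun k => (norm_le_derivSum 0 _ x).trans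
          (by simpa using h2 k x)
      simp only [sub_apply]
      rw [e1.tsum_sub e2, sub_eq_zero]
      have hf' : ∀ k : ℤ, f k x = ψ x *
          (expi (-ν * (k * P)) * timeFreqShift (t - k * P) (-ν) gaussian x) := fun k => by
        simp only [f, smul_apply, smul_eq_mul, schwartzMul_apply]
        ring
      have hg' : ∀ l : ℤ, g l x = ψ x * (((P⁻¹ : ℝ) : ℂ) *
          (gaussian (l / P + ν) * expi (-((l / P + ν) * t))) * expi (l / P * x)) := fun l => by
        simp only [g, smul_apply, smul_eq_mul, timeFreqShift_apply, sub_zero]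
        ring
      simp_rw [hf', hg', tsum_mul_left]
      rw [tsum_gaussian_translates t ν x P hP0])
  have hG : ∀ k, G (f k - g k) = G (f k) - G (g k) := fun k => map_sub _ _ _
  have h3 := hz.tsum_eq
  simp_rw [hG] at h3
  rw [sf.tsum_sub sg, sub_eq_zero] at h3
  simp only [f, g, map_smul, smul_eq_mul] at h3 sf sg
  exact ⟨sf, sg, h3⟩

/-! ### Compactly supported functions with subexponentially decaying Fourier transform -/

theorem fourier_apply_eq (f : 𝓢(ℝ, ℂ)) (ξ : ℝ) : 𝓕 f ξ = ∫ x, expi (-(x * ξ)) * f x := by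
  rw [SchwartzMap.fourier_coe, Real.fourier_real_eq_integral_exp_smul]
  refine integral_congr_ae (Filter.Eventually.of_forall fun x => ?_)
  simp only [expi, smul_eq_mul]
  congr 2
  push_cast
  ring

theorem fourierInv_apply_eq (f : 𝓢(ℝ, ℂ)) (ξ : ℝ) : 𝓕⁻ f ξ = ∫ x, expi (x * ξ) * f x := by
  have h := SchwartzMap.fourierInv_apply_eq f
  have h2 : 𝓕⁻ f ξ = 𝓕 f (-ξ) := by rw [h]; simp
  rw [h2, fourier_apply_eq]
  simp

/-- The convolution of a compactly supported Schwartz function with a compactly supported finite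
measure. -/
theorem exists_convolution (μ : Measure ℝ) [IsFiniteMeasure μ] {r R : ℝ}
    (hμ : ∀ᵐ y ∂μ, |y| ≤ r) (f : 𝓢(ℝ, ℂ)) (hf : ∀ x, R < |x| → f x = 0) :
    ∃ g : 𝓢(ℝ, ℂ), (∀ x, g x = ∫ y, f (x - y) ∂μ) ∧ (∀ x, R + r < |x| → g x = 0) ∧
      ∀ ξ, 𝓕 g ξ = 𝓕 f ξ * ∫ y, expi (-(y * ξ)) ∂μ := by
  have hfc : HasCompactSupport f := by
    refine HasCompactSupport.of_support_subset_isCompact (isCompact_Icc (a := -R) (b := R)) ?_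
    intro x hx
    rw [Function.mem_support] at hx
    exact abs_le.1 (not_lt.1 fun h => hx (hf x h))
  set g : ℝ → ℂ := fun x => ∫ y, f (x - y) ∂μ
  have hg0 : ∀ x, R + r < |x| → g x = 0 := by
    intro x hx
    refine integral_eq_zero_of_ae ?_
    filter_upwards [hμ] with y hy
    refine hf _ ?_
    have := abs_sub_abs_le_abs_sub x y
    linarith
  have hgc : HasCompactSupport g := by
    refine HasCompactSupport.of_support_subset_isCompact
      (isCompact_Icc (a := -(R + r)) (b := R + r)) ?_
    intro x hx
    rw [Function.mem_support] at hx
    exact abs_le.1 (not_lt.1 fun h => hx (hg0 x h))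
  have hgd : ContDiff ℝ (⊤ : ℕ∞) g := by
    have := HasCompactSupport.contDiff_convolution_right (𝕜 := ℝ) (μ := μ) (f := fun _ : ℝ => (1 : ℝ))
      (ContinuousLinearMap.lsmul ℝ ℝ) (n := ⊤) hfc (locallyIntegrable_const 1) (f.smooth ⊤)
    convert this using 1
    funext x
    simp [MeasureTheory.convolution, g]
  refine ⟨hgc.toSchwartzMap hgd, fun x => rfl, hg0, fun ξ => ?_⟩
  rw [fourier_apply_eq, fourier_apply_eq]
  have hint : Integrable (fun z : ℝ × ℝ => expi (-(z.1 * ξ)) * f (z.1 - z.2))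
      ((volume : Measure ℝ).prod μ) := by
    have hcont : Continuous fun z : ℝ × ℝ => expi (-(z.1 * ξ)) * f (z.1 - z.2) :=
      (continuous_expi.comp (by fun_prop)).mul (f.continuous.comp (by fun_prop))
    rw [integrable_prod_iff' hcont.aestronglyMeasurable]
    constructor
    · refine Filter.Eventually.of_forall fun y => ?_
      have h1 : Integrable fun x => f (x - y) := (f.integrable (μ := volume)).comp_sub_right y
      refine h1.norm.mono' (by
        exact (hcont.comp (by fun_prop : Continuous fun x : ℝ => (x, y))).aestronglyMeasurable)
        (Filter.Eventually.of_forall fun x => ?_)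
      rw [norm_mul, norm_expi, one_mul]
    · have : (fun y => ∫ x, ‖expi (-(x * ξ)) * f (x - y)‖) = fun _ => ∫ x, ‖f x‖ := by
        funext y
        simp only [norm_mul, norm_expi, one_mul]
        exact integral_sub_right_eq_self (fun x => ‖f x‖) y
      simp only [this]
      exact integrable_const _
  calc ∫ x, expi (-(x * ξ)) * g x = ∫ x, ∫ y, expi (-(x * ξ)) * f (x - y) ∂μ := by
        congr 1
        funext x
        exact (integral_const_mul _ _).symm
    _ = ∫ y, (∫ x, expi (-(x * ξ)) * f (x - y)) ∂μ := integral_integral_swap hint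
    _ = ∫ y, (∫ x, expi (-(x * ξ)) * f x) * expi (-(y * ξ)) ∂μ := by
        congr 1
        funext y
        rw [← integral_mul_const]
        have := integral_sub_right_eq_self (μ := volume)
          (fun x => expi (-(x * ξ)) * f x * expi (-(y * ξ))) y
        rw [← this]
        congr 1
        funext x
        rw [mul_right_comm, ← expi_add]
        ring_nf
    _ = _ := integral_const_mul _ _

/-! ### Infinite convolutions of uniform distributions -/

theorem norm_integral_expi_unitInterval_le_one (s : ℝ) :
    ‖∫ ω : unitInterval, expi (-(ω * s))‖ ≤ 1 := by
  refine (norm_integral_le_of_norm_le_const (C := 1)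
    (Filter.Eventually.of_forall fun ω => (norm_expi _).le)).trans ?_
  simp

/-- Explicit integration bounds the modulus by 1 / (π |s|), and e < 3 < π. -/
theorem norm_integral_expi_unitInterval_le {s : ℝ} (hs : 1 ≤ |s|) :
    ‖∫ ω : unitInterval, expi (-(ω * s))‖ ≤ Real.exp (-1) := by
  have hs0 : s ≠ 0 := fun h => by simp [h] at hs; linarith
  have h1 : ∫ ω : unitInterval, expi (-(ω * s)) = ∫ x in (0 : ℝ)..1, expi (-(x * s)) := by
    rw [intervalIntegral.integral_of_le zero_le_one, ← integral_Icc_eq_integral_Ioc]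
    exact (unitInterval.measurePreserving_coe.integral_comp
      unitInterval.measurableEmbedding_coe (fun x => expi (-(x * s))))
  set κ : ℂ := -(2 * Real.pi * Complex.I * s)
  have hκ : κ ≠ 0 := by
    simp [κ, Real.pi_ne_zero, hs0]
  have h2 : ∫ x in (0 : ℝ)..1, expi (-(x * s)) =
      (Complex.exp (κ * (1 : ℝ)) - Complex.exp (κ * (0 : ℝ))) / κ := by
    rw [← integral_exp_mul_complex hκ]
    congr 1
    funext x
    simp only [expi, κ]
    congr 1
    push_cast
    ring
  have h3 : ‖Complex.exp (κ * (1 : ℝ))‖ = 1 := by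
    have e : κ * (1 : ℝ) = 2 * Real.pi * Complex.I * ((-s : ℝ) : ℂ) := by
      simp only [κ]
      push_cast
      ring
    rw [e]
    exact norm_expi (-s)
  have h4 : ‖Complex.exp (κ * (1 : ℝ)) - Complex.exp (κ * (0 : ℝ))‖ ≤ 2 := by
    refine (norm_sub_le _ _).trans ?_
    rw [h3]
    simp
    norm_num
  have h5 : ‖κ‖ = 2 * Real.pi * |s| := by
    simp [κ, abs_of_pos Real.pi_pos]
  have hpi := Real.pi_gt_three
  rw [h1, h2, norm_div, h5, Real.exp_neg, div_le_iff₀ (by positivity), inv_mul_eq_div,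
    le_div_iff₀ (Real.exp_pos _)]
  have he := Real.exp_one_lt_d9
  nlinarith [norm_nonneg (Complex.exp (κ * (1 : ℝ)) - Complex.exp (κ * (0 : ℝ)))]

open Filter Topology in
/-- A probability measure on a short interval with subexponentially decaying Fourier transform. -/
theorem exists_measure_subexp {β δ : ℝ} (h0 : 0 < β) (h1 : β < 1) (hδ : 0 < δ) :
    ∃ μ : Measure ℝ, IsProbabilityMeasure μ ∧ (∀ᵐ y ∂μ, |y| ≤ δ) ∧
      ∃ C c : ℝ, 0 < C ∧ 0 < c ∧ ∀ ξ, ‖∫ y, expi (-(y * ξ)) ∂μ‖ ≤ C * subexp β c ξ := by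
  have hsum1 : Summable fun k : ℕ => ((k + 1 : ℕ) : ℝ) ^ (-(1 / β)) :=
    (summable_nat_add_iff (f := fun k : ℕ => (k : ℝ) ^ (-(1 / β))) 1).2
      (Real.summable_nat_rpow.2 (by rw [neg_lt_neg_iff, one_lt_div h0]; exact h1))
  set S := ∑' k : ℕ, ((k + 1 : ℕ) : ℝ) ^ (-(1 / β))
  have hS : 0 < S := hsum1.tsum_pos (fun k => by positivity) 0 (by simp)
  -- The measure is the law of ∑ d k ω k with independent uniform ω k. The widths decrease like (k +
  -- 1) ^ (-1 / β), which is summable because β < 1, and are normalized to have sum δ.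
  set d : ℕ → ℝ := fun k => δ / S * ((k + 1 : ℕ) : ℝ) ^ (-(1 / β))
  have hd0 : ∀ k, 0 < d k := fun k => by positivity
  have hdsum : Summable d := hsum1.mul_left _
  have hdS : ∑' k, d k = δ := by
    rw [tsum_mul_left]
    exact div_mul_cancel₀ δ hS.ne'
  let Ω := ℕ → unitInterval
  let Pr : Measure Ω := Measure.infinitePi fun _ => (volume : Measure unitInterval)
  let X : Ω → ℝ := fun ω => ∑' k, d k * ω k
  have hω : ∀ ω : Ω, ∀ k, ‖d k * (ω k : ℝ)‖ ≤ d k := fun ω k => by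
    rw [Real.norm_eq_abs, abs_of_nonneg (mul_nonneg (hd0 k).le (ω k).2.1)]
    exact mul_le_of_le_one_right (hd0 k).le (ω k).2.2
  have hXs : ∀ ω : Ω, Summable fun k => d k * (ω k : ℝ) := fun ω =>
    Summable.of_norm_bounded hdsum (hω ω)
  have hXle : ∀ ω, |X ω| ≤ δ := fun ω => by
    rw [← hdS, ← Real.norm_eq_abs]
    exact tsum_of_norm_bounded hdsum.hasSum (hω ω)
  have hpart : ∀ M : ℕ, Measurable fun ω : Ω => ∑ k ∈ Finset.range M, d k * (ω k : ℝ) := fun M =>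
    Finset.measurable_fun_sum _ fun k _ =>
      (measurable_subtype_coe.comp (measurable_pi_apply k)).const_mul _
  have hlim : ∀ ω : Ω, Tendsto (fun M => ∑ k ∈ Finset.range M, d k * (ω k : ℝ)) atTop (𝓝 (X ω)) :=
    fun ω => (hXs ω).hasSum.tendsto_sum_nat
  have hXm : Measurable X := measurable_of_tendsto_metrizable hpart (tendsto_pi_nhds.2 hlim)
  refine ⟨Pr.map X, Measure.isProbabilityMeasure_map hXm.aemeasurable, ?_, Real.exp 1,
    (δ / S) ^ β, Real.exp_pos _, by positivity, fun ξ => ?_⟩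
  · rw [ae_map_iff hXm.aemeasurable (measurableSet_le continuous_abs.measurable measurable_const)]
    exact Filter.Eventually.of_forall hXle
  have hce : Continuous fun y : ℝ => expi (-(y * ξ)) := continuous_expi.comp (by fun_prop)
  rw [integral_map hXm.aemeasurable hce.aestronglyMeasurable]
  have hcs : ∀ s : ℝ, Continuous fun ω : unitInterval => expi (-(ω * s)) := fun s =>
    continuous_expi.comp (by fun_prop)
  have hprod : ∀ M : ℕ, ∫ ω, expi (-((∑ k ∈ Finset.range M, d k * (ω k : ℝ)) * ξ)) ∂Pr =
      ∏ k : Fin M, ∫ ω : unitInterval, expi (-(ω * (d k * ξ))) := by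
    intro M
    have hind : ProbabilityTheory.iIndepFun (fun (k : ℕ) (ω : Ω) => ω k) Pr :=
      ProbabilityTheory.iIndepFun_infinitePi (X := fun _ ω => ω) (fun _ => measurable_id)
    have hind2 := hind.precomp (g := fun k : Fin M => (k : ℕ)) Fin.val_injective
    have h := hind2.integral_fun_prod_comp (𝕜 := ℂ)
      (f := fun (k : Fin M) (ω : unitInterval) => expi (-(ω * (d k * ξ))))
      (fun k => (measurable_pi_apply (k : ℕ)).aemeasurable)
      (fun k => (hcs (d k * ξ)).aestronglyMeasurable)
    calc _ = ∫ ω : Ω, ∏ k : Fin M, expi (-((ω k : ℝ) * (d k * ξ))) ∂Pr := by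
          congr 1
          funext ω
          have hexp : ∀ (s : Finset ℕ) (g : ℕ → ℝ), expi (∑ k ∈ s, g k) = ∏ k ∈ s, expi (g k) := by
            intro s g
            induction s using Finset.cons_induction with
            | empty => simp [expi_zero]
            | cons a s ha ih => rw [Finset.sum_cons, Finset.prod_cons, expi_add, ih]
          rw [Finset.sum_mul, ← Finset.sum_neg_distrib, hexp, ← Fin.prod_univ_eq_prod_range]
          refine Finset.prod_congr rfl fun k _ => ?_
          congr 1
          ring
      _ = _ := h
      _ = _ := by
          refine Finset.prod_congr rfl fun k _ => ?_
          exact (measurePreserving_eval_infinitePi (fun _ => (volume : Measure unitInterval))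
            (k : ℕ)).hasLaw.integral_comp
            (hcs (d k * ξ)).aestronglyMeasurable
  have hconv : Tendsto (fun M : ℕ => ∫ ω, expi (-((∑ k ∈ Finset.range M, d k * (ω k : ℝ)) * ξ)) ∂Pr)
      atTop (𝓝 (∫ ω, expi (-(X ω * ξ)) ∂Pr)) := by
    refine tendsto_integral_of_dominated_convergence (fun _ => 1) (fun M => ?_)
      (integrable_const _) (fun M => Filter.Eventually.of_forall fun ω => (norm_expi _).le)
      (Filter.Eventually.of_forall fun ω => ?_)
    · exact (continuous_expi.measurable.comp ((hpart M).mul_const ξ).neg).aestronglyMeasurable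
    · exact (continuous_expi.tendsto _).comp (((hlim ω).mul_const ξ).neg)
  -- This counts the factors with d k |ξ| ≥ 1. Each contributes at most exp (-1), and the remaining
  -- factors are at most 1.
  set n := ⌊(δ / S * |ξ|) ^ β⌋₊
  have hbound : ∀ M ≥ n, ‖∫ ω, expi (-((∑ k ∈ Finset.range M, d k * (ω k : ℝ)) * ξ)) ∂Pr‖ ≤
      Real.exp (-n) := by
    intro M hM
    rw [hprod M, Fin.prod_univ_eq_prod_range
      (fun k => ∫ ω : unitInterval, expi (-(ω * (d k * ξ)))) M, norm_prod,
      ← Finset.prod_range_mul_prod_Ico _ hM]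
    have e1 : ∏ k ∈ Finset.range n, ‖∫ ω : unitInterval, expi (-(ω * (d k * ξ)))‖ ≤
        ∏ k ∈ Finset.range n, Real.exp (-1) := by
      refine Finset.prod_le_prod (fun _ _ => norm_nonneg _) fun k hk => ?_
      refine norm_integral_expi_unitInterval_le ?_
      have hk' : k + 1 ≤ n := Finset.mem_range.1 hk
      have h3 : ((k + 1 : ℕ) : ℝ) ≤ (δ / S * |ξ|) ^ β :=
        (Nat.le_floor_iff (by positivity)).1 hk'
      have h4 : ((k + 1 : ℕ) : ℝ) ^ (1 / β) ≤ δ / S * |ξ| := by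
        have := Real.rpow_le_rpow (by positivity) h3 (by positivity : 0 ≤ 1 / β)
        rwa [← Real.rpow_mul (by positivity), mul_one_div_cancel h0.ne', Real.rpow_one] at this
      rw [abs_mul, abs_of_pos (hd0 k)]
      simp only [d]
      rw [Real.rpow_neg (by positivity), mul_right_comm, ← div_eq_mul_inv,
        one_le_div (by positivity)]
      exact h4
    have e2 : ∏ k ∈ Finset.Ico n M, ‖∫ ω : unitInterval, expi (-(ω * (d k * ξ)))‖ ≤ 1 :=
      Finset.prod_le_one (fun _ _ => norm_nonneg _)
        fun k _ => norm_integral_expi_unitInterval_le_one _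
    have e3 : ∏ k ∈ Finset.range n, Real.exp (-1) = Real.exp (-n) := by
      rw [Finset.prod_const, Finset.card_range, ← Real.exp_nat_mul]
      ring_nf
    rw [e3] at e1
    have e4 : 0 ≤ ∏ k ∈ Finset.Ico n M, ‖∫ ω : unitInterval, expi (-(ω * (d k * ξ)))‖ :=
      Finset.prod_nonneg fun _ _ => norm_nonneg _
    calc _ ≤ Real.exp (-n) * 1 := mul_le_mul e1 e2 e4 (Real.exp_pos _).le
      _ = _ := mul_one _
  have hle : ‖∫ ω, expi (-(X ω * ξ)) ∂Pr‖ ≤ Real.exp (-n) :=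
    le_of_tendsto hconv.norm (Filter.eventually_atTop.2 ⟨n, hbound⟩)
  refine hle.trans ?_
  unfold subexp
  rw [← Real.exp_add, Real.exp_le_exp, ← Real.mul_rpow (by positivity) (abs_nonneg _)]
  -- Rounding down loses less than one unit in the exponent, whence the constant exp 1.
  have := Nat.lt_floor_add_one ((δ / S * |ξ|) ^ β)
  linarith

/-- A smooth bump of integral one on a short interval, with subexponentially decaying Fourier
transform. -/
theorem exists_bump_subexp {β δ : ℝ} (h0 : 0 < β) (h1 : β < 1) (hδ : 0 < δ) :
    ∃ ψ : 𝓢(ℝ, ℂ), (∀ x, δ < |x| → ψ x = 0) ∧ 𝓕 ψ 0 = 1 ∧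
      ∃ C c : ℝ, 0 < C ∧ 0 < c ∧ ∀ ξ, ‖𝓕 ψ ξ‖ ≤ C * subexp β c ξ := by
  obtain ⟨μ, hμ, hμs, C, c, hC, hc, hdec⟩ := exists_measure_subexp h0 h1 (half_pos hδ)
  -- The bump only supplies smoothness and the normalization of the integral; the decay of the
  -- Fourier transform comes from convolving with μ.
  let b : ContDiffBump (0 : ℝ) := ⟨δ / 4, δ / 2, by positivity, by linarith⟩
  have hbs : ContDiff ℝ (⊤ : ℕ∞) fun x => ((b.normed volume x : ℝ) : ℂ) :=
    Complex.ofRealCLM.contDiff.comp b.contDiff_normed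
  have hbc : HasCompactSupport fun x => ((b.normed volume x : ℝ) : ℂ) :=
    b.hasCompactSupport_normed.comp_left (g := fun x : ℝ => (x : ℂ)) Complex.ofReal_zero
  let f : 𝓢(ℝ, ℂ) := hbc.toSchwartzMap hbs
  have hf : ∀ x, f x = ((b.normed volume x : ℝ) : ℂ) := fun x => rfl
  have hf0 : ∀ x, δ / 2 < |x| → f x = 0 := fun x hx => by
    rw [hf, ContDiffBump.normed_def, b.zero_of_le_dist (by
      rw [Real.dist_eq, sub_zero]; exact hx.le)]
    simp
  have hf1 : 𝓕 f 0 = 1 := by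
    rw [fourier_apply_eq]
    simp only [mul_zero, neg_zero, expi_zero, one_mul, hf]
    rw [integral_complex_ofReal, b.integral_normed, Complex.ofReal_one]
  obtain ⟨ψ, -, hψ0, hψ⟩ := exists_convolution μ hμs f hf0
  obtain ⟨D, hD⟩ : ∃ D : ℝ, ∀ ξ, ‖𝓕 f ξ‖ ≤ D :=
    ⟨_, fun ξ => SchwartzMap.norm_le_seminorm ℂ (𝓕 f) ξ⟩
  have hD0 : 0 ≤ D := (norm_nonneg _).trans (hD 0)
  refine ⟨ψ, fun x hx => hψ0 x (by linarith), ?_, (D + 1) * C, c, by positivity, hc, fun ξ => ?_⟩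
  · rw [hψ, hf1]
    simp [expi_zero]
  · rw [hψ, norm_mul, mul_assoc]
    have := hD ξ
    exact mul_le_mul (by linarith) (hdec ξ) (norm_nonneg _) (by positivity)

/-! ### Windows obtained by smoothing a box -/

theorem integral_Icc_expi (k : ℤ) {s : ℝ} (hs : 0 < s) :
    ∫ y in Set.Icc (-(1 / (2 * s))) (1 / (2 * s)), expi (-(y * (k * s))) =
      if k = 0 then ((1 / s : ℝ) : ℂ) else 0 := by
  have hle : -(1 / (2 * s)) ≤ 1 / (2 * s) := by
    have : 0 < 1 / (2 * s) := by positivity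
    linarith
  rw [integral_Icc_eq_integral_Ioc, ← intervalIntegral.integral_of_le hle]
  split_ifs with hk
  · subst hk
    simp only [Int.cast_zero, zero_mul, mul_zero, neg_zero, expi_zero]
    rw [intervalIntegral.integral_const]
    simp only [Complex.real_smul, mul_one]
    congr 1
    field_simp
    ring
  · set κ : ℂ := -(2 * Real.pi * Complex.I * (k * s))
    have hκ : κ ≠ 0 := by
      simp [κ, Real.pi_ne_zero, hk, hs.ne']
    have h2 : ∫ y in (-(1 / (2 * s)))..(1 / (2 * s)), expi (-(y * (k * s))) =
        (Complex.exp (κ * (1 / (2 * s) : ℝ)) - Complex.exp (κ * (-(1 / (2 * s)) : ℝ))) / κ := by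
      rw [← integral_exp_mul_complex hκ]
      congr 1
      funext x
      simp only [expi, κ]
      congr 1
      push_cast
      ring
    have hsC : (s : ℂ) ≠ 0 := by exact_mod_cast hs.ne'
    -- An interval of length 1 / s holds exactly |k| periods of the character, so the two endpoint
    -- values agree.
    have h3 : κ * (1 / (2 * s) : ℝ) = κ * (-(1 / (2 * s)) : ℝ) +
        ((-k : ℤ) : ℂ) * (2 * Real.pi * Complex.I) := by
      simp only [κ]
      push_cast
      field_simp
      ring
    rw [h2, h3, Complex.exp_add, Complex.exp_int_mul_two_pi_mul_I, mul_one, sub_self, zero_div]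

/-- A window `a` on an interval of length `ℓ` whose translates by `1 / s` sum to a constant, and a
function `τ` on the same interval with `τ a = a`. -/
theorem exists_window {β ℓ s : ℝ} (h0 : 0 < β) (h1 : β < 1) (hs : 0 < s) (hℓ : 1 / s < ℓ) :
    ∃ (a τ : 𝓢(ℝ, ℂ)) (r : ℝ), r < ℓ / 2 ∧ (∀ x, r < |x| → a x = 0) ∧ (∀ x, r < |x| → τ x = 0) ∧
      (∀ x, τ x * a x = a x) ∧ (∀ k : ℤ, 𝓕 a (k * s) = if k = 0 then 1 else 0) ∧
      (∃ C c : ℝ, 0 < C ∧ 0 < c ∧ ∀ ξ, ‖𝓕 a ξ‖ ≤ C * subexp β c ξ) ∧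
      (∃ C c : ℝ, 0 < C ∧ 0 < c ∧ ∀ ξ, ‖𝓕 τ ξ‖ ≤ C * subexp β c ξ) := by
  -- All supports below lie within 1 / (2 s) + 3 δ of the origin, and 3 / 16 < 1 / 2 keeps this
  -- radius below ℓ / 2.
  set δ := (ℓ - 1 / s) / 16
  have hδ : 0 < δ := div_pos (sub_pos.2 hℓ) (by norm_num)
  obtain ⟨ψ, hψ0, hψ1, C, c, hC, hc, hψ⟩ := exists_bump_subexp h0 h1 hδ
  have hbox : ∀ l : ℝ, ∃ g : 𝓢(ℝ, ℂ), (∀ x, g x = ∫ y in Set.Icc (-l) l, ψ (x - y)) ∧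
      (∀ x, δ + l < |x| → g x = 0) ∧
      (∀ ξ, 𝓕 g ξ = 𝓕 ψ ξ * ∫ y in Set.Icc (-l) l, expi (-(y * ξ))) ∧
      (∃ C c : ℝ, 0 < C ∧ 0 < c ∧ ∀ ξ, ‖𝓕 g ξ‖ ≤ C * subexp β c ξ) := by
    intro l
    obtain ⟨g, hg, hg0, hgF⟩ := exists_convolution (volume.restrict (Set.Icc (-l) l)) (r := l)
      ((ae_restrict_iff' measurableSet_Icc).2 (Filter.Eventually.of_forall fun y hy =>
        abs_le.2 hy)) ψ hψ0
    refine ⟨g, hg, hg0, hgF, C * (volume.real (Set.Icc (-l) l) + 1), c, by positivity, hc,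
      fun ξ => ?_⟩
    have h2 : ‖∫ y in Set.Icc (-l) l, expi (-(y * ξ))‖ ≤ volume.real (Set.Icc (-l) l) + 1 := by
      refine (norm_integral_le_of_norm_le_const (C := 1)
        (Filter.Eventually.of_forall fun ω => (norm_expi _).le)).trans ?_
      simp
    rw [hgF, norm_mul, mul_right_comm]
    exact mul_le_mul (hψ ξ) h2 (norm_nonneg _)
      (mul_nonneg hC.le (subexp_pos _ _ _).le)
  -- The box of length 1 / s makes 𝓕 g vanish at the nonzero multiples of s.
  obtain ⟨g, hg, hg0, hgF, Cg, cg, hCg, hcg, hgd⟩ := hbox (1 / (2 * s))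
  -- Widening the box by 2 δ on each side leaves room for ψ, of radius δ and integral one. Hence τ
  -- equals 1 wherever g may be nonzero.
  obtain ⟨τ, hτ, hτ0, hτF, hτd⟩ := hbox (1 / (2 * s) + 2 * δ)
  have hsC : (s : ℂ) ≠ 0 := by exact_mod_cast hs.ne'
  have hs2 : 1 / (2 * s) = (1 / s) / 2 := by field_simp
  have hFa : ∀ ξ, 𝓕 ((s : ℂ) • g) ξ = s * 𝓕 g ξ := fun ξ => by
    rw [FourierTransform.fourier_smul]
    simp
  refine ⟨(s : ℂ) • g, τ, 1 / (2 * s) + 3 * δ, ?_, fun x hx => ?_, fun x hx => hτ0 x (by linarith),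
    fun x => ?_, fun k => ?_, ⟨s * Cg, cg, by positivity, hcg, fun ξ => ?_⟩, hτd⟩
  · rw [hs2]
    simp only [δ]
    linarith
  · rw [smul_apply, hg0 x (by linarith), smul_zero]
  · rcases le_or_gt |x| (1 / (2 * s) + δ) with hx | hx
    · have : τ x = 1 := by
        rw [hτ, ← hψ1, fourier_apply_eq]
        simp only [mul_zero, neg_zero, expi_zero, one_mul]
        rw [setIntegral_eq_integral_of_forall_compl_eq_zero]
        · exact integral_sub_left_eq_self (fun y => ψ y) volume x
        · intro y hy
          refine hψ0 _ ?_
          by_contra! h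
          refine hy (abs_le.1 ?_)
          have h3 := abs_sub_abs_le_abs_sub y x
          rw [abs_sub_comm y x] at h3
          linarith
      rw [this, one_mul]
    · rw [smul_apply, hg0 x (by linarith), smul_zero, mul_zero]
  · rw [hFa, hgF, integral_Icc_expi k hs]
    split_ifs with hk
    · subst hk
      rw [Int.cast_zero, zero_mul, hψ1, one_mul]
      push_cast
      field_simp
    · rw [mul_zero, mul_zero]
  · rw [hFa, norm_mul, Complex.norm_real, Real.norm_eq_abs, abs_of_pos hs, mul_assoc]
    have := hgd ξ
    gcongr

/-! ### Operators with compactly supported spreading function -/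

/-- The transpose `φ ↦ 𝓕 (𝓕 A · 𝓕⁻ (𝓕⁻ B · φ))` of the operator with spreading function
`(t, ν) ↦ A t * B ν`. -/
def windowTranspose (A B : 𝓢(ℝ, ℂ)) : 𝓢(ℝ, ℂ) →L[ℂ] 𝓢(ℝ, ℂ) :=
  FourierTransform.fourierCLM ℂ 𝓢(ℝ, ℂ) ∘L schwartzMul (𝓕 A) ∘L
    FourierTransform.fourierInvCLM ℂ 𝓢(ℝ, ℂ) ∘L schwartzMul (𝓕⁻ B)

theorem windowTranspose_apply (A B φ : 𝓢(ℝ, ℂ)) :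
    windowTranspose A B φ = 𝓕 (schwartzMul (𝓕 A) (𝓕⁻ (schwartzMul (𝓕⁻ B) φ))) := rfl

theorem toTemperedDistribution_apply_line (f g : 𝓢(ℝ, ℂ)) :
    toTemperedDistributionCLM ℝ ℂ volume f g = ∫ x, g x * f x :=
  toTemperedDistributionCLM_apply_apply volume f g

theorem toTemperedDistribution_apply_plane (f g : 𝓢(ℝ × ℝ, ℂ)) :
    toTemperedDistributionCLM (ℝ × ℝ) ℂ volume f g = ∫ x, g x * f x :=
  toTemperedDistributionCLM_apply_apply volume f g

section Family

variable {ι : Type*} [Fintype ι]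

/-- The transpose of the operator with spreading function `∑ i, c i * A i t * B i ν`. -/
def familyTranspose (A B : ι → 𝓢(ℝ, ℂ)) (c : ι → ℂ) : 𝓢(ℝ, ℂ) →L[ℂ] 𝓢(ℝ, ℂ) :=
  ∑ i, c i • windowTranspose (A i) (B i)

theorem familyTranspose_apply (A B : ι → 𝓢(ℝ, ℂ)) (c : ι → ℂ) (φ : 𝓢(ℝ, ℂ)) :
    familyTranspose A B c φ = ∑ i, c i • windowTranspose (A i) (B i) φ := by
  simp [familyTranspose]

/-- The weak-* continuous operator on tempered distributions with spreading function
`∑ i, c i * A i t * B i ν`. -/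
def familyExtension (A B : ι → 𝓢(ℝ, ℂ)) (c : ι → ℂ) : 𝓢'(ℝ, ℂ) →L[ℂ] 𝓢'(ℝ, ℂ) :=
  PointwiseConvergenceCLM.precomp ℂ (familyTranspose A B c)

theorem familyExtension_apply (A B : ι → 𝓢(ℝ, ℂ)) (c : ι → ℂ) (g : 𝓢'(ℝ, ℂ)) (φ : 𝓢(ℝ, ℂ)) :
    familyExtension A B c g φ = ∑ i, c i * g (windowTranspose (A i) (B i) φ) := by
  change g (familyTranspose A B c φ) = _
  rw [familyTranspose_apply, map_sum]
  simp

/-- The restriction of `familyExtension` to Schwartz functions. -/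
def familyOperator (A B : ι → 𝓢(ℝ, ℂ)) (c : ι → ℂ) : 𝓢(ℝ, ℂ) →L[ℂ] 𝓢'(ℝ, ℂ) :=
  familyExtension A B c ∘L toTemperedDistributionCLM ℝ ℂ volume

theorem isExtension_familyOperator (A B : ι → 𝓢(ℝ, ℂ)) (c : ι → ℂ) :
    IsExtension (familyOperator A B c) (familyExtension A B c) := fun _ => rfl

/-- The Kohn-Nirenberg symbol of `familyOperator`. -/
def familySymbol (A B : ι → 𝓢(ℝ, ℂ)) (c : ι → ℂ) : 𝓢(ℝ × ℝ, ℂ) :=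
  ∑ i, c i • tensor (𝓕⁻ (B i)) (𝓕 (A i))

theorem tensor_apply (φ ψ : 𝓢(ℝ, ℂ)) (z : ℝ × ℝ) : tensor φ ψ z = φ z.1 * ψ z.2 := rfl

theorem familySymbol_apply (A B : ι → 𝓢(ℝ, ℂ)) (c : ι → ℂ) (z : ℝ × ℝ) :
    familySymbol A B c z = ∑ i, c i * (𝓕⁻ (B i) z.1 * 𝓕 (A i) z.2) := by
  simp [familySymbol, tensor_apply]

theorem chirp_tensor_apply (φ ψ : 𝓢(ℝ, ℂ)) (z : ℝ × ℝ) :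
    smulLeftCLM ℂ (fun z : ℝ × ℝ => expi (z.1 * z.2)) (tensor φ ψ) z =
      expi (z.1 * z.2) * (φ z.1 * ψ z.2) := by
  rw [smulLeftCLM_apply_apply hasTemperateGrowth_expi_chirp, tensor_apply, smul_eq_mul]

theorem integrable_schwartz_mul {E : Type*} [NormedAddCommGroup E] [NormedSpace ℝ E]
    [MeasurableSpace E] [BorelSpace E] [SecondCountableTopology E] {μ : Measure E}
    [μ.HasTemperateGrowth] (f g : 𝓢(E, ℂ)) : Integrable (fun x => f x * g x) μ := by
  have := (smulLeftCLM ℂ f g).integrable (μ := μ)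
  refine this.congr (Filter.Eventually.of_forall fun x => ?_)
  rw [smulLeftCLM_apply_apply f.hasTemperateGrowth, smul_eq_mul]

/-- The outer Fourier transform moves onto f, and writing out the inverse transform of the inner
product as an integral produces the chirp. What remains is the tensor symbol. -/
theorem integral_windowTranspose_mul (A B φ f : 𝓢(ℝ, ℂ)) :
    ∫ x, f x * windowTranspose A B φ x =
      ∫ z : ℝ × ℝ, smulLeftCLM ℂ (fun z : ℝ × ℝ => expi (z.1 * z.2)) (tensor φ (𝓕 f)) z *
        tensor (𝓕⁻ B) (𝓕 A) z := by
  have hint := integrable_schwartz_mul (μ := (volume : Measure (ℝ × ℝ)))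
    (smulLeftCLM ℂ (fun z : ℝ × ℝ => expi (z.1 * z.2)) (tensor φ (𝓕 f)))
    (tensor (𝓕⁻ B) (𝓕 A))
  rw [Measure.volume_eq_prod] at hint ⊢
  rw [integral_prod_symm _ hint]
  rw [windowTranspose_apply, ← SchwartzMap.integral_fourier_mul_eq]
  refine integral_congr_ae (Filter.Eventually.of_forall fun ξ => ?_)
  simp only [chirp_tensor_apply, tensor_apply]
  rw [schwartzMul_apply, fourierInv_apply_eq, ← integral_const_mul, ← integral_const_mul]
  refine integral_congr_ae (Filter.Eventually.of_forall fun x => ?_)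
  simp only [schwartzMul_apply]
  ring

theorem isKohnNirenbergSymbol_familyOperator (A B : ι → 𝓢(ℝ, ℂ)) (c : ι → ℂ) :
    IsKohnNirenbergSymbol (familyOperator A B c)
      (toTemperedDistributionCLM (ℝ × ℝ) ℂ volume (familySymbol A B c)) := by
  intro f φ
  change familyExtension A B c (toTemperedDistributionCLM ℝ ℂ volume f) φ = _
  rw [familyExtension_apply, toTemperedDistribution_apply_plane]
  have h : ∀ z, smulLeftCLM ℂ (fun z : ℝ × ℝ => expi (z.1 * z.2)) (tensor φ (𝓕 f)) z *
      familySymbol A B c z = ∑ i, c i *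
        (smulLeftCLM ℂ (fun z : ℝ × ℝ => expi (z.1 * z.2)) (tensor φ (𝓕 f)) z *
          tensor (𝓕⁻ (B i)) (𝓕 (A i)) z) := by
    intro z
    rw [familySymbol_apply, Finset.mul_sum]
    refine Finset.sum_congr rfl fun i _ => ?_
    rw [tensor_apply]
    ring
  simp_rw [h]
  rw [integral_finsetSum _ fun i _ => (integrable_schwartz_mul _ _).const_mul _]
  refine Finset.sum_congr rfl fun i _ => ?_
  rw [integral_const_mul, ← integral_windowTranspose_mul, toTemperedDistribution_apply_line]
  congr 1
  refine integral_congr_ae (Filter.Eventually.of_forall fun x => ?_)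
  simp only
  ring

theorem isRepresentedBy_familySymbol (A B : ι → 𝓢(ℝ, ℂ)) (c : ι → ℂ) :
    IsRepresentedBy (toTemperedDistributionCLM (ℝ × ℝ) ℂ volume (familySymbol A B c))
      (familySymbol A B c) := by
  refine ⟨(familySymbol A B c).continuous.locallyIntegrable, fun Φ _ => ?_⟩
  rw [toTemperedDistribution_apply_plane]
  refine integral_congr_ae (Filter.Eventually.of_forall fun x => ?_)
  simp only
  ring

/-! ### The support of the spreading function -/

/-- By Fubini and Fourier inversion in each variable, the symbol 𝓕⁻ B ⊗ 𝓕 A has spreading function A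
⊗ B. -/
theorem integral_symplecticFourierTranspose_mul_tensor (A B : 𝓢(ℝ, ℂ)) (Φ : 𝓢(ℝ × ℝ, ℂ)) :
    ∫ z : ℝ × ℝ, symplecticFourierTranspose Φ z * tensor (𝓕⁻ B) (𝓕 A) z =
      ∫ y : ℝ × ℝ, Φ y * (A y.1 * B y.2) := by
  set σ := tensor (𝓕⁻ B) (𝓕 A)
  have hint : Integrable (fun p : (ℝ × ℝ) × (ℝ × ℝ) =>
      expi (-(p.2.2 * p.1.1 - p.1.2 * p.2.1)) * Φ p.2 * σ p.1)
      ((volume : Measure (ℝ × ℝ)).prod volume) := by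
    have h1 : Integrable (fun p : (ℝ × ℝ) × (ℝ × ℝ) => σ p.1 * Φ p.2)
        ((volume : Measure (ℝ × ℝ)).prod volume) := σ.integrable.mul_prod Φ.integrable
    refine h1.norm.mono' ?_ (Filter.Eventually.of_forall fun p => ?_)
    · refine Continuous.aestronglyMeasurable ?_
      refine ((continuous_expi.comp (by fun_prop)).mul (Φ.continuous.comp (by fun_prop))).mul
        (σ.continuous.comp (by fun_prop))
    · simp only [norm_mul, norm_expi, one_mul]
      rw [mul_comm]
  calc ∫ z : ℝ × ℝ, symplecticFourierTranspose Φ z * σ z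
      = ∫ z : ℝ × ℝ, ∫ y : ℝ × ℝ, expi (-(y.2 * z.1 - z.2 * y.1)) * Φ y * σ z := by
        refine integral_congr_ae (Filter.Eventually.of_forall fun z => ?_)
        simp only
        rw [integral_mul_const, ← symplecticFourierTranspose_apply]
    _ = ∫ y : ℝ × ℝ, ∫ z : ℝ × ℝ, expi (-(y.2 * z.1 - z.2 * y.1)) * Φ y * σ z :=
        integral_integral_swap hint
    _ = ∫ y : ℝ × ℝ, Φ y * (A y.1 * B y.2) := by
        refine integral_congr_ae (Filter.Eventually.of_forall fun y => ?_)
        simp only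
        have hB : B y.2 = ∫ x, expi (-(x * y.2)) * 𝓕⁻ B x := by
          rw [← fourier_apply_eq, FourierTransform.fourier_fourierInv_eq]
        have hA : A y.1 = ∫ x, expi (x * y.1) * 𝓕 A x := by
          rw [← fourierInv_apply_eq, FourierTransform.fourierInv_fourier_eq]
        rw [mul_comm (A y.1), hB, hA, ← integral_prod_mul, ← Measure.volume_eq_prod,
          ← integral_const_mul]
        refine integral_congr_ae (Filter.Eventually.of_forall fun z => ?_)
        simp only [σ, tensor_apply]
        have : -(y.2 * z.1 - z.2 * y.1) = -(z.1 * y.2) + z.2 * y.1 := by ring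
        rw [this, expi_add]
        ring

theorem symplecticFourier_familySymbol_apply (A B : ι → 𝓢(ℝ, ℂ)) (c : ι → ℂ) (Φ : 𝓢(ℝ × ℝ, ℂ)) :
    symplecticFourier (toTemperedDistributionCLM (ℝ × ℝ) ℂ volume (familySymbol A B c)) Φ =
      ∑ i, c i * ∫ y : ℝ × ℝ, Φ y * (A i y.1 * B i y.2) := by
  change toTemperedDistributionCLM (ℝ × ℝ) ℂ volume (familySymbol A B c)
    (symplecticFourierTranspose Φ) = _
  rw [toTemperedDistribution_apply_plane]
  have h : ∀ z, symplecticFourierTranspose Φ z * familySymbol A B c z = ∑ i, c i *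
        (symplecticFourierTranspose Φ z * tensor (𝓕⁻ (B i)) (𝓕 (A i)) z) := by
    intro z
    rw [familySymbol_apply, Finset.mul_sum]
    refine Finset.sum_congr rfl fun i _ => ?_
    rw [tensor_apply]
    ring
  simp_rw [h]
  rw [integral_finsetSum _ fun i _ => (integrable_schwartz_mul _ _).const_mul _]
  refine Finset.sum_congr rfl fun i _ => ?_
  rw [integral_const_mul, integral_symplecticFourierTranspose_mul_tensor]

/-- The spreading distribution is an honest function vanishing off Z, so it annihilates every test
function supported in the complement. -/
theorem dsupport_symplecticFourier_subset (A B : ι → 𝓢(ℝ, ℂ)) (c : ι → ℂ) {Z : Set (ℝ × ℝ)}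
    (hZ : IsClosed Z) (h : ∀ i, ∀ y : ℝ × ℝ, y ∉ Z → A i y.1 * B i y.2 = 0) :
    Distribution.dsupport (symplecticFourier
      (toTemperedDistributionCLM (ℝ × ℝ) ℂ volume (familySymbol A B c))) ⊆ Z := by
  intro x hx
  refine (Distribution.mem_dsupport_iff x).1 hx Z (fun Φ hΦ => ?_) hZ
  rw [symplecticFourier_familySymbol_apply]
  refine Finset.sum_eq_zero fun i _ => ?_
  rw [integral_eq_zero_of_ae, mul_zero]
  refine Filter.Eventually.of_forall fun y => ?_
  by_cases hy : y ∈ Z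
  · have : Φ y = 0 := image_eq_zero_of_notMem_tsupport fun h' => hΦ h' hy
    simp [this]
  · simp [h i y hy]

end Family

/-! ### Uniqueness of the symbol -/

/-- A smooth compactly supported function on the line that is `1` on `closedBall c r` and vanishes
off `closedBall c (r + 1 / (n + 1))`. -/
def ballBump (c : ℝ) {r : ℝ} (hr : 0 < r) (n : ℕ) : ContDiffBump c where
  rIn := r
  rOut := r + 1 / ((n : ℝ) + 1)
  rIn_pos := hr
  rIn_lt_rOut := lt_add_of_pos_right _ Nat.one_div_pos_of_nat

theorem hasCompactSupport_ballBump_ofReal (c : ℝ) {r : ℝ} (hr : 0 < r) (n : ℕ) :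
    HasCompactSupport (fun x : ℝ => ((ballBump c hr n x : ℝ) : ℂ)) :=
  (ballBump c hr n).hasCompactSupport.comp_left Complex.ofReal_zero

/-- `ballBump` as a Schwartz function. -/
def ballBumpSchwartz (c : ℝ) {r : ℝ} (hr : 0 < r) (n : ℕ) : 𝓢(ℝ, ℂ) :=
  (hasCompactSupport_ballBump_ofReal c hr n).toSchwartzMap
    (Complex.ofRealCLM.contDiff.comp (ballBump c hr n).contDiff)

theorem ballBumpSchwartz_apply (c : ℝ) {r : ℝ} (hr : 0 < r) (n : ℕ) (x : ℝ) :
    ballBumpSchwartz c hr n x = ((ballBump c hr n x : ℝ) : ℂ) := rfl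

theorem norm_ballBumpSchwartz_le (c : ℝ) {r : ℝ} (hr : 0 < r) (n : ℕ) (x : ℝ) :
    ‖ballBumpSchwartz c hr n x‖ ≤ 1 := by
  rw [ballBumpSchwartz_apply, Complex.norm_real, Real.norm_eq_abs,
    abs_of_nonneg (ballBump c hr n).nonneg]
  exact (ballBump c hr n).le_one

theorem ballBumpSchwartz_eq_zero (c : ℝ) {r : ℝ} (hr : 0 < r) (n : ℕ) {x : ℝ}
    (hx : r + 1 / ((n : ℝ) + 1) ≤ dist x c) : ballBumpSchwartz c hr n x = 0 := by
  rw [ballBumpSchwartz_apply, (ballBump c hr n).zero_of_le_dist hx, Complex.ofReal_zero]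

theorem tendsto_ballBumpSchwartz (c : ℝ) {r : ℝ} (hr : 0 < r) (x : ℝ) :
    Filter.Tendsto (fun n => ballBumpSchwartz c hr n x) Filter.atTop
      (nhds ((Metric.closedBall c r).indicator 1 x)) := by
  refine tendsto_const_nhds.congr' ?_
  by_cases hx : x ∈ Metric.closedBall c r
  · refine Filter.Eventually.of_forall fun n => ?_
    change _ = ballBumpSchwartz c hr n x
    rw [Set.indicator_of_mem hx, ballBumpSchwartz_apply,
      (ballBump c hr n).one_of_mem_closedBall hx, Complex.ofReal_one, Pi.one_apply]
  · rw [Set.indicator_of_notMem hx]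
    rw [Metric.mem_closedBall, not_le] at hx
    obtain ⟨n, hn⟩ := exists_nat_one_div_lt (sub_pos.mpr hx)
    filter_upwards [Filter.eventually_ge_atTop n] with m hm
    refine (ballBumpSchwartz_eq_zero c hr m ?_).symm
    have : 1 / ((m : ℝ) + 1) ≤ 1 / ((n : ℝ) + 1) := Nat.one_div_le_one_div hm
    linarith

/-- A locally integrable function on the plane that annihilates all tensor products of smooth
compactly supported functions vanishes almost everywhere. -/
theorem ae_eq_zero_of_integral_tensor_eq_zero {K : ℝ × ℝ → ℂ} (hK : LocallyIntegrable K volume)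
    (h : ∀ φ ψ : 𝓢(ℝ, ℂ), HasCompactSupport φ → HasCompactSupport ψ →
      ∫ z : ℝ × ℝ, K z * (φ z.1 * ψ z.2) = 0) : K =ᵐ[volume] 0 := by
  -- Balls of the maximum norm are squares, so their indicators are limits of tensor products of
  -- shrinking bumps; dominated convergence applies.
  have hball (z : ℝ × ℝ) {r : ℝ} (hr : 0 < r) : ∫ y in Metric.closedBall z r, K y = 0 := by
    have hlim : Filter.Tendsto (fun n : ℕ => ∫ y : ℝ × ℝ, K y *
        (ballBumpSchwartz z.1 hr n y.1 * ballBumpSchwartz z.2 hr n y.2)) Filter.atTop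
        (nhds (∫ y : ℝ × ℝ, (Metric.closedBall z r).indicator K y)) := by
      refine tendsto_integral_of_dominated_convergence
        (fun y => ‖(Metric.closedBall z (r + 1)).indicator K y‖) (fun n => ?_) ?_ (fun n => ?_) ?_
      · refine hK.aestronglyMeasurable.mul (Continuous.aestronglyMeasurable ?_)
        exact ((ballBumpSchwartz z.1 hr n).continuous.comp continuous_fst).mul
          ((ballBumpSchwartz z.2 hr n).continuous.comp continuous_snd)
      · exact ((integrable_indicator_iff measurableSet_closedBall).mpr
          (hK.integrableOn_isCompact (isCompact_closedBall z (r + 1)))).norm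
      · refine Filter.Eventually.of_forall fun y => ?_
        have hn : 1 / ((n : ℝ) + 1) ≤ 1 := by
          rw [div_le_one (by positivity)]; linarith [Nat.cast_nonneg (α := ℝ) n]
        by_cases hy : y ∈ Metric.closedBall z (r + 1)
        · rw [Set.indicator_of_mem hy, norm_mul, norm_mul]
          exact mul_le_of_le_one_right (norm_nonneg _) (mul_le_one₀
            (norm_ballBumpSchwartz_le _ _ _ _) (norm_nonneg _) (norm_ballBumpSchwartz_le _ _ _ _))
        · rw [Set.indicator_of_notMem hy]
          have hy' : r + 1 < dist y.1 z.1 ∨ r + 1 < dist y.2 z.2 := by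
            rw [Metric.mem_closedBall, not_le, Prod.dist_eq] at hy
            exact lt_max_iff.mp hy
          rcases hy' with h' | h'
          · rw [ballBumpSchwartz_eq_zero z.1 hr n (by linarith)]; simp
          · rw [ballBumpSchwartz_eq_zero z.2 hr n (by linarith)]; simp
      · refine Filter.Eventually.of_forall fun y => ?_
        have := ((tendsto_ballBumpSchwartz z.1 hr y.1).mul
          (tendsto_ballBumpSchwartz z.2 hr y.2)).const_mul (K y)
        convert this using 2
        have hz : Metric.closedBall z r = Metric.closedBall z.1 r ×ˢ Metric.closedBall z.2 r :=
          (closedBall_prod_same z.1 z.2 r).symm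
        rw [hz]
        by_cases h1 : y.1 ∈ Metric.closedBall z.1 r <;>
          by_cases h2 : y.2 ∈ Metric.closedBall z.2 r <;> simp [h1, h2]
    rw [← integral_indicator measurableSet_closedBall]
    refine tendsto_nhds_unique hlim ?_
    refine tendsto_const_nhds.congr fun n => (h _ _ ?_ ?_).symm
    · exact hasCompactSupport_ballBump_ofReal z.1 hr n
    · exact hasCompactSupport_ballBump_ofReal z.2 hr n
  -- By Lebesgue differentiation, almost every value is a limit of averages over squares, all of
  -- which vanish.
  filter_upwards [IsUnifLocDoublingMeasure.ae_tendsto_average volume hK 1] with z hz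
  have hpos : ∀ n : ℕ, (0 : ℝ) < 1 / ((n : ℝ) + 1) := fun n => Nat.one_div_pos_of_nat
  have hδ : Filter.Tendsto (fun n : ℕ => 1 / ((n : ℝ) + 1)) Filter.atTop
      (nhdsWithin 0 (Set.Ioi 0)) :=
    tendsto_nhdsWithin_iff.mpr
      ⟨tendsto_one_div_add_atTop_nhds_zero_nat, Filter.Eventually.of_forall hpos⟩
  have h1 := hz (fun _ => z) _ hδ (Filter.Eventually.of_forall fun n => by
    rw [one_mul]; exact Metric.mem_closedBall_self (hpos n).le)
  refine tendsto_nhds_unique h1 (tendsto_const_nhds.congr fun n => ?_)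
  rw [setAverage_eq, hball z (hpos n)]
  simp

/-- Testing with f = 𝓕⁻ ψ makes the tensor in the symbol identity compactly supported, so that the
representing functions may be inserted. The chirp has modulus one and can be divided out. -/
theorem ae_eq_of_isKohnNirenbergSymbol {H : 𝓢(ℝ, ℂ) →L[ℂ] 𝓢'(ℝ, ℂ)} {σ σ' : 𝓢'(ℝ × ℝ, ℂ)}
    {F F' : ℝ × ℝ → ℂ} (hσ : IsKohnNirenbergSymbol H σ) (hσ' : IsKohnNirenbergSymbol H σ')
    (hF : IsRepresentedBy σ F) (hF' : IsRepresentedBy σ' F') : F =ᵐ[volume] F' := by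
  have hcont : Continuous (fun z : ℝ × ℝ => expi (z.1 * z.2)) :=
    continuous_expi.comp (continuous_fst.mul continuous_snd)
  have hD : LocallyIntegrable (fun z => F z - F' z) volume := hF.1.sub hF'.1
  have hK : LocallyIntegrable (fun z : ℝ × ℝ => expi (z.1 * z.2) * (F z - F' z)) volume := by
    rw [← locallyIntegrableOn_univ] at hD ⊢
    exact hD.continuousOn_mul hcont.continuousOn isOpen_univ.isLocallyClosed
  have := ae_eq_zero_of_integral_tensor_eq_zero hK fun φ ψ hφ hψ => ?_
  · filter_upwards [this] with z hz
    have hne : expi (z.1 * z.2) ≠ 0 := by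
      rw [← norm_ne_zero_iff, norm_expi]; exact one_ne_zero
    exact sub_eq_zero.mp ((mul_eq_zero.mp hz).resolve_left hne)
  · set Φ := smulLeftCLM ℂ (fun z : ℝ × ℝ => expi (z.1 * z.2)) (tensor φ ψ) with hΦ
    have hsupp : HasCompactSupport Φ := by
      refine HasCompactSupport.of_support_subset_isCompact (hφ.isCompact.prod hψ.isCompact) ?_
      intro z hz
      rw [Function.mem_support, hΦ, chirp_tensor_apply] at hz
      refine ⟨subset_tsupport _ ?_, subset_tsupport _ ?_⟩
      · exact fun h => hz (by rw [h]; simp)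
      · exact fun h => hz (by rw [h]; simp)
    have h1 := hσ (𝓕⁻ ψ) φ
    have h2 := hσ' (𝓕⁻ ψ) φ
    rw [FourierTransform.fourier_fourierInv_eq] at h1 h2
    rw [hF.2 Φ hsupp] at h1
    rw [hF'.2 Φ hsupp] at h2
    have hi {G : ℝ × ℝ → ℂ} (hG : LocallyIntegrable G volume) :
        Integrable (fun z => G z * Φ z) volume := by
      have := hG.integrable_smul_left_of_hasCompactSupport Φ.continuous hsupp
      refine this.congr (Filter.Eventually.of_forall fun z => ?_)
      simp only [smul_eq_mul, mul_comm]
    rw [h1] at h2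
    have h3 := integral_sub (hi hF.1) (hi hF'.1)
    rw [h2, sub_self] at h3
    rw [← h3]
    refine integral_congr_ae (Filter.Eventually.of_forall fun z => ?_)
    simp only [hΦ, chirp_tensor_apply]
    ring

/-! ### The operator norm as a mixed norm of the symbol -/

theorem mixedNorm_congr_ae (p q : ℝ≥0∞) (w : ℝ × ℝ → ℝ) {F G : ℝ × ℝ → ℂ}
    (h : F =ᵐ[volume] G) : mixedNorm p q w F = mixedNorm p q w G := by
  have h1 : ∀ᵐ z : ℝ × ℝ ∂(volume : Measure ℝ).prod volume, F z.swap = G z.swap :=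
    (Measure.measurePreserving_swap (μ := (volume : Measure ℝ))
      (ν := (volume : Measure ℝ))).quasiMeasurePreserving.ae h
  refine eLpNorm_congr_ae ?_
  filter_upwards [Measure.ae_ae_of_ae_prod h1] with ξ hξ
  refine eLpNorm_congr_ae ?_
  filter_upwards [hξ] with x hx
  exact congrArg _ hx

/-- The `OPW` norm of an operator whose symbol is the function `F`. -/
theorem opwNorm_eq (p q : ℝ≥0∞) (w : ℝ × ℝ → ℝ) {H : 𝓢(ℝ, ℂ) →L[ℂ] 𝓢'(ℝ, ℂ)}
    {σ : 𝓢'(ℝ × ℝ, ℂ)} {F : ℝ × ℝ → ℂ} (hσ : IsKohnNirenbergSymbol H σ)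
    (hF : IsRepresentedBy σ F) : opwNorm p q w H = mixedNorm p q w F := by
  unfold opwNorm
  refine le_antisymm ?_ ?_
  · exact iInf_le_of_le σ (iInf_le_of_le F (iInf_le_of_le hσ (iInf_le_of_le hF le_rfl)))
  · refine le_iInf fun σ' => le_iInf fun F' => le_iInf fun hσ' => le_iInf fun hF' => ?_
    exact (mixedNorm_congr_ae p q w (ae_eq_of_isKohnNirenbergSymbol hσ hσ' hF hF')).le

/-! ### Bounds for mixed norms -/

theorem measurable_subexp (β c : ℝ) : Measurable (subexp β c) := by
  unfold subexp; fun_prop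

theorem integrable_subexp {β c : ℝ} (hβ : 0 < β) (hc : 0 < c) :
    Integrable (subexp β c) volume := by
  obtain ⟨C, hC, h⟩ := exists_pow_mul_subexp_le hβ hc 2
  refine (integrable_inv_one_add_sq.const_mul C).mono' (measurable_subexp β c).aestronglyMeasurable
    (Filter.Eventually.of_forall fun x => ?_)
  rw [Real.norm_eq_abs, abs_of_pos (subexp_pos _ _ _), ← div_eq_mul_inv, le_div_iff₀ (by positivity)]
  refine le_trans ?_ (h x)
  rw [mul_comm]
  refine mul_le_mul_of_nonneg_right ?_ (subexp_pos _ _ _).le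
  nlinarith [sq_abs x, abs_nonneg x]

theorem eLpNorm_subexp_lt_top {β c : ℝ} (hβ : 0 < β) (hc : 0 < c) {p : ℝ≥0∞} (hp : 1 ≤ p) :
    eLpNorm (subexp β c) p volume < ∞ := by
  have hle (x : ℝ) : ‖subexp β c x‖ₑ ≤ 1 := by
    rw [← ofReal_norm, Real.norm_eq_abs, abs_of_pos (subexp_pos _ _ _)]
    exact ENNReal.ofReal_le_one.mpr (subexp_le_one hc.le x)
  by_cases htop : p = ∞
  · rw [htop, eLpNorm_exponent_top]
    exact (eLpNormEssSup_le_of_ae_enorm_bound (Filter.Eventually.of_forall hle)).trans_lt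
      ENNReal.one_lt_top
  · rw [eLpNorm_lt_top_iff_lintegral_rpow_enorm_lt_top (zero_lt_one.trans_le hp).ne' htop]
    refine lt_of_le_of_lt (lintegral_mono fun x => ?_) (integrable_subexp hβ hc).2
    refine (ENNReal.rpow_le_rpow_of_exponent_ge (hle x) ?_).trans_eq (ENNReal.rpow_one _)
    rw [← ENNReal.toReal_one]
    exact (ENNReal.toReal_le_toReal ENNReal.one_ne_top htop).mpr hp

theorem subexp_norm_le_mul {β c : ℝ} (hβ : 0 ≤ β) (hc : 0 ≤ c) (z : ℝ × ℝ) :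
    subexp β (2 * c) ‖z‖ ≤ subexp β c z.1 * subexp β c z.2 := by
  have h1 : |z.1| ≤ |‖z‖| := by rw [abs_norm]; exact norm_fst_le z
  have h2 : |z.2| ≤ |‖z‖| := by rw [abs_norm]; exact norm_snd_le z
  rw [two_mul, subexp_add_const]
  exact mul_le_mul (subexp_le_of_abs_le hβ hc h1) (subexp_le_of_abs_le hβ hc h2)
    (subexp_pos _ _ _).le (subexp_pos _ _ _).le

theorem mul_subexp_le_subexp_norm {β c : ℝ} (hc : 0 ≤ c) (z : ℝ × ℝ) :
    subexp β c z.1 * subexp β c z.2 ≤ subexp β c ‖z‖ := by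
  rw [Prod.norm_def]
  rcases max_cases ‖z.1‖ ‖z.2‖ with h | h
  · rw [h.1, Real.norm_eq_abs, subexp_abs]
    exact mul_le_of_le_one_right (subexp_pos _ _ _).le (subexp_le_one hc _)
  · rw [h.1, Real.norm_eq_abs, subexp_abs]
    exact mul_le_of_le_one_left (subexp_pos _ _ _).le (subexp_le_one hc _)

/-- In the rate γ + 2, the part γ cancels the weight, and the part 2 splits into a unit rate in each
variable. These are integrable to the powers p and q, or bounded when the exponent is ∞. -/
theorem exists_mixedNorm_le {p q : ℝ≥0∞} (hp : 1 ≤ p) (hq : 1 ≤ q) {w : ℝ × ℝ → ℝ}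
    {β γ C : ℝ} (hβ : 0 < β) (hC : 0 < C) (hw0 : ∀ z, 0 ≤ w z)
    (hw : ∀ z, w z ≤ C * Real.exp (γ * ‖z‖ ^ β)) :
    ∃ K : ℝ, 0 < K ∧ ∀ (D : ℝ) (F : ℝ × ℝ → ℂ), 0 ≤ D →
      (∀ z, ‖F z‖ ≤ D * subexp β (γ + 2) ‖z‖) → mixedNorm p q w F ≤ ENNReal.ofReal (K * D) := by
  set Ep := (eLpNorm (subexp β 1) p volume).toReal
  set Eq := (eLpNorm (subexp β 1) q volume).toReal
  have hEp : eLpNorm (subexp β 1) p volume = ENNReal.ofReal Ep :=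
    (ENNReal.ofReal_toReal (eLpNorm_subexp_lt_top hβ one_pos hp).ne).symm
  have hEq : eLpNorm (subexp β 1) q volume = ENNReal.ofReal Eq :=
    (ENNReal.ofReal_toReal (eLpNorm_subexp_lt_top hβ one_pos hq).ne).symm
  have hEp0 : 0 ≤ Ep := ENNReal.toReal_nonneg
  have hEq0 : 0 ≤ Eq := ENNReal.toReal_nonneg
  refine ⟨C * Ep * Eq + 1, by positivity, fun D F hD hF => ?_⟩
  have hpt (z : ℝ × ℝ) : ‖(w z : ℂ) * F z‖ ≤ C * D * subexp β 1 z.2 * ‖subexp β 1 z.1‖ := by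
    rw [norm_mul, Complex.norm_real, Real.norm_eq_abs, abs_of_nonneg (hw0 z), Real.norm_eq_abs,
      abs_of_pos (subexp_pos _ _ _)]
    have h1 : Real.exp (γ * ‖z‖ ^ β) * subexp β (γ + 2) ‖z‖ = subexp β (2 * 1) ‖z‖ := by
      simp only [subexp, abs_norm]
      rw [← Real.exp_add]; congr 1; ring
    calc w z * ‖F z‖ ≤ C * Real.exp (γ * ‖z‖ ^ β) * (D * subexp β (γ + 2) ‖z‖) :=
          mul_le_mul (hw z) (hF z) (norm_nonneg _) (by positivity)
      _ = C * D * subexp β (2 * 1) ‖z‖ := by rw [← h1]; ring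
      _ ≤ C * D * (subexp β 1 z.1 * subexp β 1 z.2) := by
          gcongr; exact subexp_norm_le_mul hβ.le zero_le_one z
      _ = _ := by ring
  have hinner (ξ : ℝ) : eLpNorm (fun x : ℝ => (w (x, ξ) : ℂ) * F (x, ξ)) p volume ≤
      ENNReal.ofReal (C * D * Ep * subexp β 1 ξ) := by
    refine (eLpNorm_le_mul_eLpNorm_of_ae_le_mul (g := subexp β 1) (c := C * D * subexp β 1 ξ)
      (Filter.Eventually.of_forall fun x => hpt (x, ξ)) p).trans_eq ?_
    rw [hEp, ← ENNReal.ofReal_mul (mul_nonneg (by positivity) (subexp_pos _ _ _).le)]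
    congr 1; ring
  have houter : mixedNorm p q w F ≤ eLpNorm (fun ξ => C * D * Ep * subexp β 1 ξ) q volume := by
    refine eLpNorm_mono_enorm fun ξ => ?_
    rw [enorm_eq_self, ← ofReal_norm, Real.norm_of_nonneg
      (mul_nonneg (by positivity) (subexp_pos _ _ _).le)]
    exact hinner ξ
  refine houter.trans ?_
  refine (eLpNorm_le_mul_eLpNorm_of_ae_le_mul (g := subexp β 1) (c := C * D * Ep)
      (Filter.Eventually.of_forall fun x => ?_) q).trans ?_
  · rw [norm_mul, Real.norm_of_nonneg (by positivity)]
  · rw [hEq, ← ENNReal.ofReal_mul (by positivity)]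
    refine ENNReal.ofReal_le_ofReal ?_
    nlinarith

/-- A weighted integral over the line is bounded by an `L^p` norm. -/
theorem exists_lintegral_subexp_mul_le {β : ℝ} (hβ : 0 < β) {p : ℝ≥0∞} (hp : 1 ≤ p) :
    ∃ K : ℝ≥0, ∀ f : ℝ → ℝ≥0∞, Measurable f →
      ∫⁻ x, ENNReal.ofReal (subexp β 1 x) * f x ≤ K * eLpNorm f p volume := by
  have hm : Measurable fun x => ENNReal.ofReal (subexp β 1 x) :=
    (measurable_subexp β 1).ennreal_ofReal
  -- The measure μ is finite and dominated by Lebesgue measure, so its L¹ norm is bounded by its L^p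
  -- norm and hence by the Lebesgue L^p norm.
  set μ := (volume : Measure ℝ).withDensity fun x => ENNReal.ofReal (subexp β 1 x) with hμ
  have hle : μ ≤ volume := by
    conv_rhs => rw [← withDensity_one (μ := (volume : Measure ℝ))]
    exact withDensity_mono (Filter.Eventually.of_forall fun x =>
      ENNReal.ofReal_le_one.mpr (subexp_le_one zero_le_one x))
  have hfin : μ Set.univ < ∞ := by
    rw [hμ, withDensity_apply _ MeasurableSet.univ, Measure.restrict_univ]
    exact (integrable_subexp hβ one_pos).lintegral_lt_top
  have hexp : (0 : ℝ) ≤ 1 / (1 : ℝ≥0∞).toReal - 1 / p.toReal := by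
    rw [ENNReal.toReal_one, div_one, sub_nonneg]
    by_cases htop : p = ∞
    · simp [htop]
    · have : (1 : ℝ) ≤ p.toReal := by
        rw [← ENNReal.toReal_one]
        exact (ENNReal.toReal_le_toReal ENNReal.one_ne_top htop).mpr hp
      rw [div_le_one (by linarith)]; exact this
  refine ⟨(μ Set.univ ^ (1 / (1 : ℝ≥0∞).toReal - 1 / p.toReal)).toNNReal, fun f hf => ?_⟩
  rw [ENNReal.coe_toNNReal (ENNReal.rpow_lt_top_of_nonneg hexp hfin.ne).ne, mul_comm]
  calc ∫⁻ x, ENNReal.ofReal (subexp β 1 x) * f x = ∫⁻ x, f x ∂μ := by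
        rw [hμ, lintegral_withDensity_eq_lintegral_mul _ hm hf]; rfl
    _ = eLpNorm f 1 μ := by simp [eLpNorm_one_eq_lintegral_enorm]
    _ ≤ eLpNorm f p μ * _ :=
        eLpNorm_le_eLpNorm_mul_rpow_measure_univ hp hf.aestronglyMeasurable
    _ ≤ _ := by gcongr

/-- The one-variable estimate is iterated, first in x and then in ξ. Passing to a measurable
minorant w₀ of the weight makes Tonelli's theorem available. -/
theorem exists_lintegral_le_mixedNorm {p q : ℝ≥0∞} (hp : 1 ≤ p) (hq : 1 ≤ q) {β : ℝ}
    (hβ : 0 < β) :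
    ∃ K : ℝ, 0 < K ∧ ∀ (w w₀ : ℝ × ℝ → ℝ) (F : ℝ × ℝ → ℂ), Measurable w₀ → (∀ z, w₀ z ≤ w z) →
      Measurable F →
        ∫⁻ z : ℝ × ℝ, ENNReal.ofReal (subexp β 1 z.2) * (ENNReal.ofReal (subexp β 1 z.1) *
          (ENNReal.ofReal (w₀ z) * ‖F z‖ₑ)) ≤ ENNReal.ofReal K * mixedNorm p q w F := by
  obtain ⟨Kp, hKp⟩ := exists_lintegral_subexp_mul_le hβ hp
  obtain ⟨Kq, hKq⟩ := exists_lintegral_subexp_mul_le hβ hq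
  refine ⟨Kq * Kp + 1, by positivity, fun w w₀ F hw₀ hw hF => ?_⟩
  have hρm : Measurable fun x => ENNReal.ofReal (subexp β 1 x) :=
    (measurable_subexp β 1).ennreal_ofReal
  have hGm : Measurable fun z => ENNReal.ofReal (w₀ z) * ‖F z‖ₑ := hw₀.ennreal_ofReal.mul hF.enorm
  have hHm : Measurable fun z : ℝ × ℝ => ENNReal.ofReal (subexp β 1 z.1) *
      (ENNReal.ofReal (w₀ z) * ‖F z‖ₑ) := (hρm.comp measurable_fst).mul hGm
  have hm : Measurable fun z : ℝ × ℝ => ENNReal.ofReal (subexp β 1 z.2) *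
      (ENNReal.ofReal (subexp β 1 z.1) * (ENNReal.ofReal (w₀ z) * ‖F z‖ₑ)) :=
    (hρm.comp measurable_snd).mul hHm
  have hIm : Measurable fun ξ => ∫⁻ x, ENNReal.ofReal (subexp β 1 x) *
      (ENNReal.ofReal (w₀ (x, ξ)) * ‖F (x, ξ)‖ₑ) := hHm.lintegral_prod_left'
  have hinner (ξ : ℝ) : ∫⁻ x, ENNReal.ofReal (subexp β 1 x) *
      (ENNReal.ofReal (w₀ (x, ξ)) * ‖F (x, ξ)‖ₑ) ≤
      Kp * eLpNorm (fun x : ℝ => (w (x, ξ) : ℂ) * F (x, ξ)) p volume := by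
    refine (hKp (fun x => ENNReal.ofReal (w₀ (x, ξ)) * ‖F (x, ξ)‖ₑ)
      (hGm.comp measurable_prodMk_right)).trans ?_
    refine mul_le_mul_right (eLpNorm_mono_enorm fun x => ?_) _
    rw [enorm_eq_self, enorm_mul]
    refine mul_le_mul_left ?_ _
    rw [← ofReal_norm, Complex.norm_real]
    exact ENNReal.ofReal_le_ofReal ((hw _).trans (le_abs_self _))
  rw [Measure.volume_eq_prod, lintegral_prod_symm' _ hm]
  calc ∫⁻ ξ : ℝ, ∫⁻ x : ℝ, ENNReal.ofReal (subexp β 1 ξ) * (ENNReal.ofReal (subexp β 1 x) *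
        (ENNReal.ofReal (w₀ (x, ξ)) * ‖F (x, ξ)‖ₑ))
      = ∫⁻ ξ, ENNReal.ofReal (subexp β 1 ξ) * ∫⁻ x, ENNReal.ofReal (subexp β 1 x) *
        (ENNReal.ofReal (w₀ (x, ξ)) * ‖F (x, ξ)‖ₑ) := by
        refine lintegral_congr fun ξ => ?_
        exact lintegral_const_mul' _ _ ENNReal.ofReal_ne_top
    _ ≤ Kq * (Kp * mixedNorm p q w F) := by
        refine (hKq _ hIm).trans (mul_le_mul_right ?_ _)
        have h := eLpNorm_le_mul_eLpNorm_of_ae_le_mul' (μ := (volume : Measure ℝ)) (c := Kp)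
          (f := fun ξ => ∫⁻ x, ENNReal.ofReal (subexp β 1 x) *
            (ENNReal.ofReal (w₀ (x, ξ)) * ‖F (x, ξ)‖ₑ))
          (g := fun ξ => eLpNorm (fun x : ℝ => (w (x, ξ) : ℂ) * F (x, ξ)) p volume)
          (Filter.Eventually.of_forall hinner) q
        exact h
    _ ≤ ENNReal.ofReal (Kq * Kp + 1) * mixedNorm p q w F := by
        rw [← mul_assoc]
        refine mul_le_mul_left ?_ _
        rw [← ENNReal.coe_mul, ← ENNReal.ofReal_coe_nnreal]
        exact ENNReal.ofReal_le_ofReal (by push_cast; linarith)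

/-- A substitute for Hölder duality: a function decaying at rate γ + 2 beats the reciprocal of the
weight and leaves a unit rate in each variable. -/
theorem exists_enorm_integral_mul_le_mixedNorm {p q : ℝ≥0∞} (hp : 1 ≤ p) (hq : 1 ≤ q)
    {w : ℝ × ℝ → ℝ} {β γ C : ℝ} (hβ : 0 < β) (hC : 0 < C)
    (hw : ∀ z, C⁻¹ * Real.exp (-γ * ‖z‖ ^ β) ≤ w z) :
    ∃ K : ℝ, 0 < K ∧ ∀ (D : ℝ) (F Θ : ℝ × ℝ → ℂ), 0 ≤ D → Measurable F →
      (∀ z, ‖Θ z‖ ≤ D * subexp β (γ + 2) ‖z‖) →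
        ‖∫ z, F z * Θ z‖ₑ ≤ ENNReal.ofReal (K * D) * mixedNorm p q w F := by
  obtain ⟨K, hK, h⟩ := exists_lintegral_le_mixedNorm hp hq hβ
  refine ⟨C * K, by positivity, fun D F Θ hD hF hΘ => ?_⟩
  obtain ⟨w₀, hw₀⟩ : ∃ w₀ : ℝ × ℝ → ℝ, w₀ = fun z => C⁻¹ * Real.exp (-γ * ‖z‖ ^ β) := ⟨_, rfl⟩
  have hw₀m : Measurable w₀ := by rw [hw₀]; fun_prop
  have hw₀n (z) : 0 ≤ w₀ z := by rw [hw₀]; positivity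
  have hw₀w (z) : w₀ z ≤ w z := by rw [hw₀]; exact hw z
  have hpt (z : ℝ × ℝ) : ‖F z * Θ z‖ₑ ≤ ENNReal.ofReal (C * D) *
      (ENNReal.ofReal (subexp β 1 z.2) * (ENNReal.ofReal (subexp β 1 z.1) *
        (ENNReal.ofReal (w₀ z) * ‖F z‖ₑ))) := by
    have h1 : subexp β (γ + 2) ‖z‖ = C * w₀ z * subexp β (2 * 1) ‖z‖ := by
      simp only [hw₀, subexp, abs_norm]
      rw [← mul_assoc, mul_inv_cancel₀ hC.ne', one_mul, ← Real.exp_add]; congr 1; ring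
    have h2 : ‖Θ z‖ ≤ C * D * (subexp β 1 z.2 * (subexp β 1 z.1 * w₀ z)) := by
      calc ‖Θ z‖ ≤ D * subexp β (γ + 2) ‖z‖ := hΘ z
        _ = C * D * w₀ z * subexp β (2 * 1) ‖z‖ := by rw [h1]; ring
        _ ≤ C * D * w₀ z * (subexp β 1 z.1 * subexp β 1 z.2) :=
            mul_le_mul_of_nonneg_left (subexp_norm_le_mul hβ.le zero_le_one z)
              (mul_nonneg (by positivity) (hw₀n z))
        _ = _ := by ring
    have h3 : ‖Θ z‖ₑ ≤ ENNReal.ofReal (C * D) * (ENNReal.ofReal (subexp β 1 z.2) *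
        (ENNReal.ofReal (subexp β 1 z.1) * ENNReal.ofReal (w₀ z))) := by
      rw [← ENNReal.ofReal_mul (subexp_pos _ _ _).le, ← ENNReal.ofReal_mul (subexp_pos _ _ _).le,
        ← ENNReal.ofReal_mul (by positivity), ← ofReal_norm]
      exact ENNReal.ofReal_le_ofReal h2
    rw [enorm_mul, mul_comm]
    refine (mul_le_mul_left h3 _).trans_eq ?_
    ring
  calc ‖∫ z, F z * Θ z‖ₑ ≤ ∫⁻ z, ‖F z * Θ z‖ₑ := enorm_integral_le_lintegral_enorm _
    _ ≤ _ := lintegral_mono hpt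
    _ = ENNReal.ofReal (C * D) * _ := lintegral_const_mul' _ _ ENNReal.ofReal_ne_top
    _ ≤ ENNReal.ofReal (C * D) * (ENNReal.ofReal K * mixedNorm p q w F) :=
        mul_le_mul_right (h w w₀ F hw₀m hw₀w hF) _
    _ = _ := by
        rw [← mul_assoc, ← ENNReal.ofReal_mul (by positivity)]
        congr 2; ring

/-! ### Recovering the coefficients from the symbol -/

theorem fourier_timeFreqShift (t s : ℝ) (f : 𝓢(ℝ, ℂ)) :
    𝓕 (timeFreqShift t s f) = expi (t * s) • timeFreqShift s (-t) (𝓕 f) := by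
  ext ξ
  rw [fourier_apply_eq, smul_apply, smul_eq_mul, timeFreqShift_apply, fourier_apply_eq,
    ← integral_add_right_eq_self _ t, ← integral_const_mul, ← integral_const_mul]
  refine integral_congr_ae (Filter.Eventually.of_forall fun x => ?_)
  simp only [timeFreqShift_apply, add_sub_cancel_right]
  rw [← mul_assoc, ← mul_assoc, ← mul_assoc, ← expi_add, ← expi_add, ← expi_add]
  congr 2; ring

theorem fourierInv_timeFreqShift (t s : ℝ) (f : 𝓢(ℝ, ℂ)) :
    𝓕⁻ (timeFreqShift t s f) = expi (t * s) • timeFreqShift (-s) t (𝓕⁻ f) := by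
  ext ξ
  rw [fourierInv_apply_eq, smul_apply, smul_eq_mul, timeFreqShift_apply, fourierInv_apply_eq,
    ← integral_add_right_eq_self _ t, ← integral_const_mul, ← integral_const_mul]
  refine integral_congr_ae (Filter.Eventually.of_forall fun x => ?_)
  simp only [timeFreqShift_apply, add_sub_cancel_right]
  rw [← mul_assoc, ← mul_assoc, ← mul_assoc, ← expi_add, ← expi_add, ← expi_add]
  congr 2; ring

theorem norm_fourier_timeFreqShift (t s : ℝ) (f : 𝓢(ℝ, ℂ)) (ξ : ℝ) :
    ‖𝓕 (timeFreqShift t s f) ξ‖ = ‖𝓕 f (ξ - s)‖ := by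
  rw [fourier_timeFreqShift, smul_apply, smul_eq_mul, timeFreqShift_apply, norm_mul, norm_mul,
    norm_expi, norm_expi, one_mul, one_mul]

theorem fourierInv_apply_eq_neg (f : 𝓢(ℝ, ℂ)) (ξ : ℝ) : 𝓕⁻ f ξ = 𝓕 f (-ξ) := by
  rw [fourierInv_apply_eq, fourier_apply_eq]
  refine integral_congr_ae (Filter.Eventually.of_forall fun x => ?_)
  simp only
  congr 2; ring

theorem norm_fourierInv_timeFreqShift (t s : ℝ) (f : 𝓢(ℝ, ℂ)) (ξ : ℝ) :
    ‖𝓕⁻ (timeFreqShift t s f) ξ‖ = ‖𝓕 f (-(ξ + s))‖ := by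
  rw [fourierInv_timeFreqShift, smul_apply, smul_eq_mul, timeFreqShift_apply, norm_mul, norm_mul,
    norm_expi, norm_expi, one_mul, one_mul, fourierInv_apply_eq_neg, sub_neg_eq_add]

/-- A window `a` supported in `[-r, r]` whose Fourier transform interpolates the unit sequence on
`s ℤ`, with a cutoff function `τ` of similar support; both have Fourier transforms of subexponential
decay. -/
structure IsWindowPair (β s r : ℝ) (a τ : 𝓢(ℝ, ℂ)) : Prop where
  eq_zero : ∀ x, r < |x| → a x = 0
  cutoff_eq_zero : ∀ x, r < |x| → τ x = 0
  cutoff_mul : ∀ x, τ x * a x = a x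
  fourier_lattice : ∀ k : ℤ, 𝓕 a (k * s) = if k = 0 then 1 else 0
  decay : ∃ C c, 0 < C ∧ 0 < c ∧ ∀ ξ, ‖𝓕 a ξ‖ ≤ C * subexp β c ξ
  cutoff_decay : ∃ C c, 0 < C ∧ 0 < c ∧ ∀ ξ, ‖𝓕 τ ξ‖ ≤ C * subexp β c ξ

/-- At distinct positions the supports are disjoint. At equal positions τ a = a reduces the
integral, up to a phase, to 𝓕 a at (k' - k) s. -/
theorem IsWindowPair.integral_mul {β s r : ℝ} {a τ : 𝓢(ℝ, ℂ)} (h : IsWindowPair β s r a τ)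
    {t t' : ℝ} (ht : t = t' ∨ 2 * r < |t - t'|) (k k' : ℤ) :
    ∫ x, timeFreqShift t (k * s) a x * timeFreqShift t' (-(k' * s)) τ x =
      if t = t' ∧ k = k' then 1 else 0 := by
  rcases ht with rfl | ht
  · have h1 : ∀ x, timeFreqShift t (k * s) a x * timeFreqShift t (-(k' * s)) τ x =
        expi (-(x * ((k' - k : ℤ) * s))) * a (x - t) := by
      intro x
      rw [timeFreqShift_apply, timeFreqShift_apply]
      calc _ = (expi (k * s * x) * expi (-(k' * s) * x)) * (τ (x - t) * a (x - t)) := by ring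
        _ = _ := by rw [h.cutoff_mul, ← expi_add]; congr 2; push_cast; ring
    simp_rw [h1]
    rw [← integral_add_right_eq_self _ t]
    have h2 : ∀ x, expi (-((x + t) * ((k' - k : ℤ) * s))) * a (x + t - t) =
        expi (-(t * ((k' - k : ℤ) * s))) * (expi (-(x * ((k' - k : ℤ) * s))) * a x) := by
      intro x
      rw [← mul_assoc (expi _), ← expi_add, add_sub_cancel_right]; congr 2; ring
    simp_rw [h2]
    rw [integral_const_mul, ← fourier_apply_eq, h.fourier_lattice]
    by_cases hk : k = k'
    · simp [hk, expi_zero]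
    · rw [if_neg (fun h => hk (by omega)), if_neg (by tauto), mul_zero]
  · have h1 : ∀ x, timeFreqShift t (k * s) a x * timeFreqShift t' (-(k' * s)) τ x = 0 := by
      intro x
      rw [timeFreqShift_apply, timeFreqShift_apply]
      by_cases hx : r < |x - t|
      · rw [h.eq_zero _ hx]; simp
      · have : r < |x - t'| := by
          rw [not_lt] at hx
          have := abs_sub_le t x t'
          rw [abs_sub_comm t x] at this
          linarith
        rw [h.cutoff_eq_zero _ this]; simp
    simp_rw [h1]
    rw [integral_zero, if_neg]
    rintro ⟨rfl, -⟩
    -- Separation with t = t' would force r < 0, hence a = 0, contradicting 𝓕 a 0 = 1.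
    have hr : r < 0 := by rw [sub_self, abs_zero] at ht; linarith
    have ha : ∀ x, a x = 0 := fun x => h.eq_zero x (hr.trans_le (abs_nonneg x))
    have := h.fourier_lattice 0
    rw [fourier_apply_eq] at this
    simp [ha] at this

section Atoms

variable {ι : Type*}

/-- The first factor of the spreading function of an atom. -/
def timeAtom (a : 𝓢(ℝ, ℂ)) (s₂ : ℝ) (T : ι → ℝ) (m : ι → ℤ) (i : ι) : 𝓢(ℝ, ℂ) :=
  timeFreqShift (T i) (m i * s₂) a

/-- The second factor of the spreading function of an atom. -/
def freqAtom (b : 𝓢(ℝ, ℂ)) (s₁ : ℝ) (V : ι → ℝ) (n : ι → ℤ) (i : ι) : 𝓢(ℝ, ℂ) :=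
  timeFreqShift (V i) (-(n i * s₁)) b

/-- The dual functions are built from the cutoffs τ and θ. Parseval in each variable turns the
pairing into a product of two biorthogonality relations, which singles out the index i. -/
theorem integral_familySymbol_mul [Fintype ι] {β s₁ s₂ r₁ r₂ : ℝ} {a τ b θ : 𝓢(ℝ, ℂ)}
    (ha : IsWindowPair β s₂ r₁ a τ) (hb : IsWindowPair β s₁ r₂ b θ) {T V : ι → ℝ} {m n : ι → ℤ}
    (hT : ∀ i i', T i = T i' ∨ 2 * r₁ < |T i - T i'|)
    (hV : ∀ i i', V i = V i' ∨ 2 * r₂ < |V i - V i'|)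
    (hinj : ∀ i i', T i = T i' → V i = V i' → n i = n i' → m i = m i' → i = i')
    (c : ι → ℂ) (i : ι) :
    ∫ z : ℝ × ℝ, familySymbol (timeAtom a s₂ T m) (freqAtom b s₁ V n) c z *
      tensor (𝓕 (timeFreqShift (V i) (n i * s₁) θ)) (𝓕⁻ (timeFreqShift (T i) (-(m i * s₂)) τ)) z
      = c i := by
  classical
  set X := 𝓕 (timeFreqShift (V i) (n i * s₁) θ)
  set Y := 𝓕⁻ (timeFreqShift (T i) (-(m i * s₂)) τ)
  have hterm (i' : ι) : ∫ z : ℝ × ℝ, (𝓕⁻ (freqAtom b s₁ V n i') z.1 *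
      𝓕 (timeAtom a s₂ T m i') z.2) * (X z.1 * Y z.2) = if i' = i then 1 else 0 := by
    have h1 : ∀ z : ℝ × ℝ, (𝓕⁻ (freqAtom b s₁ V n i') z.1 *
        𝓕 (timeAtom a s₂ T m i') z.2) * (X z.1 * Y z.2) =
        (𝓕⁻ (freqAtom b s₁ V n i') z.1 * X z.1) * (𝓕 (timeAtom a s₂ T m i') z.2 * Y z.2) :=
      fun z => by ring
    simp_rw [h1]
    rw [Measure.volume_eq_prod, integral_prod_mul
      (f := fun x => 𝓕⁻ (freqAtom b s₁ V n i') x * X x)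
      (g := fun x => 𝓕 (timeAtom a s₂ T m i') x * Y x), SchwartzMap.integral_fourierInv_mul_eq,
      SchwartzMap.integral_fourier_mul_eq, FourierTransform.fourierInv_fourier_eq,
      FourierTransform.fourier_fourierInv_eq]
    have hA := ha.integral_mul (hT i' i) (m i') (m i)
    -- The frequency atoms are modulated by -n s₁, hence the opposite indices.
    have hB := hb.integral_mul (hV i' i) (-n i') (-n i)
    push_cast at hB
    rw [neg_mul, neg_mul, neg_neg] at hB
    simp only [timeAtom, freqAtom]
    rw [hA, hB]
    by_cases hi : i' = i
    · subst hi; simp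
    · rw [if_neg hi]
      by_contra hne
      rw [mul_eq_zero, not_or] at hne
      have h2 : V i' = V i ∧ -n i' = -n i := by
        by_contra h; exact hne.1 (if_neg h)
      have h3 : T i' = T i ∧ m i' = m i := by
        by_contra h; exact hne.2 (if_neg h)
      exact hi (hinj i' i h3.1 h2.1 (neg_inj.mp h2.2) h3.2)
  have hexp : ∀ z : ℝ × ℝ, familySymbol (timeAtom a s₂ T m) (freqAtom b s₁ V n) c z *
      tensor X Y z = ∑ i', c i' * ((𝓕⁻ (freqAtom b s₁ V n i') z.1 *
        𝓕 (timeAtom a s₂ T m i') z.2) * (X z.1 * Y z.2)) := by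
    intro z
    rw [familySymbol_apply, Finset.sum_mul, tensor_apply]
    exact Finset.sum_congr rfl fun i' _ => by ring
  simp_rw [hexp]
  rw [integral_finsetSum]
  · simp_rw [integral_const_mul, hterm]
    simp
  · intro i' _
    exact (integrable_schwartz_mul (tensor (𝓕⁻ (freqAtom b s₁ V n i')) (𝓕 (timeAtom a s₂ T m i')))
      (tensor X Y)).const_mul _

/-- The coefficients of a finite family of atoms at distance at most `N` from the origin are
controlled by the mixed norm of its symbol. -/
theorem exists_coefficient_le {p q : ℝ≥0∞} (hp : 1 ≤ p) (hq : 1 ≤ q) {w : ℝ × ℝ → ℝ}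
    {β β' γ C : ℝ} (hβ : 0 < β) (hβ1 : β ≤ 1) (hββ : β < β') (hγ : 0 ≤ γ) (hC : 0 < C)
    (hw : ∀ z, C⁻¹ * Real.exp (-γ * ‖z‖ ^ β) ≤ w z) {s₁ s₂ r₁ r₂ : ℝ} {a τ b θ : 𝓢(ℝ, ℂ)}
    (ha : IsWindowPair β' s₂ r₁ a τ) (hb : IsWindowPair β' s₁ r₂ b θ) :
    ∃ K κ : ℝ, 0 < K ∧ 0 < κ ∧ ∀ (ι : Type) [Fintype ι] (T V : ι → ℝ) (m n : ι → ℤ) (N : ℝ),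
      (∀ i i', T i = T i' ∨ 2 * r₁ < |T i - T i'|) →
      (∀ i i', V i = V i' ∨ 2 * r₂ < |V i - V i'|) →
      (∀ i i', T i = T i' → V i = V i' → n i = n i' → m i = m i' → i = i') →
      (∀ i, |n i * s₁| ≤ N) → (∀ i, |m i * s₂| ≤ N) →
      ∀ (c : ι → ℂ) (i : ι), ENNReal.ofReal (subexp β κ N * ‖c i‖) ≤
        ENNReal.ofReal K * mixedNorm p q w
          (familySymbol (timeAtom a s₂ T m) (freqAtom b s₁ V n) c) := by
  obtain ⟨K, hK, hint⟩ := exists_enorm_integral_mul_le_mixedNorm hp hq hβ hC hw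
  obtain ⟨C₁, c₁, hC₁, hc₁, hτ⟩ := ha.cutoff_decay
  obtain ⟨C₂, c₂, hC₂, hc₂, hθ⟩ := hb.cutoff_decay
  obtain ⟨D₁, hD₁, hτ'⟩ := exists_subexp_le_mul_subexp hβ hββ hc₁ (γ + 2)
  obtain ⟨D₂, hD₂, hθ'⟩ := exists_subexp_le_mul_subexp hβ hββ hc₂ (γ + 2)
  have hγ2 : 0 ≤ γ + 2 := by linarith
  -- Each of the two factors of the dual function is centred at distance at most N from the origin,
  -- and moving it back costs one factor of rate γ + 2 at N.
  refine ⟨K * (C₁ * D₁ * (C₂ * D₂)), 2 * (γ + 2), by positivity, by positivity, ?_⟩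
  intro ι _ T V m n N hT hV hinj hn hm c i
  have hκ : subexp β (2 * (γ + 2)) N = subexp β (γ + 2) N * subexp β (γ + 2) N := by
    rw [two_mul, subexp_add_const]
  have hshift (x y : ℝ) (hy : |y| ≤ N) :
      subexp β (γ + 2) N * subexp β (γ + 2) (x - y) ≤ subexp β (γ + 2) x := by
    have hN : |y| ≤ |N| := hy.trans (le_abs_self N)
    calc _ ≤ subexp β (γ + 2) y * subexp β (γ + 2) (x - y) :=
          mul_le_mul_of_nonneg_right (subexp_le_of_abs_le hβ.le hγ2 hN) (subexp_pos _ _ _).le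
      _ ≤ subexp β (γ + 2) (y + (x - y)) := subexp_mul_le hβ.le hβ1 hγ2 _ _
      _ = _ := by rw [add_sub_cancel]
  set S := subexp β (γ + 2) N
  have hS : 0 < S := subexp_pos _ _ _
  set F := familySymbol (timeAtom a s₂ T m) (freqAtom b s₁ V n) c with hF
  set Θ := tensor (𝓕 (timeFreqShift (V i) (n i * s₁) θ))
    (𝓕⁻ (timeFreqShift (T i) (-(m i * s₂)) τ)) with hΘ
  have hΘb : ∀ z, ‖Θ z‖ ≤ (C₁ * D₁ * (C₂ * D₂) / (S * S)) * subexp β (γ + 2) ‖z‖ := by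
    intro z
    have h1 : ‖𝓕 (timeFreqShift (V i) (n i * s₁) θ) z.1‖ ≤
        C₂ * D₂ / S * subexp β (γ + 2) z.1 := by
      rw [norm_fourier_timeFreqShift, div_mul_eq_mul_div, le_div_iff₀ hS]
      calc _ ≤ C₂ * (D₂ * subexp β (γ + 2) (z.1 - n i * s₁)) * S := by
            gcongr
            exact (hθ _).trans (mul_le_mul_of_nonneg_left (hθ' _) hC₂.le)
        _ = C₂ * D₂ * (S * subexp β (γ + 2) (z.1 - n i * s₁)) := by ring
        _ ≤ _ := by gcongr; exact hshift _ _ (hn i)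
    have h2 : ‖𝓕⁻ (timeFreqShift (T i) (-(m i * s₂)) τ) z.2‖ ≤
        C₁ * D₁ / S * subexp β (γ + 2) z.2 := by
      rw [norm_fourierInv_timeFreqShift, div_mul_eq_mul_div, le_div_iff₀ hS]
      calc _ ≤ C₁ * (D₁ * subexp β (γ + 2) (z.2 - m i * s₂)) * S := by
            gcongr
            refine (hτ _).trans (mul_le_mul_of_nonneg_left ?_ hC₁.le)
            rw [subexp_neg, ← sub_eq_add_neg]
            exact hτ' _
        _ = C₁ * D₁ * (S * subexp β (γ + 2) (z.2 - m i * s₂)) := by ring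
        _ ≤ _ := by gcongr; exact hshift _ _ (hm i)
    rw [hΘ, tensor_apply, norm_mul]
    calc _ ≤ (C₂ * D₂ / S * subexp β (γ + 2) z.1) * (C₁ * D₁ / S * subexp β (γ + 2) z.2) :=
          mul_le_mul h1 h2 (norm_nonneg _)
            (mul_nonneg (by positivity) (subexp_pos _ _ _).le)
      _ = (C₁ * D₁ * (C₂ * D₂) / (S * S)) * (subexp β (γ + 2) z.1 * subexp β (γ + 2) z.2) := by
          field_simp
      _ ≤ _ := by gcongr; exact mul_subexp_le_subexp_norm hγ2 z
  have h := hint _ F Θ (by positivity) F.continuous.measurable hΘb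
  rw [hF, hΘ, integral_familySymbol_mul ha hb hT hV hinj c i, ← hF] at h
  rw [hκ, ENNReal.ofReal_mul (by positivity), ofReal_norm]
  refine (mul_le_mul_right h _).trans_eq ?_
  rw [← mul_assoc, ← ENNReal.ofReal_mul (by positivity)]
  congr 2
  field_simp

end Atoms

/-! ### Estimates for single atoms -/

theorem schwartzMul_smul_left (c : ℂ) (f g : 𝓢(ℝ, ℂ)) :
    schwartzMul (c • f) g = c • schwartzMul f g := by
  ext x
  simp only [schwartzMul_apply, smul_apply, smul_eq_mul]
  ring

/-- The functional `φ ↦ G (𝓕 (𝓕 A · 𝓕⁻ φ))`. -/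
def multiplierFunctional (G : 𝓢(ℝ, ℂ) →L[ℂ] ℂ) (A : 𝓢(ℝ, ℂ)) : 𝓢(ℝ, ℂ) →L[ℂ] ℂ :=
  G ∘L FourierTransform.fourierCLM ℂ 𝓢(ℝ, ℂ) ∘L schwartzMul (𝓕 A) ∘L
    FourierTransform.fourierInvCLM ℂ 𝓢(ℝ, ℂ)

theorem multiplierFunctional_apply (G : 𝓢(ℝ, ℂ) →L[ℂ] ℂ) (A φ : 𝓢(ℝ, ℂ)) :
    multiplierFunctional G A φ = G (𝓕 (schwartzMul (𝓕 A) (𝓕⁻ φ))) := rfl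

theorem norm_multiplierFunctional (G : 𝓢(ℝ, ℂ) →L[ℂ] ℂ) (a φ : 𝓢(ℝ, ℂ)) (T σ : ℝ) :
    ‖multiplierFunctional G (timeFreqShift T σ a) φ‖ =
      ‖G (𝓕 (schwartzMul (timeFreqShift σ (-T) (𝓕 a)) (𝓕⁻ φ)))‖ := by
  rw [multiplierFunctional_apply, fourier_timeFreqShift, schwartzMul_smul_left,
    FourierTransform.fourier_smul, map_smul, norm_smul, norm_expi, one_mul]

theorem one_add_abs_le {x R : ℝ} (h : |x| ≤ R) (N : ℕ) : (1 + |x|) ^ N ≤ (1 + R) ^ N := by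
  gcongr

/-- The factor 𝓕⁻ b is translated to σ₁ and the Gaussian sits at t, so their product is small in
terms of the distance. Multiplication by the translate of 𝓕 a to σ₂ is bounded uniformly in σ₂; the
bounded shifts T and V only affect constants. -/
theorem exists_norm_multiplierFunctional_atom_le {β : ℝ} (h0 : 0 < β) (h1 : β ≤ 1)
    (G : 𝓢(ℝ, ℂ) →L[ℂ] ℂ) (a : 𝓢(ℝ, ℂ)) {b : 𝓢(ℝ, ℂ)} (hb : HasSubexpDecay β (𝓕⁻ b)) (R : ℝ) :
    ∃ (r : ℕ) (C c : ℝ), 0 < C ∧ 0 < c ∧ ∀ T V σ₁ σ₂ t ν : ℝ, |T| ≤ R → |V| ≤ R →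
      ‖multiplierFunctional G (timeFreqShift T σ₂ a)
        (schwartzMul (𝓕⁻ (timeFreqShift V (-σ₁) b)) (timeFreqShift t (-ν) gaussian))‖ ≤
        C * (1 + |σ₁|) ^ r * (1 + |ν|) ^ r * subexp β c (t - σ₁) := by
  obtain ⟨N₀, C₀, hC₀, hG⟩ := exists_bound_of_functional G
  obtain ⟨N₁, C₁, hC₁, hF⟩ := exists_bound_of_operator (FourierTransform.fourierCLM ℂ 𝓢(ℝ, ℂ)) N₀
  obtain ⟨C₂, hC₂, hM⟩ := exists_schwartzBound_mul_timeFreqShift (𝓕 a) N₁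
  obtain ⟨N₃, C₃, hC₃, hI⟩ :=
    exists_bound_of_operator (FourierTransform.fourierInvCLM ℂ 𝓢(ℝ, ℂ)) N₁
  obtain ⟨C₄, c, hC₄, hc, hL⟩ :=
    hb.exists_schwartzBound_mul h0 h1 (hasSubexpDecay_gaussian h0 h1) N₃
  refine ⟨N₃, C₀ * (C₁ * (C₂ * (1 + |R|) ^ N₁ * (C₃ * (C₄ * (1 + |R|) ^ N₃)))) + 1, c,
    by positivity, hc, fun T V σ₁ σ₂ t ν hT hV => ?_⟩
  have hT' := one_add_abs_le (hT.trans (le_abs_self R)) N₁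
  have hV' := one_add_abs_le (hV.trans (le_abs_self R)) N₃
  rw [norm_multiplierFunctional, fourierInv_timeFreqShift, schwartzMul_smul_left,
    FourierTransform.fourierInv_smul, map_smul, FourierTransform.fourier_smul, map_smul, norm_smul,
    norm_expi, one_mul, neg_neg]
  have h := hG _ _ (hF _ _ (hM σ₂ (-T) _ _ (hI _ _ (hL σ₁ V t (-ν)))))
  refine h.trans ?_
  rw [abs_neg, abs_neg, subexp_sub_comm β c σ₁ t]
  have hS := subexp_pos β c (t - σ₁)
  set S := subexp β c (t - σ₁)
  calc _ = C₀ * (C₁ * (C₂ * (1 + |T|) ^ N₁ * (C₃ * (C₄ * (1 + |V|) ^ N₃)))) *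
        ((1 + |σ₁|) ^ N₃ * (1 + |ν|) ^ N₃ * S) := by ring
    _ ≤ (C₀ * (C₁ * (C₂ * (1 + |R|) ^ N₁ * (C₃ * (C₄ * (1 + |R|) ^ N₃)))) + 1) *
        ((1 + |σ₁|) ^ N₃ * (1 + |ν|) ^ N₃ * S) := by
        refine mul_le_mul_of_nonneg_right ?_ (by positivity)
        refine le_trans ?_ (le_add_of_nonneg_right zero_le_one)
        gcongr
    _ = _ := by ring

theorem fourierInv_fourierInv_apply (b : 𝓢(ℝ, ℂ)) (x : ℝ) : 𝓕⁻ (𝓕⁻ b) x = b (-x) := by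
  rw [fourierInv_apply_eq_neg, FourierTransform.fourier_fourierInv_eq]

/-- After an inverse Fourier transform the modulated window is a reflected copy of b near -(ξ + V),
while the multiplier is concentrated near σ₂. Decay therefore takes place in ξ + σ₂, which
complements the decay in time of the previous estimate. -/
theorem exists_norm_multiplierFunctional_character_le {β : ℝ} (h0 : 0 < β) (h1 : β ≤ 1)
    (G : 𝓢(ℝ, ℂ) →L[ℂ] ℂ) {a b : 𝓢(ℝ, ℂ)} (ha : HasSubexpDecay β (𝓕 a))
    (hb : HasSubexpDecay β (𝓕⁻ (𝓕⁻ b))) (R : ℝ) :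
    ∃ (r : ℕ) (C c : ℝ), 0 < C ∧ 0 < c ∧ ∀ T V σ₁ σ₂ ξ : ℝ, |T| ≤ R → |V| ≤ R →
      ‖multiplierFunctional G (timeFreqShift T σ₂ a)
        (timeFreqShift 0 ξ (𝓕⁻ (timeFreqShift V (-σ₁) b)))‖ ≤
        C * (1 + |σ₁|) ^ r * (1 + |σ₂|) ^ r * subexp β c (ξ + σ₂) := by
  obtain ⟨N₀, C₀, hC₀, hG⟩ := exists_bound_of_functional G
  obtain ⟨N₁, C₁, hC₁, hF⟩ := exists_bound_of_operator (FourierTransform.fourierCLM ℂ 𝓢(ℝ, ℂ)) N₀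
  obtain ⟨C₂, c, hC₂, hc, hL⟩ := ha.exists_schwartzBound_mul h0 h1 hb N₁
  have hSR := subexp_pos β c R
  refine ⟨N₁, (C₀ * (C₁ * (C₂ * (1 + |R|) ^ N₁)) + 1) / subexp β c R, c,
    by positivity, hc, fun T V σ₁ σ₂ ξ hT hV => ?_⟩
  have hT' := one_add_abs_le (hT.trans (le_abs_self R)) N₁
  have hv : ∃ u : ℂ, ‖u‖ = 1 ∧ 𝓕⁻ (timeFreqShift 0 ξ (𝓕⁻ (timeFreqShift V (-σ₁) b))) =
      u • timeFreqShift (-(ξ + V)) σ₁ (𝓕⁻ (𝓕⁻ b)) := by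
    refine ⟨expi (V * -σ₁) * expi (σ₁ * V) * expi (σ₁ * ξ), by simp [norm_expi], ?_⟩
    rw [fourierInv_timeFreqShift, fourierInv_timeFreqShift, FourierTransform.fourierInv_smul,
      fourierInv_timeFreqShift, neg_neg]
    ext x
    simp only [map_smul, smul_apply, smul_eq_mul, timeFreqShift_apply]
    rw [zero_mul, zero_mul, expi_zero, one_mul, one_mul]
    have h2 : expi (σ₁ * (x - -ξ)) = expi (σ₁ * ξ) * expi (σ₁ * x) := by
      rw [← expi_add]; congr 1; ring
    have h3 : x - -ξ - -V = x - -(ξ + V) := by ring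
    rw [h2, h3]
    ring
  obtain ⟨u, hu, hv⟩ := hv
  rw [norm_multiplierFunctional, hv, map_smul, FourierTransform.fourier_smul, map_smul, norm_smul,
    hu, one_mul]
  refine (hG _ _ (hF _ _ (hL σ₂ (-T) (-(ξ + V)) σ₁))).trans ?_
  -- The bounded shift V is removed at the price of the constant factor `subexp β c R`.
  have h5 : subexp β c R * subexp β c (σ₂ - -(ξ + V)) ≤ subexp β c (ξ + σ₂) := by
    calc _ ≤ subexp β c (-V) * subexp β c (σ₂ - -(ξ + V)) := by
          refine mul_le_mul_of_nonneg_right ?_ (subexp_pos _ _ _).le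
          refine subexp_le_of_abs_le h0.le hc.le ?_
          rw [abs_neg]; exact hV.trans (le_abs_self R)
      _ ≤ _ := (subexp_mul_le h0.le h1 hc.le _ _).trans_eq (by congr 1; ring)
  rw [abs_neg]
  have hS := subexp_pos β c (σ₂ - -(ξ + V))
  set S := subexp β c (σ₂ - -(ξ + V))
  calc _ = C₀ * (C₁ * (C₂ * (1 + |T|) ^ N₁)) * ((1 + |σ₁|) ^ N₁ * (1 + |σ₂|) ^ N₁ * S) := by ring
    _ ≤ (C₀ * (C₁ * (C₂ * (1 + |R|) ^ N₁)) + 1) * ((1 + |σ₁|) ^ N₁ * (1 + |σ₂|) ^ N₁ * S) := by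
        refine mul_le_mul_of_nonneg_right ?_ (by positivity)
        refine le_trans ?_ (le_add_of_nonneg_right zero_le_one)
        gcongr
    _ = (C₀ * (C₁ * (C₂ * (1 + |R|) ^ N₁)) + 1) / subexp β c R * (1 + |σ₁|) ^ N₁ *
        (1 + |σ₂|) ^ N₁ * (subexp β c R * S) := by field_simp
    _ ≤ _ := by gcongr

/-! ### Periodization of a finite family -/

/-- A finite sum of functionals at a Gaussian atom is estimated by its values at the characters of
the dual lattice and by its values at the other translates of the atom. -/
theorem exists_norm_sum_gaussian_le {β : ℝ} (h0 : 0 < β) (h1 : β ≤ 1) :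
    ∃ c₀ : ℝ, 0 < c₀ ∧ ∀ c : ℝ, 0 < c → ∃ K : ℝ, 0 < K ∧ ∀ (ι : Type) [Fintype ι]
      (ψ : ι → 𝓢(ℝ, ℂ)) (G : ι → 𝓢(ℝ, ℂ) →L[ℂ] ℂ) (σ : ι → ℝ) (t ν P D B E : ℝ),
      (∀ i, HasSubexpDecay β (ψ i)) → 1 ≤ D → D ≤ P → 0 ≤ B → (∀ i, |t - σ i| ≤ P - D) →
      (∀ i (x : ℝ), ‖G i (schwartzMul (ψ i) (timeFreqShift x (-ν) gaussian))‖ ≤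
        B * subexp β c (x - σ i)) →
      (∀ l : ℤ, subexp β c₀ (l / P + ν) * ‖∑ i, G i (timeFreqShift 0 (l / P) (ψ i))‖ ≤ E) →
      ‖∑ i, G i (schwartzMul (ψ i) (timeFreqShift t (-ν) gaussian))‖ ≤
        K * (P * E + Fintype.card ι * B * subexp β (c / 2) D) := by
  obtain ⟨Cg, cg, hCg, hcg, hg⟩ := norm_gaussian_le h0 h1
  obtain ⟨K₁, hK₁, hlat⟩ := exists_subexp_lattice_le h0 (half_pos hcg)
  refine ⟨cg / 2, half_pos hcg, fun c hc => ?_⟩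
  obtain ⟨K₂, hK₂, hpun⟩ := exists_subexp_punctured_lattice_le h0 hc
  refine ⟨Cg * K₁ + K₂, by positivity, ?_⟩
  intro ι _ ψ G σ t ν P D B E hψ hD hDP hB hσ hG hE
  have hP : 1 ≤ P := hD.trans hDP
  have hP0 : 0 < P := by linarith
  have hE0 : 0 ≤ E := le_trans (mul_nonneg (subexp_pos _ _ _).le (norm_nonneg _)) (hE 0)
  set Φ : ℤ → ℂ := fun k => ∑ i, G i (schwartzMul (ψ i)
    (timeFreqShift (t - k * P) (-ν) gaussian)) with hΦ
  have hsumL : Summable fun k : ℤ => expi (-ν * (k * P)) * Φ k := by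
    simp only [hΦ, Finset.mul_sum]
    exact summable_sum fun i _ => (tsum_functional_gaussian h0 h1 (hψ i) (G i) t ν hP).1
  have heq : ∑' k : ℤ, expi (-ν * (k * P)) * Φ k =
      ∑' l : ℤ, ((P⁻¹ : ℝ) : ℂ) * (gaussian (l / P + ν) * expi (-((l / P + ν) * t))) *
        ∑ i, G i (timeFreqShift 0 (l / P) (ψ i)) := by
    simp only [hΦ, Finset.mul_sum]
    rw [Summable.tsum_finsetSum fun i _ =>
        (tsum_functional_gaussian h0 h1 (hψ i) (G i) t ν hP).1,
      Summable.tsum_finsetSum fun i _ =>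
        (tsum_functional_gaussian h0 h1 (hψ i) (G i) t ν hP).2.1]
    exact Finset.sum_congr rfl fun i _ => (tsum_functional_gaussian h0 h1 (hψ i) (G i) t ν hP).2.2
  -- Half of the Gaussian rate is spent on the hypothesis for E, the other half on summing over l.
  -- The sum is of order P ^ 2, and the factor 1 / P of the Poisson formula leaves P.
  have hright : ‖∑' k : ℤ, expi (-ν * (k * P)) * Φ k‖ ≤ Cg * K₁ * (P * E) := by
    rw [heq]
    obtain ⟨hs, hle⟩ := hlat P hP ν
    refine (tsum_of_norm_bounded (g := fun l : ℤ => P⁻¹ * Cg * E * subexp β (cg / 2) (l / P + ν))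
      (hs.mul_left _).hasSum fun l => ?_).trans ?_
    · rw [norm_mul, norm_mul, norm_mul, norm_expi, mul_one, Complex.norm_real,
        Real.norm_of_nonneg (inv_nonneg.mpr hP0.le)]
      have h2 := hg (l / P + ν)
      rw [subexp_half] at h2
      have h3 := hE l
      set S := subexp β (cg / 2) (l / P + ν)
      have hS : 0 < S := subexp_pos _ _ _
      calc _ ≤ P⁻¹ * (Cg * (S * S)) * ‖∑ i, G i (timeFreqShift 0 (l / P) (ψ i))‖ := by gcongr
        _ = P⁻¹ * Cg * S * (S * ‖∑ i, G i (timeFreqShift 0 (l / P) (ψ i))‖) := by ring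
        _ ≤ P⁻¹ * Cg * S * E := by gcongr
        _ = _ := by ring
    · rw [tsum_mul_left]
      calc _ ≤ P⁻¹ * Cg * E * (K₁ * P ^ 2) := by gcongr
        _ = _ := by field_simp
  -- These are the unwanted translates of the Gaussian. They lie outside the time range of all σ i
  -- with a margin D.
  have hpunct : ‖∑' k : ℤ, (if k = 0 then 0 else expi (-ν * (k * P)) * Φ k)‖ ≤
      K₂ * (Fintype.card ι * B * subexp β (c / 2) D) := by
    have hs (i : ι) := hpun P D (t - σ i) hD hDP (hσ i)
    refine (tsum_of_norm_bounded (g := fun k : ℤ => ∑ i, B *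
      (if k = 0 then 0 else subexp β c (t - σ i - k * P)))
      (summable_sum fun i _ => (hs i).1.mul_left B).hasSum fun k => ?_).trans ?_
    · by_cases hk : k = 0
      · simp [hk]
      · simp only [hk, if_false]
        rw [norm_mul, norm_expi, one_mul]
        refine (norm_sum_le _ _).trans (Finset.sum_le_sum fun i _ => ?_)
        have := hG i (t - k * P)
        rwa [sub_right_comm] at this
    · rw [Summable.tsum_finsetSum fun i _ => (hs i).1.mul_left B]
      calc _ ≤ ∑ _i : ι, B * (K₂ * subexp β (c / 2) D) := by
            refine Finset.sum_le_sum fun i _ => ?_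
            rw [tsum_mul_left]
            exact mul_le_mul_of_nonneg_left (hs i).2 hB
        _ = _ := by rw [Finset.sum_const, Finset.card_univ, nsmul_eq_mul]; ring
  -- The term k = 0 is the quantity sought: the whole periodization minus the unwanted translates.
  have hsplit := hsumL.tsum_eq_add_tsum_ite 0
  have hΦ0 : Φ 0 = ∑ i, G i (schwartzMul (ψ i) (timeFreqShift t (-ν) gaussian)) := by
    simp [hΦ]
  have hfirst : expi (-ν * (((0 : ℤ) : ℝ) * P)) * Φ 0 = Φ 0 := by
    simp [expi_zero]
  rw [hfirst] at hsplit
  rw [← hΦ0, eq_sub_of_add_eq hsplit.symm]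
  refine (norm_sub_le _ _).trans ((add_le_add hright hpunct).trans ?_)
  have hS : 0 < subexp β (c / 2) D := subexp_pos _ _ _
  have h3 : 0 ≤ P * E := by positivity
  have h4 : 0 ≤ Fintype.card ι * B * subexp β (c / 2) D := by positivity
  have h5 : 0 < Cg * K₁ := by positivity
  nlinarith

theorem subexp_mul_arg {β d : ℝ} (hd : 0 ≤ d) (c x : ℝ) :
    subexp β c (d * x) = subexp β (c * d ^ β) x := by
  unfold subexp
  rw [abs_mul, abs_of_nonneg hd, Real.mul_rpow hd (abs_nonneg x), mul_assoc]

/-! ### The response of a finite family -/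

theorem subexp_sub_le {β c : ℝ} (h0 : 0 ≤ β) (h1 : β ≤ 1) (hc : 0 ≤ c) (x y : ℝ) :
    subexp β c (x - y) ≤ (subexp β c y)⁻¹ * subexp β c x := by
  rw [inv_mul_eq_div, le_div_iff₀ (subexp_pos _ _ _)]
  exact (subexp_mul_le h0 h1 hc _ _).trans_eq (by rw [sub_add_cancel])

theorem HasSubexpDecay.fourierInv_timeFreqShift {β : ℝ} (h0 : 0 < β) (h1 : β ≤ 1) {b : 𝓢(ℝ, ℂ)}
    (hb : HasSubexpDecay β (𝓕⁻ b)) (V σ : ℝ) : HasSubexpDecay β (𝓕⁻ (timeFreqShift V σ b)) := by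
  obtain ⟨C, c, hC, hc, h⟩ := hb 0
  refine hasSubexpDecay_of_norm_le h0 h1 ⟨C * (subexp β c (-σ))⁻¹, c,
    mul_pos hC (inv_pos.mpr (subexp_pos _ _ _)), hc, fun x => ?_⟩
  rw [norm_fourierInv_timeFreqShift, ← fourierInv_apply_eq_neg, mul_assoc]
  refine ((norm_le_derivSum 0 _ _).trans (h _)).trans (mul_le_mul_of_nonneg_left ?_ hC.le)
  rw [← sub_neg_eq_add]
  exact subexp_sub_le h0.le h1 hc.le x (-σ)

set_option maxHeartbeats 1000000 in
/-- A finite family of atoms whose responses to the characters `l / P` with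
`|l / P| ≤ N * (1 + 2 * δ)` vanish, where `P = 2 * N * (1 + 2 * δ)`, has a small response to all
Gaussian atoms. -/
theorem exists_norm_family_le {β : ℝ} (h0 : 0 < β) (h1 : β ≤ 1) (G : 𝓢(ℝ, ℂ) →L[ℂ] ℂ)
    {a b : 𝓢(ℝ, ℂ)} (ha : HasSubexpDecay β (𝓕 a)) (hb : HasSubexpDecay β (𝓕⁻ b))
    (hbb : HasSubexpDecay β (𝓕⁻ (𝓕⁻ b))) (R : ℝ) {δ : ℝ} (hδ : 0 < δ) :
    ∃ K κ : ℝ, 0 < K ∧ 0 < κ ∧ ∀ (ι : Type) [Fintype ι] (T V σ₁ σ₂ : ι → ℝ) (c : ι → ℂ) (N : ℝ),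
      1 ≤ N → 1 ≤ 3 * δ * N → (∀ i, |T i| ≤ R) → (∀ i, |V i| ≤ R) → (∀ i, |σ₁ i| ≤ N) →
      (∀ i, |σ₂ i| ≤ N) → (∀ i, ‖c i‖ ≤ 1) →
      (∀ l : ℤ, |l / (2 * N * (1 + 2 * δ))| ≤ N * (1 + 2 * δ) →
        ∑ i, c i * multiplierFunctional G (timeFreqShift (T i) (σ₂ i) a)
          (timeFreqShift 0 (l / (2 * N * (1 + 2 * δ)))
            (𝓕⁻ (timeFreqShift (V i) (-σ₁ i) b))) = 0) →
      ∀ t ν : ℝ, ‖∑ i, c i * multiplierFunctional G (timeFreqShift (T i) (σ₂ i) a)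
        (schwartzMul (𝓕⁻ (timeFreqShift (V i) (-σ₁ i) b)) (timeFreqShift t (-ν) gaussian))‖ ≤
        K * Fintype.card ι * subexp β κ N * subexp β κ ‖(t, ν)‖ := by
  obtain ⟨r₁, C₁, c₁, hC₁, hc₁, hF1⟩ := exists_norm_multiplierFunctional_atom_le h0 h1 G a hb R
  obtain ⟨r₂, C₂, c₂, hC₂, hc₂, hF2⟩ :=
    exists_norm_multiplierFunctional_character_le h0 h1 G ha hbb R
  obtain ⟨c₀, hc₀, hper⟩ := exists_norm_sum_gaussian_le h0 h1
  obtain ⟨K₁, hK₁, hper⟩ := hper c₁ hc₁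
  obtain ⟨cm, hcm, hm₀, hm₁, hm₂⟩ : ∃ cm, 0 < cm ∧ cm ≤ c₀ ∧ cm ≤ c₁ / 2 ∧ cm ≤ c₂ :=
    ⟨min c₀ (min (c₁ / 2) c₂), lt_min hc₀ (lt_min (half_pos hc₁) hc₂), min_le_left _ _,
      (min_le_right _ _).trans (min_le_left _ _), (min_le_right _ _).trans (min_le_right _ _)⟩
  set M := 2 * (r₁ + r₂) with hM
  set Cf := C₁ + C₂ with hCf
  -- The bound δ' ≤ 1 / 2 serves the points outside the box of radius 2 N, and δ' ≤ δ / 2 those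
  -- inside, where distances of δ N are available and 2 δ' N ≤ δ N.
  obtain ⟨δ', hδ', hδ'1, hδ'2⟩ : ∃ δ' : ℝ, 0 < δ' ∧ δ' ≤ 1 / 2 ∧ δ' ≤ δ / 2 :=
    ⟨min (1 / 2) (δ / 2), lt_min one_half_pos (half_pos hδ), min_le_left _ _, min_le_right _ _⟩
  have hcδ : 0 < cm * δ' ^ β := by positivity
  -- The extra power beyond M absorbs the period P, which grows linearly in X.
  obtain ⟨K₂, hK₂, hpoly⟩ := exists_pow_mul_subexp_le_subexp h0 hcδ (M + 1)
  refine ⟨(1 + K₁ * (4 + 2 * δ)) * Cf * K₂, cm * δ' ^ β / 2 / 2, by positivity, by positivity, ?_⟩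
  intro ι _ T V σ₁ σ₂ c N hN hδN hT hV hσ₁ hσ₂ hc hann t ν
  set A : ι → 𝓢(ℝ, ℂ) := fun i => timeFreqShift (T i) (σ₂ i) a with hA
  set ψ : ι → 𝓢(ℝ, ℂ) := fun i => 𝓕⁻ (timeFreqShift (V i) (-σ₁ i) b) with hψ
  have hN0 : 0 < N := by linarith
  have hZt : |t| ≤ ‖(t, ν)‖ := norm_fst_le (t, ν)
  have hZν : |ν| ≤ ‖(t, ν)‖ := norm_snd_le (t, ν)
  have hZmax : ‖(t, ν)‖ = max |t| |ν| := rfl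
  set Z := ‖(t, ν)‖ with hZ
  have hmono {d : ℝ} (hd : cm ≤ d) {x y : ℝ} (hx : 0 ≤ x) (hxy : x ≤ |y|) :
      subexp β d y ≤ subexp β cm x :=
    (subexp_le_of_const_le hd y).trans
      (subexp_le_of_abs_le h0.le hcm.le (by rwa [abs_of_nonneg hx]))
  -- A bound in a common scale X ≥ max (N, Z) suffices: half of the rate absorbs the polynomial, and
  -- the remainder is divided between N and Z.
  have hfinal (X : ℝ) (hNX : N ≤ X) (hZX : Z ≤ X)
      (h : ‖∑ i, c i * multiplierFunctional G (A i)
        (schwartzMul (ψ i) (timeFreqShift t (-ν) gaussian))‖ ≤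
        (1 + K₁ * (4 + 2 * δ)) * Cf * Fintype.card ι *
          ((1 + X) ^ (M + 1) * subexp β cm (δ' * X))) :
      ‖∑ i, c i * multiplierFunctional G (A i)
        (schwartzMul (ψ i) (timeFreqShift t (-ν) gaussian))‖ ≤
        (1 + K₁ * (4 + 2 * δ)) * Cf * K₂ * Fintype.card ι *
          subexp β (cm * δ' ^ β / 2 / 2) N * subexp β (cm * δ' ^ β / 2 / 2) Z := by
    have hX0 : 0 ≤ X := hN0.le.trans hNX
    have h3 := hpoly X
    rw [abs_of_nonneg hX0, ← subexp_mul_arg hδ'.le, subexp_half β (cm * δ' ^ β / 2)] at h3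
    have h4 : subexp β (cm * δ' ^ β / 2 / 2) X ≤ subexp β (cm * δ' ^ β / 2 / 2) N :=
      subexp_le_of_abs_le h0.le (by positivity) (by rwa [abs_of_pos hN0, abs_of_nonneg hX0])
    have h5 : subexp β (cm * δ' ^ β / 2 / 2) X ≤ subexp β (cm * δ' ^ β / 2 / 2) Z :=
      subexp_le_of_abs_le h0.le (by positivity)
        (by rwa [abs_of_nonneg (norm_nonneg _), abs_of_nonneg hX0])
    have h6 := mul_le_mul h4 h5 (subexp_pos _ _ _).le (subexp_pos _ _ _).le
    calc _ ≤ (1 + K₁ * (4 + 2 * δ)) * Cf * Fintype.card ι *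
          ((1 + X) ^ (M + 1) * subexp β cm (δ' * X)) := h
      _ ≤ (1 + K₁ * (4 + 2 * δ)) * Cf * Fintype.card ι *
          (K₂ * (subexp β (cm * δ' ^ β / 2 / 2) N * subexp β (cm * δ' ^ β / 2 / 2) Z)) := by
          refine mul_le_mul_of_nonneg_left (h3.trans ?_) (by positivity)
          exact mul_le_mul_of_nonneg_left h6 hK₂.le
      _ = _ := by ring
  have hF1' (X : ℝ) (hNX : N ≤ X) (hνX : |ν| ≤ X) (i : ι) (x : ℝ) :
      ‖c i * multiplierFunctional G (A i) (schwartzMul (ψ i) (timeFreqShift x (-ν) gaussian))‖ ≤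
        Cf * (1 + X) ^ M * subexp β c₁ (x - σ₁ i) := by
    have hX1 : 1 ≤ 1 + X := by linarith
    have hX0 : 0 ≤ X := by linarith
    rw [norm_mul]
    have hS := subexp_pos β c₁ (x - σ₁ i)
    calc _ ≤ 1 * (C₁ * (1 + |σ₁ i|) ^ r₁ * (1 + |ν|) ^ r₁ * subexp β c₁ (x - σ₁ i)) :=
          mul_le_mul (hc i) (hF1 _ _ _ _ _ _ (hT i) (hV i)) (norm_nonneg _) zero_le_one
      _ ≤ 1 * (Cf * (1 + X) ^ r₁ * (1 + X) ^ r₁ * subexp β c₁ (x - σ₁ i)) := by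
          gcongr
          · linarith
          · exact (hσ₁ i).trans hNX
      _ = Cf * (1 + X) ^ (2 * r₁) * subexp β c₁ (x - σ₁ i) := by ring
      _ ≤ _ := by gcongr; omega
  have hF2' (X : ℝ) (hNX : N ≤ X) (i : ι) (ξ : ℝ) :
      ‖c i * multiplierFunctional G (A i) (timeFreqShift 0 ξ (ψ i))‖ ≤
        Cf * (1 + X) ^ M * subexp β c₂ (ξ + σ₂ i) := by
    have hX1 : 1 ≤ 1 + X := by linarith
    have hX0 : 0 ≤ X := by linarith
    rw [norm_mul]
    have hS := subexp_pos β c₂ (ξ + σ₂ i)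
    calc _ ≤ 1 * (C₂ * (1 + |σ₁ i|) ^ r₂ * (1 + |σ₂ i|) ^ r₂ * subexp β c₂ (ξ + σ₂ i)) :=
          mul_le_mul (hc i) (hF2 _ _ _ _ _ (hT i) (hV i)) (norm_nonneg _) zero_le_one
      _ ≤ 1 * (Cf * (1 + X) ^ r₂ * (1 + X) ^ r₂ * subexp β c₂ (ξ + σ₂ i)) := by
          gcongr
          · linarith
          · exact (hσ₁ i).trans hNX
          · exact (hσ₂ i).trans hNX
      _ = Cf * (1 + X) ^ (2 * r₂) * subexp β c₂ (ξ + σ₂ i) := by ring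
      _ ≤ _ := by gcongr; omega
  -- If t is far from every σ₁ i, the decay in time of single atoms already suffices.
  have hdirect (X : ℝ) (hNX : N ≤ X) (hνX : |ν| ≤ X) (h : ∀ i, δ' * X ≤ |t - σ₁ i|) :
      ‖∑ i, c i * multiplierFunctional G (A i)
        (schwartzMul (ψ i) (timeFreqShift t (-ν) gaussian))‖ ≤
        (1 + K₁ * (4 + 2 * δ)) * Cf * Fintype.card ι *
          ((1 + X) ^ (M + 1) * subexp β cm (δ' * X)) := by
    have hX0 : 0 ≤ X := by linarith
    have hS := subexp_pos β cm (δ' * X)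
    calc _ ≤ ∑ _i : ι, Cf * (1 + X) ^ M * subexp β cm (δ' * X) := by
          refine (norm_sum_le _ _).trans (Finset.sum_le_sum fun i _ => ?_)
          refine (hF1' X hNX hνX i t).trans (mul_le_mul_of_nonneg_left ?_ (by positivity))
          exact hmono (by linarith) (by positivity) (h i)
      _ = 1 * Cf * Fintype.card ι * ((1 + X) ^ M * subexp β cm (δ' * X)) := by
          rw [Finset.sum_const, Finset.card_univ, nsmul_eq_mul]; ring
      _ ≤ _ := by
          gcongr
          · exact le_add_of_nonneg_right (by positivity)
          · linarith
          · omega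
  -- Otherwise the atom is periodized. Each character must be annihilated, or be suppressed by its
  -- Gaussian coefficient together with the distance of ν from σ₂ i, or be suppressed by its own
  -- distance from -σ₂ i.
  have hpoisson (X P D : ℝ) (hNX : N ≤ X) (hνX : |ν| ≤ X) (hD : 1 ≤ D) (hDP : D ≤ P)
      (hPX : P ≤ (3 + 2 * δ) * (1 + X)) (hDX : δ' * X ≤ D) (hσP : ∀ i, |t - σ₁ i| ≤ P - D)
      (hl : ∀ l : ℤ, ∑ i, c i * multiplierFunctional G (A i) (timeFreqShift 0 (l / P) (ψ i)) = 0 ∨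
        ∀ i, δ' * X ≤ |ν - σ₂ i| ∨ δ' * X ≤ |l / P + σ₂ i|) :
      ‖∑ i, c i * multiplierFunctional G (A i)
        (schwartzMul (ψ i) (timeFreqShift t (-ν) gaussian))‖ ≤
        (1 + K₁ * (4 + 2 * δ)) * Cf * Fintype.card ι *
          ((1 + X) ^ (M + 1) * subexp β cm (δ' * X)) := by
    have hX0 : 0 ≤ X := by linarith
    have hS := subexp_pos β cm (δ' * X)
    have h := hper ι ψ (fun i => c i • multiplierFunctional G (A i)) σ₁ t ν P D
      (Cf * (1 + X) ^ M) (Fintype.card ι * (Cf * (1 + X) ^ M * subexp β cm (δ' * X)))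
      (fun i => hb.fourierInv_timeFreqShift h0 h1 _ _) hD hDP (by positivity) hσP
      (fun i x => hF1' X hNX hνX i x) (fun l => ?_)
    · refine h.trans ?_
      have hS2 : subexp β (c₁ / 2) D ≤ subexp β cm (δ' * X) :=
        hmono hm₁ (by positivity) (hDX.trans (le_abs_self D))
      calc _ ≤ K₁ * ((3 + 2 * δ) * (1 + X) * (Fintype.card ι *
            (Cf * (1 + X) ^ M * subexp β cm (δ' * X))) +
            Fintype.card ι * (Cf * (1 + X) ^ M) * subexp β cm (δ' * X)) := by
            gcongr
        _ = K₁ * ((3 + 2 * δ) * (1 + X) + 1) * (Cf * Fintype.card ι) *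
            ((1 + X) ^ M * subexp β cm (δ' * X)) := by ring
        _ ≤ ((1 + K₁ * (4 + 2 * δ)) * (1 + X)) * (Cf * Fintype.card ι) *
            ((1 + X) ^ M * subexp β cm (δ' * X)) := by
            refine mul_le_mul_of_nonneg_right (mul_le_mul_of_nonneg_right ?_ (by positivity))
              (by positivity)
            have := mul_nonneg hK₁.le hX0
            linarith
        _ = _ := by ring
    · rcases hl l with hz | hi
      · change _ * ‖∑ i, c i * multiplierFunctional G (A i) (timeFreqShift 0 (l / P) (ψ i))‖ ≤ _
        rw [hz, norm_zero, mul_zero]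
        positivity
      · calc _ ≤ subexp β cm (l / P + ν) * ∑ i, Cf * (1 + X) ^ M * subexp β cm (l / P + σ₂ i) := by
              refine mul_le_mul (subexp_le_of_const_le hm₀ _) ?_ (norm_nonneg _)
                (subexp_pos _ _ _).le
              refine (norm_sum_le _ _).trans (Finset.sum_le_sum fun i _ => ?_)
              exact (hF2' X hNX i _).trans (mul_le_mul_of_nonneg_left
                (subexp_le_of_const_le hm₂ _) (by positivity))
          _ = ∑ i, Cf * (1 + X) ^ M * (subexp β cm (l / P + ν) * subexp β cm (l / P + σ₂ i)) := by
              rw [Finset.mul_sum]; exact Finset.sum_congr rfl fun i _ => by ring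
          _ ≤ ∑ _i : ι, Cf * (1 + X) ^ M * subexp β cm (δ' * X) := by
              refine Finset.sum_le_sum fun i _ => mul_le_mul_of_nonneg_left ?_ (by positivity)
              rcases hi i with h' | h'
              · have h2 := subexp_sub_mul_le h0.le h1 hcm.le (l / P : ℝ) (-ν) (-σ₂ i)
                rw [sub_neg_eq_add, sub_neg_eq_add] at h2
                refine h2.trans (hmono le_rfl (by positivity) (h'.trans_eq ?_))
                rw [← abs_neg]; congr 1; ring
              · refine (mul_le_of_le_one_left (subexp_pos _ _ _).le
                  (subexp_le_one hcm.le _)).trans (hmono le_rfl (by positivity) h')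
          _ = _ := by rw [Finset.sum_const, Finset.card_univ, nsmul_eq_mul]
  have hδ'N : δ' * (2 * N) ≤ δ * N := by
    have := mul_le_mul_of_nonneg_right hδ'2 hN0.le
    linarith
  have hδN0 : 0 < δ * N := mul_pos hδ hN0
  rcases le_or_gt (2 * N) Z with hbig | hsmall
  · have hNZ : N ≤ Z := by linarith
    have hδZ : δ' * Z ≤ Z / 2 := by
      have := mul_le_mul_of_nonneg_right hδ'1 (norm_nonneg (t, ν))
      linarith
    have hδZ0 : 0 ≤ δ * Z := mul_nonneg hδ.le (norm_nonneg _)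
    refine hfinal Z hNZ le_rfl ?_
    rcases le_total |t| |ν| with h | h
    · rw [max_eq_right h] at hZmax
      -- Far away in frequency: |t - σ₁ i| ≤ Z + N ≤ 2 Z = P - D, and |ν - σ₂ i| ≥ Z / 2, so no
      -- annihilation is needed.
      refine hpoisson Z (3 * Z) Z hNZ hZν (by linarith) (by linarith) (by linarith)
        (by linarith) (fun i => ?_) (fun l => Or.inr fun i => Or.inl ?_)
      · have := abs_sub t (σ₁ i)
        have := hσ₁ i
        linarith
      · have := abs_sub_abs_le_abs_sub ν (σ₂ i)
        have := hσ₂ i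
        linarith
    · rw [max_eq_left h] at hZmax
      refine hdirect Z hNZ hZν fun i => ?_
      have := abs_sub_abs_le_abs_sub t (σ₁ i)
      have := hσ₁ i
      linarith
  · refine hfinal (2 * N) (by linarith) hsmall.le ?_
    have hν2 : |ν| ≤ 2 * N := hZν.trans hsmall.le
    rcases le_or_gt (N * (1 + δ)) |t| with h | h
    · refine hdirect (2 * N) (by linarith) hν2 fun i => ?_
      have := abs_sub_abs_le_abs_sub t (σ₁ i)
      have := hσ₁ i
      linarith
    · refine hpoisson (2 * N) (2 * N * (1 + 2 * δ)) (3 * δ * N) (by linarith) hν2 hδN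
        (by linarith) (by linarith) (by linarith) (fun i => ?_) (fun l => ?_)
      · have := abs_sub t (σ₁ i)
        have := hσ₁ i
        linarith
      · rcases le_or_gt |(l / (2 * N * (1 + 2 * δ)) : ℝ)| (N * (1 + 2 * δ)) with hl | hl
        · exact Or.inl (hann l hl)
        · refine Or.inr fun i => Or.inr ?_
          have := abs_sub_abs_le_abs_sub (l / (2 * N * (1 + 2 * δ)) : ℝ) (-σ₂ i)
          rw [abs_neg, sub_neg_eq_add] at this
          have := hσ₂ i
          linarith

/-! ### Counting -/

/-- Fewer equations than unknowns leave a nonzero kernel vector, which is divided by its largest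
modulus. -/
theorem exists_annihilating_coefficients {ι Λ : Type*} [Fintype ι] [Fintype Λ]
    (h : Fintype.card Λ < Fintype.card ι) (E : Λ → ι → ℂ) :
    ∃ c : ι → ℂ, (∀ i, ‖c i‖ ≤ 1) ∧ (∃ i, ‖c i‖ = 1) ∧ ∀ l, ∑ i, c i * E l i = 0 := by
  classical
  obtain ⟨v, hv, hv0⟩ := Submodule.exists_mem_ne_zero_of_ne_bot
    (LinearMap.ker_ne_bot_of_finrank_lt (f := Matrix.mulVecLin (Matrix.of E)) (by simpa using h))
  have hne : Nonempty ι := by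
    obtain ⟨i, -⟩ := Function.ne_iff.mp hv0
    exact ⟨i⟩
  obtain ⟨i₀, -, hi₀⟩ := Finset.exists_max_image Finset.univ (fun i => ‖v i‖) Finset.univ_nonempty
  have hpos : 0 < ‖v i₀‖ := by
    obtain ⟨i, hi⟩ := Function.ne_iff.mp hv0
    exact (norm_pos_iff.mpr hi).trans_le (hi₀ i (Finset.mem_univ i))
  refine ⟨fun i => v i / (‖v i₀‖ : ℂ), fun i => ?_, ⟨i₀, ?_⟩, fun l => ?_⟩
  · rw [norm_div, Complex.norm_real, norm_norm, div_le_one hpos]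
    exact hi₀ i (Finset.mem_univ i)
  · rw [norm_div, Complex.norm_real, norm_norm, div_self hpos.ne']
  · have h1 : ∑ i, E l i * v i = 0 := congrFun (LinearMap.mem_ker.mp hv) l
    calc ∑ i, v i / (‖v i₀‖ : ℂ) * E l i = (∑ i, E l i * v i) / (‖v i₀‖ : ℂ) := by
          rw [Finset.sum_div]; exact Finset.sum_congr rfl fun i _ => by ring
      _ = 0 := by rw [h1, zero_div]

/-- The integers of absolute value at most `x`. -/
def intBox (x : ℝ) : Finset ℤ := Finset.Icc (-⌊x⌋) ⌊x⌋

theorem mem_intBox {x : ℝ} {l : ℤ} : l ∈ intBox x ↔ |(l : ℝ)| ≤ x := by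
  rw [intBox, Finset.mem_Icc, abs_le, Int.le_floor, neg_le, Int.le_floor]
  push_cast
  rw [neg_le]

theorem card_intBox {x : ℝ} (hx : 0 ≤ x) : ((intBox x).card : ℝ) = 2 * ⌊x⌋ + 1 := by
  have h := Int.floor_nonneg.mpr hx
  rw [intBox, Int.card_Icc]
  have : ((⌊x⌋ + 1 - -⌊x⌋).toNat : ℤ) = 2 * ⌊x⌋ + 1 := by omega
  exact_mod_cast this

theorem card_intBox_le {x : ℝ} (hx : 0 ≤ x) : ((intBox x).card : ℝ) ≤ 2 * x + 1 := by
  rw [card_intBox hx]; linarith [Int.floor_le x]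

theorem le_card_intBox {x : ℝ} (hx : 0 ≤ x) : 2 * x - 1 ≤ ((intBox x).card : ℝ) := by
  rw [card_intBox hx]; linarith [Int.lt_floor_add_one x]

/-- The leading terms are 4 N² Q on the left and 4 N² J / (s₁ s₂) on the right; rounding affects
only lower orders. -/
theorem exists_card_lt {s₁ s₂ Q : ℝ} (h1 : 0 < s₁) (h2 : 0 < s₂) (hQ : 0 ≤ Q) {J : ℕ}
    (h : s₁ * s₂ * Q < J) : ∃ N₀ : ℝ, ∀ N, N₀ ≤ N →
      (intBox (2 * N ^ 2 * Q)).card < J * (intBox (N / s₁)).card * (intBox (N / s₂)).card := by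
  -- Here d is the surplus in the quadratic coefficient, while e below is the linear loss from
  -- rounding.
  set d := 4 * (J / (s₁ * s₂) - Q) with hd
  have hd0 : 0 < d := by
    rw [hd]
    have : Q < J / (s₁ * s₂) := by rw [lt_div_iff₀ (by positivity)]; linarith
    linarith
  set e := 2 * J * (1 / s₁ + 1 / s₂) with he
  have he0 : 0 ≤ e := by positivity
  refine ⟨max (max (s₁ / 2) (s₂ / 2)) (max 1 ((e + 2) / d)), fun N hN => ?_⟩
  simp only [max_le_iff] at hN
  obtain ⟨⟨hN1, hN2⟩, hN3, hN4⟩ := hN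
  rw [div_le_iff₀ hd0] at hN4
  have hN0 : 0 < N := by linarith
  have hx1 : 0 ≤ 2 * (N / s₁) - 1 := by
    rw [sub_nonneg, ← mul_div_assoc, le_div_iff₀ h1]; linarith
  have hx2 : 0 ≤ 2 * (N / s₂) - 1 := by
    rw [sub_nonneg, ← mul_div_assoc, le_div_iff₀ h2]; linarith
  have hlow : (J : ℝ) * (2 * (N / s₁) - 1) * (2 * (N / s₂) - 1) ≤
      J * (intBox (N / s₁)).card * (intBox (N / s₂)).card := by
    gcongr
    · exact le_card_intBox (by positivity)
    · exact le_card_intBox (by positivity)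
  have hup := card_intBox_le (x := 2 * N ^ 2 * Q) (by positivity)
  have hmid : 2 * (2 * N ^ 2 * Q) + 1 < (J : ℝ) * (2 * (N / s₁) - 1) * (2 * (N / s₂) - 1) := by
    have hexp : (J : ℝ) * (2 * (N / s₁) - 1) * (2 * (N / s₂) - 1) =
        2 * (2 * N ^ 2 * Q) + N * (N * d) - N * e + J := by
      rw [hd, he]; field_simp; ring
    rw [hexp]
    have hJ : (0 : ℝ) ≤ J := Nat.cast_nonneg J
    have := mul_le_mul_of_nonneg_left hN4 hN0.le
    linarith
  have := hup.trans_lt (hmid.trans_le hlow)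
  exact_mod_cast this

/-! ### Grid sets -/

/-- The rectangle of the grid with index `(k, p)`. -/
def gridCell (K L : ℕ) (i : ℤ × ℤ) : Set (ℝ × ℝ) :=
  Set.Ico ((i.1 : ℝ) / K) ((i.1 : ℝ) / K + 1 / K) ×ˢ
    Set.Ico ((i.2 : ℝ) * K / L) ((i.2 : ℝ) * K / L + K / L)

theorem volume_gridCell {K L : ℕ} (hK : 0 < K) (i : ℤ × ℤ) :
    volume (gridCell K L i) = ENNReal.ofReal (1 / L) := by
  rw [gridCell, Measure.volume_eq_prod, Measure.prod_prod, Real.volume_Ico, Real.volume_Ico,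
    add_sub_cancel_left, add_sub_cancel_left, ← ENNReal.ofReal_mul (by positivity)]
  have : (K : ℝ) ≠ 0 := by positivity
  congr 1
  field_simp

/-- Every cell has area 1 / L, so L cells cover area at most 1. Passing to the image of the indexing
discards repetitions in the union. -/
theorem exists_gridCells_of_one_lt_innerContent {M : Set (ℝ × ℝ)} (h : 1 < innerContent M) :
    ∃ (K L : ℕ) (S : Finset (ℤ × ℤ)), 0 < K ∧ 0 < L ∧ L < S.card ∧ ∀ i ∈ S, gridCell K L i ⊆ M := by
  classical
  obtain ⟨c, ⟨K, L, U, hK, hL, ⟨J, k, p, rfl⟩, hUM, rfl⟩, hc⟩ := lt_sSup_iff.mp h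
  refine ⟨K, L, Finset.univ.image fun j => (k j, p j), hK, hL, ?_, fun i hi => ?_⟩
  · by_contra hcard
    rw [not_lt] at hcard
    refine hc.not_ge ?_
    have hsub : (⋃ j, Set.Ico ((k j : ℝ) / K) ((k j : ℝ) / K + 1 / K) ×ˢ
        Set.Ico ((p j : ℝ) * K / L) ((p j : ℝ) * K / L + K / L)) ⊆
        ⋃ i ∈ Finset.univ.image fun j => (k j, p j), gridCell K L i :=
      Set.iUnion_subset fun j => Set.subset_biUnion_of_mem (u := gridCell K L)
        (Finset.mem_image_of_mem (fun j => (k j, p j)) (Finset.mem_univ j))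
    refine (measure_mono hsub).trans ((measure_biUnion_finset_le _ _).trans ?_)
    simp_rw [volume_gridCell hK]
    rw [Finset.sum_const, nsmul_eq_mul, ← ENNReal.ofReal_natCast,
      ← ENNReal.ofReal_mul (Nat.cast_nonneg _)]
    have hL' : (0 : ℝ) < L := by exact_mod_cast hL
    refine ENNReal.ofReal_le_one.mpr ?_
    rw [mul_one_div, div_le_one hL']
    exact_mod_cast hcard
  · obtain ⟨j, -, rfl⟩ := Finset.mem_image.mp hi
    exact (Set.subset_iUnion (fun j => gridCell K L (k j, p j)) j).trans hUM

/-- Counting cells in integers leaves a whole unit between L and L + 1. By continuity at zero this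
unit accommodates both losses: the sparser modulation lattice and the enlarged set of characters. -/
theorem exists_oversampling (L : ℕ) :
    ∃ ε : ℝ, 0 < ε ∧ (1 + ε) ^ 2 * L * (1 + 2 * ε) ^ 2 < L + 1 := by
  have hc : ContinuousAt (fun ε : ℝ => (1 + ε) ^ 2 * L * (1 + 2 * ε) ^ 2) 0 := by fun_prop
  have h := hc.eventually_lt (continuousAt_const (y := (L : ℝ) + 1)) (by norm_num)
  obtain ⟨ε, h, hε⟩ := ((h.filter_mono nhdsWithin_le_nhds).and
    (self_mem_nhdsWithin (s := Set.Ioi (0 : ℝ)))).exists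
  exact ⟨ε, hε, h⟩

theorem lt_abs_sub_of_ne {ℓ r : ℝ} (hℓ : 0 < ℓ) (hr : 2 * r < ℓ) (k k' : ℤ) :
    (k + 1 / 2 : ℝ) * ℓ = (k' + 1 / 2) * ℓ ∨ 2 * r < |(k + 1 / 2 : ℝ) * ℓ - (k' + 1 / 2) * ℓ| := by
  by_cases h : k = k'
  · exact Or.inl (by rw [h])
  · refine Or.inr (hr.trans_le ?_)
    have h1 : (1 : ℝ) ≤ |(k : ℝ) - k'| := by
      have : (1 : ℤ) ≤ |k - k'| := Int.one_le_abs (sub_ne_zero.mpr h)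
      exact_mod_cast this
    rw [← sub_mul, abs_mul, abs_of_pos hℓ, add_sub_add_right_eq_sub]
    exact le_mul_of_one_le_left hℓ.le h1

/-! ### Failure of boundedness below -/

theorem exists_windowPair {β ℓ s : ℝ} (h0 : 0 < β) (h1 : β < 1) (hs : 0 < s) (hℓ : 1 / s < ℓ) :
    ∃ (a τ : 𝓢(ℝ, ℂ)) (r : ℝ), r < ℓ / 2 ∧ IsWindowPair β s r a τ := by
  obtain ⟨a, τ, r, hr, h1, h2, h3, h4, h5, h6⟩ := exists_window h0 h1 hs hℓ
  exact ⟨a, τ, r, hr, h1, h2, h3, h4, h5, h6⟩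

theorem IsWindowPair.hasSubexpDecay_fourier {β s r : ℝ} (h0 : 0 < β) (h1 : β ≤ 1)
    {a τ : 𝓢(ℝ, ℂ)} (h : IsWindowPair β s r a τ) : HasSubexpDecay β (𝓕 a) :=
  hasSubexpDecay_of_norm_le h0 h1 h.decay

theorem IsWindowPair.hasSubexpDecay_fourierInv {β s r : ℝ} (h0 : 0 < β) (h1 : β ≤ 1)
    {a τ : 𝓢(ℝ, ℂ)} (h : IsWindowPair β s r a τ) : HasSubexpDecay β (𝓕⁻ a) := by
  obtain ⟨C, c, hC, hc, hd⟩ := h.decay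
  refine hasSubexpDecay_of_norm_le h0 h1 ⟨C, c, hC, hc, fun x => ?_⟩
  rw [fourierInv_apply_eq_neg, ← subexp_neg]
  exact hd _

theorem IsWindowPair.hasSubexpDecay_fourierInv_fourierInv {β s r : ℝ} (h0 : 0 < β) (h1 : β ≤ 1)
    {a τ : 𝓢(ℝ, ℂ)} (h : IsWindowPair β s r a τ) : HasSubexpDecay β (𝓕⁻ (𝓕⁻ a)) :=
  hasSubexpDecay_of_hasCompactSupport h0 h1 (R := r) fun x hx => by
    rw [fourierInv_fourierInv_apply]
    exact h.eq_zero _ (by rwa [abs_neg])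

theorem stft_familyExtension {ι : Type*} [Fintype ι] (A B : ι → 𝓢(ℝ, ℂ)) (c : ι → ℂ)
    (g : 𝓢'(ℝ, ℂ)) (G : 𝓢(ℝ, ℂ) →L[ℂ] ℂ) (hG : ∀ φ, G φ = g φ) (z : ℝ × ℝ) :
    stft (familyExtension A B c g) z = ∑ i, c i * multiplierFunctional G (A i)
      (schwartzMul (𝓕⁻ (B i)) (timeFreqShift z.1 (-z.2) gaussian)) := by
  rw [stft, familyExtension_apply]
  refine Finset.sum_congr rfl fun i _ => ?_
  rw [windowTranspose_apply, multiplierFunctional_apply, hG]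

/-- The windows decay with the exponent β' > β, hence faster than any rate of exponent β demanded by
the weight. -/
theorem mixedNorm_familySymbol_lt_top {ι : Type*} [Fintype ι] {p q : ℝ≥0∞} (hp : 1 ≤ p)
    (hq : 1 ≤ q) {w : ℝ × ℝ → ℝ} {β β' γ C : ℝ} (hβ : 0 < β) (hββ : β < β') (hβ' : β' ≤ 1)
    (hγ : 0 ≤ γ) (hC : 0 < C) (hw0 : ∀ z, 0 ≤ w z) (hw : ∀ z, w z ≤ C * Real.exp (γ * ‖z‖ ^ β))
    {A B : ι → 𝓢(ℝ, ℂ)} (hA : ∀ i, HasSubexpDecay β' (𝓕 (A i)))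
    (hB : ∀ i, HasSubexpDecay β' (𝓕⁻ (B i))) (c : ι → ℂ) :
    mixedNorm p q w (familySymbol A B c) < ∞ := by
  obtain ⟨K, hK, h⟩ := exists_mixedNorm_le hp hq hβ hC hw0 hw
  have hdec {f : 𝓢(ℝ, ℂ)} (hf : HasSubexpDecay β' f) :
      ∃ D, 0 < D ∧ ∀ x, ‖f x‖ ≤ D * subexp β (γ + 2) x := by
    obtain ⟨C₁, c₁, hC₁, hc₁, h₁⟩ := hf 0
    obtain ⟨D₁, hD₁, hd₁⟩ := exists_subexp_le_mul_subexp hβ hββ hc₁ (γ + 2)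
    refine ⟨C₁ * D₁, by positivity, fun x => ?_⟩
    rw [mul_assoc]
    exact ((norm_le_derivSum 0 _ _).trans (h₁ x)).trans
      (mul_le_mul_of_nonneg_left (hd₁ x) hC₁.le)
  choose DA hDA hA' using fun i => hdec (hA i)
  choose DB hDB hB' using fun i => hdec (hB i)
  refine (h (∑ i, ‖c i‖ * (DB i * DA i)) _
    (Finset.sum_nonneg fun i _ => mul_nonneg (norm_nonneg _) (mul_pos (hDB i) (hDA i)).le)
    fun z => ?_).trans_lt ENNReal.ofReal_lt_top
  rw [familySymbol_apply, Finset.sum_mul]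
  refine (norm_sum_le _ _).trans (Finset.sum_le_sum fun i _ => ?_)
  rw [norm_mul, norm_mul, mul_assoc]
  refine mul_le_mul_of_nonneg_left ?_ (norm_nonneg _)
  calc _ ≤ (DB i * subexp β (γ + 2) z.1) * (DA i * subexp β (γ + 2) z.2) :=
        mul_le_mul (hB' i _) (hA' i _) (norm_nonneg _)
          (mul_nonneg (hDB i).le (subexp_pos _ _ _).le)
    _ = DB i * DA i * (subexp β (γ + 2) z.1 * subexp β (γ + 2) z.2) := by ring
    _ ≤ _ := mul_le_mul_of_nonneg_left (mul_subexp_le_subexp_norm (by linarith) z)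
        (mul_pos (hDB i) (hDA i)).le

theorem HasSubexpDecay.fourier_timeFreqShift {β : ℝ} (h0 : 0 < β) (h1 : β ≤ 1) {a : 𝓢(ℝ, ℂ)}
    (ha : HasSubexpDecay β (𝓕 a)) (T σ : ℝ) : HasSubexpDecay β (𝓕 (timeFreqShift T σ a)) := by
  obtain ⟨C, c, hC, hc, h⟩ := ha 0
  refine hasSubexpDecay_of_norm_le h0 h1 ⟨C * (subexp β c σ)⁻¹, c,
    mul_pos hC (inv_pos.mpr (subexp_pos _ _ _)), hc, fun x => ?_⟩
  rw [norm_fourier_timeFreqShift, mul_assoc]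
  exact ((norm_le_derivSum 0 _ _).trans (h _)).trans
    (mul_le_mul_of_nonneg_left (subexp_sub_le h0.le h1 hc.le x σ) hC.le)

theorem mul_mem_gridCell {K L : ℕ} {r₁ r₂ : ℝ} (hr₁ : 2 * r₁ < 1 / K) (hr₂ : 2 * r₂ < K / L)
    (i : ℤ × ℤ) {y : ℝ × ℝ} (h1 : |y.1 - (i.1 + 1 / 2) * (1 / K : ℝ)| ≤ r₁)
    (h2 : |y.2 - (i.2 + 1 / 2) * (K / L : ℝ)| ≤ r₂) : y ∈ gridCell K L i := by
  have e1 : (i.1 + 1 / 2) * (1 / K : ℝ) = i.1 / K + 1 / K / 2 := by ring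
  have e2 : (i.2 + 1 / 2) * (K / L : ℝ) = i.2 * K / L + K / L / 2 := by ring
  rw [e1, abs_le] at h1
  rw [e2, abs_le] at h2
  refine ⟨⟨?_, ?_⟩, ⟨?_, ?_⟩⟩ <;> linarith

set_option maxHeartbeats 1000000 in
/-- Evaluation at a tempered distribution is not bounded below on an operator Paley-Wiener space
over a set of inner content larger than one. -/
theorem not_isBoundedBelowAt {p q : ℝ≥0∞} (hp : 1 ≤ p) (hq : 1 ≤ q) {w : ℝ × ℝ → ℝ}
    (hw : IsSubexponentialWeight w) {M : Set (ℝ × ℝ)} (hvol : 1 < innerContent M)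
    (g : 𝓢'(ℝ, ℂ)) : ¬ IsBoundedBelowAt p q w M g := by
  rintro ⟨A₀, hA₀, hbelow⟩
  obtain ⟨γ, Cw, β, hγ, hCw, hβ, hβ1, hbd⟩ := hw.bounds
  -- The exponent β' exceeds that of the weight, so the final comparison is won, but stays below 1,
  -- so compactly supported windows exist.
  obtain ⟨β', hββ, hβ'1⟩ := exists_between hβ1
  have hβ' : 0 < β' := hβ.trans hββ
  obtain ⟨K, L, S, hK, hL, hS, hSM⟩ := exists_gridCells_of_one_lt_innerContent hvol
  have hKr : (0 : ℝ) < K := by exact_mod_cast hK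
  have hLr : (0 : ℝ) < L := by exact_mod_cast hL
  obtain ⟨ε, hε, hover⟩ := exists_oversampling L
  -- Windows of length strictly less than a cell require lattice steps slightly above the
  -- reciprocals of the side lengths.
  set s₂ : ℝ := (1 + ε) * K with hs₂
  set s₁ : ℝ := (1 + ε) * (L / K) with hs₁
  have hs₁0 : 0 < s₁ := by positivity
  have hs₂0 : 0 < s₂ := by positivity
  have hℓ₁ : 1 / s₂ < 1 / (K : ℝ) := by
    refine one_div_lt_one_div_of_lt hKr ?_
    rw [hs₂]
    nlinarith
  have hℓ₂ : 1 / s₁ < (K : ℝ) / L := by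
    rw [← one_div_div (L : ℝ) K]
    refine one_div_lt_one_div_of_lt (by positivity) ?_
    rw [hs₁]
    have : 0 < (L : ℝ) / K := by positivity
    nlinarith
  obtain ⟨a, τ, r₁, hr₁, ha⟩ := exists_windowPair hβ' hβ'1 hs₂0 hℓ₁
  obtain ⟨b, θ, r₂, hr₂, hb⟩ := exists_windowPair hβ' hβ'1 hs₁0 hℓ₂
  obtain ⟨G, hG⟩ : ∃ G : 𝓢(ℝ, ℂ) →L[ℂ] ℂ, ∀ φ, G φ = g φ := ⟨g, fun _ => rfl⟩
  obtain ⟨R, hR⟩ : ∃ R : ℝ, ∀ i ∈ S, |((i.1 : ℝ) + 1 / 2) * (1 / K : ℝ)| ≤ R ∧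
      |((i.2 : ℝ) + 1 / 2) * (K / L : ℝ)| ≤ R := by
    refine ⟨∑ i ∈ S, (|((i.1 : ℝ) + 1 / 2) * (1 / K : ℝ)| + |((i.2 : ℝ) + 1 / 2) * (K / L : ℝ)|),
      fun i hi => ?_⟩
    have := Finset.single_le_sum (f := fun i : ℤ × ℤ => |((i.1 : ℝ) + 1 / 2) * (1 / K : ℝ)| +
      |((i.2 : ℝ) + 1 / 2) * (K / L : ℝ)|) (fun i _ => by positivity) hi
    constructor
    · exact (le_add_of_nonneg_right (abs_nonneg _)).trans this
    · exact (le_add_of_nonneg_left (abs_nonneg _)).trans this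
  obtain ⟨K₁, κ₁, hK₁, hκ₁, hresp⟩ := exists_norm_family_le hβ' hβ'1.le G
    (ha.hasSubexpDecay_fourier hβ' hβ'1.le) (hb.hasSubexpDecay_fourierInv hβ' hβ'1.le)
    (hb.hasSubexpDecay_fourierInv_fourierInv hβ' hβ'1.le) R hε
  obtain ⟨K₂, κ₂, hK₂, hκ₂, hcoef⟩ := exists_coefficient_le hp hq hβ hβ1.le hββ hγ.le hCw
    (fun z => (hbd z).1) ha hb
  obtain ⟨K₃, hK₃, hmix⟩ := exists_mixedNorm_le hp hq hβ hCw hw.isModerate.nonneg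
    (fun z => (hbd z).2)
  obtain ⟨D₁, hD₁, hd₁⟩ := exists_subexp_le_mul_subexp hβ hββ hκ₁ (γ + 2)
  obtain ⟨D₂, hD₂, hd₂⟩ := exists_pow_mul_subexp_le_subexp hβ' hκ₁ 3
  obtain ⟨D₃, hD₃, hd₃⟩ := exists_subexp_le_mul_subexp hβ hββ (half_pos hκ₁) κ₂
  obtain ⟨N₀, hcount⟩ := exists_card_lt hs₁0 hs₂0 (Q := (1 + 2 * ε) ^ 2) (by positivity) (J := S.card)
    (by
      have h1 : s₁ * s₂ * (1 + 2 * ε) ^ 2 = (1 + ε) ^ 2 * L * (1 + 2 * ε) ^ 2 := by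
        rw [hs₁, hs₂]; field_simp
      rw [h1]
      refine hover.trans_le ?_
      exact_mod_cast hS)
  set W : ℝ := S.card * (2 / s₁ + 1) * (2 / s₂ + 1) with hW
  -- the main inequality for large `N`
  have hmain (N : ℝ) (hN1 : 1 ≤ N) (hN2 : 1 ≤ 3 * ε * N) (hN3 : N₀ ≤ N) :
      (A₀ : ℝ) * (1 + N) ≤ K₂ * (K₃ * (K₁ * W * D₁)) * (D₂ * D₃) := by
    have hN0 : 0 < N := by linarith
    -- An atom is indexed by its cell and by the two modulations that place its symbol in the box of
    -- radius N.
    let ι : Type := S × intBox (N / s₁) × intBox (N / s₂)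
    set T : ι → ℝ := fun i => ((i.1 : ℤ × ℤ).1 + 1 / 2) * (1 / K : ℝ) with hT
    set V : ι → ℝ := fun i => ((i.1 : ℤ × ℤ).2 + 1 / 2) * (K / L : ℝ) with hV
    set n : ι → ℤ := fun i => (i.2.1 : ℤ) with hn
    set m : ι → ℤ := fun i => (i.2.2 : ℤ) with hm
    have hcard : (Fintype.card ι : ℝ) ≤ W * (1 + N) ^ 2 := by
      have h1 : (Fintype.card ι : ℝ) = S.card * ((intBox (N / s₁)).card * (intBox (N / s₂)).card) := by
        have : Fintype.card ι = S.card * ((intBox (N / s₁)).card * (intBox (N / s₂)).card) := by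
          simp [ι]
        exact_mod_cast this
      have h2 {s : ℝ} (hs : 0 < s) : ((intBox (N / s)).card : ℝ) ≤ (2 / s + 1) * (1 + N) := by
        refine (card_intBox_le (by positivity)).trans ?_
        have : 0 < 2 / s := by positivity
        calc 2 * (N / s) + 1 = 2 / s * N + 1 := by ring
          _ ≤ _ := by nlinarith
      rw [h1, hW]
      calc _ ≤ (S.card : ℝ) * (((2 / s₁ + 1) * (1 + N)) * ((2 / s₂ + 1) * (1 + N))) := by
            gcongr
            · exact h2 hs₁0
            · exact h2 hs₂0
        _ = _ := by ring
    have hlt : Fintype.card (intBox (2 * N ^ 2 * (1 + 2 * ε) ^ 2)) < Fintype.card ι := by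
      have := hcount N hN3
      simpa [ι, mul_assoc] using this
    -- One equation for each integer l with |l / P| ≤ N (1 + 2 ε), where P = 2 N (1 + 2 ε); this
    -- means |l| ≤ 2 N² (1 + 2 ε)².
    obtain ⟨c, hc1, ⟨i₀, hi₀⟩, hann⟩ := exists_annihilating_coefficients hlt
      (fun l i => multiplierFunctional G (timeFreqShift (T i) (m i * s₂) a)
        (timeFreqShift 0 (((l : ℤ) : ℝ) / (2 * N * (1 + 2 * ε)))
          (𝓕⁻ (timeFreqShift (V i) (-(n i * s₁)) b))))
    have hns (i : ι) : |n i * s₁| ≤ N := by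
      have := mem_intBox.mp i.2.1.2
      rw [abs_mul, abs_of_pos hs₁0]
      rwa [le_div_iff₀ hs₁0] at this
    have hms (i : ι) : |m i * s₂| ≤ N := by
      have := mem_intBox.mp i.2.2.2
      rw [abs_mul, abs_of_pos hs₂0]
      rwa [le_div_iff₀ hs₂0] at this
    have hresp' := hresp ι T V (fun i => n i * s₁) (fun i => m i * s₂) c N hN1 hN2
      (fun i => (hR i.1 i.1.2).1) (fun i => (hR i.1 i.1.2).2) hns hms hc1 (fun l hl => by
        refine hann ⟨l, mem_intBox.mpr ?_⟩
        have hP : 0 < 2 * N * (1 + 2 * ε) := by positivity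
        rw [abs_div, abs_of_pos hP, div_le_iff₀ hP] at hl
        exact hl.trans_eq (by ring))
    set A := timeAtom a s₂ T m with hA
    set B := freqAtom b s₁ V n with hB
    have hsep₁ (i i' : ι) : T i = T i' ∨ 2 * r₁ < |T i - T i'| :=
      lt_abs_sub_of_ne (by positivity) (by linarith) _ _
    have hsep₂ (i i' : ι) : V i = V i' ∨ 2 * r₂ < |V i - V i'| :=
      lt_abs_sub_of_ne (by positivity) (by linarith) _ _
    have hinj (i i' : ι) (h1 : T i = T i') (h2 : V i = V i') (h3 : n i = n i') (h4 : m i = m i') :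
        i = i' := by
      have hK' : (1 / K : ℝ) ≠ 0 := by positivity
      have hL' : (K / L : ℝ) ≠ 0 := by positivity
      have e1 := mul_right_cancel₀ hK' h1
      have e2 := mul_right_cancel₀ hL' h2
      rw [add_left_inj] at e1 e2
      exact Prod.ext (Subtype.ext (Prod.ext (by exact_mod_cast e1) (by exact_mod_cast e2)))
        (Prod.ext (Subtype.ext h3) (Subtype.ext h4))
    have hcoef' := hcoef ι T V m n N hsep₁ hsep₂ hinj hns hms c i₀
    rw [hi₀, mul_one] at hcoef'
    have hop := opwNorm_eq p q w (isKohnNirenbergSymbol_familyOperator A B c)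
      (isRepresentedBy_familySymbol A B c)
    have hmem : familyOperator A B c ∈ OPW p q w M := by
      refine ⟨⟨_, isKohnNirenbergSymbol_familyOperator A B c, ?_⟩, ?_⟩
      -- The closed rectangles that support the atoms lie strictly inside the half-open cells, so
      -- taking the closure does not leave M.
      · have hZ : IsClosed (⋃ i : ι, Metric.closedBall (T i) r₁ ×ˢ Metric.closedBall (V i) r₂) :=
          isClosed_iUnion_of_finite fun i => Metric.isClosed_closedBall.prod
            Metric.isClosed_closedBall
        refine (dsupport_symplecticFourier_subset A B c hZ fun i y hy => ?_).trans ?_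
        · have hy' : ¬ (|y.1 - T i| ≤ r₁ ∧ |y.2 - V i| ≤ r₂) := fun h =>
            hy (Set.mem_iUnion.mpr ⟨i, h⟩)
          rw [hA, hB, timeAtom, freqAtom, timeFreqShift_apply, timeFreqShift_apply]
          rcases not_and_or.mp hy' with h | h
          · rw [ha.eq_zero _ (not_le.mp h)]; simp
          · rw [hb.eq_zero _ (not_le.mp h)]; simp
        · refine Set.iUnion_subset fun i y hy => hSM i.1 i.1.2 ?_
          exact mul_mem_gridCell (by linarith) (by linarith) _ hy.1 hy.2
      · rw [hop]
        exact mixedNorm_familySymbol_lt_top hp hq hβ hββ hβ'1.le hγ.le hCw hw.isModerate.nonneg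
          (fun z => (hbd z).2)
          (fun i => (ha.hasSubexpDecay_fourier hβ' hβ'1.le).fourier_timeFreqShift hβ' hβ'1.le _ _)
          (fun i =>
            (hb.hasSubexpDecay_fourierInv hβ' hβ'1.le).fourierInv_timeFreqShift hβ' hβ'1.le _ _) c
    have hlow := hbelow _ hmem _ (isExtension_familyOperator A B c)
    rw [hop] at hlow
    have hup : modulationNorm p q w (familyExtension A B c g) ≤
        ENNReal.ofReal (K₃ * (K₁ * Fintype.card ι * subexp β' κ₁ N * D₁)) := by
      have hS1 := subexp_pos β' κ₁ N
      refine hmix _ _ (by positivity) fun z => ?_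
      rw [stft_familyExtension A B c g G hG z]
      have h4 := hresp' z.1 z.2
      have h5 : K₁ * Fintype.card ι * subexp β' κ₁ N * subexp β' κ₁ ‖z‖ ≤
          K₁ * Fintype.card ι * subexp β' κ₁ N * (D₁ * subexp β (γ + 2) ‖z‖) := by
        gcongr; exact hd₁ ‖z‖
      rw [← mul_assoc] at h5
      exact h4.trans h5
    -- The coefficient i₀ has modulus one, so the norm of the symbol is at least of order exp (-κ₂ N
    -- ^ β), whereas the output is of order exp (-κ₁ N ^ β') up to the number of atoms.
    have hcomb : ENNReal.ofReal (A₀ * subexp β κ₂ N) ≤ ENNReal.ofReal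
        (K₂ * (K₃ * (K₁ * Fintype.card ι * subexp β' κ₁ N * D₁))) := by
      rw [ENNReal.ofReal_mul A₀.coe_nonneg, ENNReal.ofReal_mul hK₂.le, ENNReal.ofReal_coe_nnreal]
      calc (A₀ : ℝ≥0∞) * ENNReal.ofReal (subexp β κ₂ N)
          ≤ A₀ * (ENNReal.ofReal K₂ * mixedNorm p q w (familySymbol A B c)) :=
            mul_le_mul_right hcoef' _
        _ = ENNReal.ofReal K₂ * (A₀ * mixedNorm p q w (familySymbol A B c)) := by ring
        _ ≤ _ := mul_le_mul_right (hlow.trans hup) _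
    have hS1 := subexp_pos β' κ₁ N
    rw [ENNReal.ofReal_le_ofReal_iff (by positivity)] at hcomb
    have h1 := hd₂ N
    have h2 := hd₃ N
    rw [abs_of_pos hN0] at h1
    have hS2 := subexp_pos β κ₂ N
    have hW0 : 0 ≤ W := by positivity
    refine le_of_mul_le_mul_right ?_ hS2
    calc (A₀ : ℝ) * (1 + N) * subexp β κ₂ N = (1 + N) * (A₀ * subexp β κ₂ N) := by ring
      _ ≤ (1 + N) * (K₂ * (K₃ * (K₁ * (W * (1 + N) ^ 2) * subexp β' κ₁ N * D₁))) := by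
          refine mul_le_mul_of_nonneg_left (hcomb.trans ?_) (by positivity)
          gcongr
      _ = K₂ * (K₃ * (K₁ * W * D₁)) * ((1 + N) ^ 3 * subexp β' κ₁ N) := by ring
      _ ≤ K₂ * (K₃ * (K₁ * W * D₁)) * (D₂ * (D₃ * subexp β κ₂ N)) := by
          refine mul_le_mul_of_nonneg_left (h1.trans ?_) (by positivity)
          gcongr
      _ = _ := by ring
  have hA₀' : (0 : ℝ) < A₀ := by exact_mod_cast hA₀
  set X := K₂ * (K₃ * (K₁ * W * D₁)) * (D₂ * D₃)
  -- The factor 1 + N retained in `hmain` makes N ≥ X / A₀ enough for a contradiction.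
  set N := max (max 1 (1 / (3 * ε))) (max N₀ (X / A₀)) with hN
  have hN2 : 1 / (3 * ε) ≤ N := (le_max_right _ _).trans (le_max_left _ _)
  have hN4 : X / A₀ ≤ N := (le_max_right _ _).trans (le_max_right _ _)
  rw [div_le_iff₀ (by positivity)] at hN2
  rw [div_le_iff₀ hA₀'] at hN4
  have := hmain N ((le_max_left _ _).trans (le_max_left _ _)) (by linarith)
    ((le_max_left _ _).trans (le_max_right _ _))
  linarith

end OperatorSampling

end

theorem mainTheorem2 (p q : ℝ≥0∞) (hp : 1 ≤ p) (hq : 1 ≤ q)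
    (w : ℝ × ℝ → ℝ) (hw : OperatorSampling.IsSubexponentialWeight w)
    (M : Set (ℝ × ℝ)) (hM : Bornology.IsBounded M)
    (hvol : 1 < OperatorSampling.innerContent M) :
    ¬ OperatorSampling.IsIdentifiable p q w M ∧
      ∀ g ∈ OperatorSampling.modulationSpace ∞ ∞ (fun _ => 1),
        ¬ OperatorSampling.IsBoundedBelowAt p q w M g :=
  ⟨fun ⟨g, _, h, _⟩ => OperatorSampling.not_isBoundedBelowAt hp hq hw hvol g h,
    fun g _ => OperatorSampling.not_isBoundedBelowAt hp hq hw hvol g⟩
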